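/- Let $n,m\ge 1$ be integers and let $\mathbf X\subset\mathbb R^n$ be a non-empty bounded open set (no regularity of the boundary is assumed). Let $a\in C^\infty(\mathbb R^n\times\mathbb R^n)$ be a classical symbol of order $2m$, that is, $a(x,\xi)\sim\sum_{j\ge 0}(1-\chi(\xi))\,a_{2m-j}(x,\xi)$, where $\chi\in C_c^\infty(\mathbb R^n)$ equals $1$ near $0$, each $a_{2m-j}$ is smooth on $\mathbb R^n\times(\mathbb R^n\setminus\{0\})$ and positively homogeneous of degree $2m-j$ in $\xi$, and for every $N\ge 0$ the remainder $r=a-\sum_{j<N}(1-\chi)a_{2m-j}$ satisfies $|\partial_\xi^\alpha\partial_x^\beta r(x,\xi)|\le C_{K,\alpha,\beta}(1+|\xi|^2)^{(2m-N-|\alpha|)/2}$ for $x$ in a compact set $K$, $\xi\in\mathbb R^n$. Let $$A_0u(x)=(2\pi)^{-n}\int e^{ix\cdot\xi}\,a(x,\xi)\Big(\int e^{-iy\cdot\xi}u(y)\,dy\Big)d\xi ,\qquad u\in C_c^\infty(\mathbb R^n),$$ be the corresponding pseudodifferential operator. Assume that $A_0$ is symmetric, $(A_0u,v)_{L^2(\mathbb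 R^n)}=(u,A_0v)_{L^2(\mathbb R^n)}$ for all $u,v\in C_c^\infty(\mathbb R^n)$, and that there is a constant $C_0>0$ such that its principal symbol satisfies $$a_{2m}(x,\xi)\ge C_0|\xi|^{2m}\qquad\text{for all }x\in\mathbf X,\ \xi\in\mathbb R^n\setminus\{0\}.$$ Let $A$ be the Friedrichs extension in $L^2(\mathbf X)$ of the operator $\mathrm{res}\circ A_0\circ\mathrm{ext}:C_c^\infty(\mathbf X)\to L^2(\mathbf X)$, where $\mathrm{ext}$ is extension by zero and $\mathrm{res}$ is restriction to $\mathbf X$. Let $H^m(\mathbf X)$ be the Sobolev space of all $u\in L^2(\mathbf X)$ with weak derivatives $\partial^\alpha u\in L^2(\mathbf X)$, $|\alpha|\le m$, with norm $\|u\|_{H^m(\mathbf X)}^2=\sum_{|\alpha|\le m}\|\partial^\alpha u\|_{L^2(\mathbf X)}^2$, and let $H_0^m(\mathbf X)$ be the closure of $C_c^\infty(\mathbf X)$ in $H^m(\mathbf X)$. Then: (a) $A$ is a self-adjoint extension of $\mathrm{res}\circ A_0\circ\mathrm{ext}$ and has compact resolvent: its resolvent set is non-empty, and $(A-z)^{-1}$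 is a compact operator for every $z$ in it. (b) The spectrum of $A$ is discrete: it consists of a strictly increasing sequence of real eigenvalues of finite multiplicity tending to $+\infty$. (c) $D(A)\subset H_0^m(\mathbf X)$, and there are constants $C,M>0$ such that $$((A+M)u,u)_{L^2(\mathbf X)}\ge C\,\|u\|_{H^m(\mathbf X)}^2\qquad\text{for all }u\in D(A).$$ -/

import Mathlib

open MeasureTheory Filter Topology TopologicalSpace
open scoped Distributions ContDiff

noncomputable section

namespace WeylPDO

/-! ### Partial derivatives and symbols on `ℝⁿ` -/

/-- `ℝⁿ` with its Euclidean norm. -/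
abbrev Euc (n : ℕ) : Type := EuclideanSpace ℝ (Fin n)

/-- The partial derivative `∂ᵢ f`. -/
def partialDeriv {n : ℕ} (i : Fin n) (f : Euc n → ℂ) : Euc n → ℂ :=
  fun x => fderiv ℝ f x (EuclideanSpace.single i 1)

/-- The partial derivative `∂^α f = ∂₁^{α₁} ⋯ ∂ₙ^{αₙ} f` for a multi-index `α`. -/
def multiDeriv {n : ℕ} (α : Fin n → ℕ) (f : Euc n → ℂ) : Euc n → ℂ :=
  (List.finRange n).foldr (fun i g => (partialDeriv i)^[α i] g) f

/-- The mixed derivative `∂_ξ^α ∂_x^β a (x, ξ)`. -/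
def symbolDeriv {n : ℕ} (α β : Fin n → ℕ) (a : Euc n → Euc n → ℂ) (x ξ : Euc n) : ℂ :=
  multiDeriv β (fun y => multiDeriv α (fun η => a y η) ξ) x

/-- The symbol class `S^s_{1,0}(ℝⁿ × ℝⁿ)`: smooth functions with
`|∂_ξ^α ∂_x^β a(x,ξ)| ≤ C_{K,α,β} ⟨ξ⟩^{s-|α|}` for `x` in the compact set `K`. -/
structure IsSymbol {n : ℕ} (s : ℝ) (a : Euc n → Euc n → ℂ) : Prop where
  smooth : ContDiff ℝ ∞ (fun z : Euc n × Euc n => a z.1 z.2)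
  bound : ∀ K : Set (Euc n), IsCompact K → ∀ α β : Fin n → ℕ, ∃ C : ℝ, ∀ x ∈ K, ∀ ξ : Euc n,
    ‖symbolDeriv α β a x ξ‖ ≤ C * (1 + ‖ξ‖ ^ 2) ^ ((s - ∑ i, (α i : ℝ)) / 2)

/-- A classical symbol of integer order `d` on `ℝⁿ × ℝⁿ`: a function `a` with an asymptotic
expansion `a(x,ξ) ∼ ∑_{j ≥ 0} (1 - χ(ξ)) a_{d-j}(x,ξ)`, where `χ` is a smooth compactly supported
function equal to `1` near `0`, and `a_{d-j} = part j` is smooth on `ℝⁿ × (ℝⁿ ∖ 0)` and positively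
homogeneous of degree `d - j` in `ξ`. The expansion means that
`a - ∑_{j < N} (1 - χ) a_{d-j}` is a symbol of order `d - N` for all `N`. -/
structure ClassicalSymbol (n : ℕ) (d : ℤ) where
  toFun : Euc n → Euc n → ℂ
  part : ℕ → Euc n → Euc n → ℂ
  cutoff : Euc n → ℝ
  cutoff_smooth : ContDiff ℝ ∞ cutoff
  cutoff_compact : HasCompactSupport cutoff
  cutoff_one : ∀ᶠ ξ in 𝓝 (0 : Euc n), cutoff ξ = 1
  part_smooth : ∀ j, ContDiffOn ℝ ∞ (fun z : Euc n × Euc n => part j z.1 z.2) {z | z.2 ≠ 0}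
  part_homogeneous : ∀ j, ∀ x ξ : Euc n, ξ ≠ 0 → ∀ t : ℝ, 0 < t →
    part j x (t • ξ) = ((t ^ (d - (j : ℤ)) : ℝ) : ℂ) * part j x ξ
  expansion : ∀ N : ℕ, IsSymbol ((d : ℝ) - N)
    (fun x ξ => toFun x ξ - ∑ j ∈ Finset.range N, ((1 - cutoff ξ : ℝ) : ℂ) * part j x ξ)

/-- The principal symbol `a_d`. -/
def ClassicalSymbol.principal {n : ℕ} {d : ℤ} (σ : ClassicalSymbol n d) : Euc n → Euc n → ℂ :=
  σ.part 0

/-! ### Pseudodifferential operators -/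

/-- `∫ e^{-i y·ξ} u(y) dy`. -/
def fourierInt {n : ℕ} (u : Euc n → ℂ) (ξ : Euc n) : ℂ :=
  ∫ y, Complex.exp (-(Complex.I * ((inner ℝ y ξ : ℝ) : ℂ))) * u y

/-- The pseudodifferential operator with left symbol `a`:
`(2π)⁻ⁿ ∫ (∫ e^{i (x-y)·ξ} a(x,ξ) u(y) dy) dξ`. -/
def pdo {n : ℕ} (a : Euc n → Euc n → ℂ) (u : Euc n → ℂ) (x : Euc n) : ℂ :=
  (((2 * Real.pi) ^ n : ℝ) : ℂ)⁻¹ *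
    ∫ ξ, Complex.exp (Complex.I * ((inner ℝ x ξ : ℝ) : ℂ)) * a x ξ * fourierInt u ξ

/-- The operator with symbol `σ` is symmetric: `(A₀ u, v) = (u, A₀ v)` for all
`u, v ∈ C_c^∞(ℝⁿ)`. -/
def ClassicalSymbol.IsSymmetric {n : ℕ} {d : ℤ} (σ : ClassicalSymbol n d) : Prop :=
  ∀ u v : 𝓓((⊤ : Opens (Euc n)), ℂ),
    ∫ x, pdo σ.toFun u x * starRingEnd ℂ (v x) = ∫ x, u x * starRingEnd ℂ (pdo σ.toFun v x)

theorem multiDeriv_zero {n : ℕ} (f : Euc n → ℂ) : multiDeriv 0 f = f := by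
  unfold multiDeriv
  induction List.finRange n with
  | nil => rfl
  | cons i l _ => simp

theorem ClassicalSymbol.isSymbol {n : ℕ} {d : ℤ} (σ : ClassicalSymbol n d) :
    IsSymbol d σ.toFun := by
  simpa using σ.expansion 0

theorem IsSymbol.exists_bound {n : ℕ} {s : ℝ} {a : Euc n → Euc n → ℂ} (ha : IsSymbol s a)
    {K : Set (Euc n)} (hK : IsCompact K) :
    ∃ (C : ℝ) (k : ℕ), ∀ x ∈ K, ∀ ξ : Euc n, ‖a x ξ‖ ≤ C * (1 + ‖ξ‖ ^ 2) ^ k := by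
  obtain ⟨C, hC⟩ := ha.bound K hK 0 0
  refine ⟨|C|, ⌈s / 2⌉₊, fun x hx ξ => ?_⟩
  have h := hC x hx ξ
  simp only [symbolDeriv, multiDeriv_zero] at h
  refine h.trans ?_
  have h1 : (1 : ℝ) ≤ 1 + ‖ξ‖ ^ 2 := by nlinarith [sq_nonneg ‖ξ‖]
  have h2 : (1 + ‖ξ‖ ^ 2) ^ ((s - ∑ i : Fin n, (((0 : Fin n → ℕ) i : ℕ) : ℝ)) / 2)
      ≤ (1 + ‖ξ‖ ^ 2) ^ ⌈s / 2⌉₊ := by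
    rw [← Real.rpow_natCast (1 + ‖ξ‖ ^ 2)]
    apply Real.rpow_le_rpow_of_exponent_le h1
    simpa using Nat.le_ceil (s / 2)
  calc C * _ ≤ |C| * (1 + ‖ξ‖ ^ 2) ^ ((s - ∑ i : Fin n, (((0 : Fin n → ℕ) i : ℕ) : ℝ)) / 2) := by
        gcongr
        exact le_abs_self C
    _ ≤ _ := by gcongr

theorem fourierInt_eq {n : ℕ} (f : SchwartzMap (Euc n) ℂ) (ξ : Euc n) :
    fourierInt f ξ = (FourierTransform.fourier f : SchwartzMap (Euc n) ℂ)
      ((2 * Real.pi)⁻¹ • ξ) := by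
  rw [SchwartzMap.fourier_coe, Real.fourier_eq']
  unfold fourierInt
  refine integral_congr_ae (ae_of_all _ fun y => ?_)
  simp only [smul_eq_mul, inner_smul_right]
  congr 2
  push_cast
  field_simp

theorem integrable_fourierInt {n : ℕ} {X : Opens (Euc n)} (u : 𝓓(X, ℂ)) (k : ℕ) :
    Integrable (fun ξ : Euc n => (1 + ‖ξ‖ ^ 2) ^ k * ‖fourierInt u ξ‖) := by
  set f : SchwartzMap (Euc n) ℂ := u.hasCompactSupport.toSchwartzMap u.contDiff with hf
  set g : SchwartzMap (Euc n) ℂ := FourierTransform.fourier f with hg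
  have h2π : (2 * Real.pi) ≠ 0 := by positivity
  have h1 : Integrable (fun η : Euc n => (1 + ‖(2 * Real.pi) • η‖ ^ 2) ^ k * ‖g η‖) := by
    have h : (fun η : Euc n => (1 + ‖(2 * Real.pi) • η‖ ^ 2) ^ k * ‖g η‖) =
        fun η => ∑ j ∈ Finset.range (k + 1),
          ((2 * Real.pi) ^ (2 * (k - j)) * (k.choose j)) * (‖η‖ ^ (2 * (k - j)) * ‖g η‖) := by
      funext η
      rw [add_pow, Finset.sum_mul]
      refine Finset.sum_congr rfl fun j _ => ?_
      rw [norm_smul, Real.norm_of_nonneg (by positivity), one_pow, ← pow_mul, mul_pow]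
      ring
    rw [h]
    exact integrable_finsetSum _ fun j _ => (g.integrable_pow_mul volume _).const_mul _
  have h2 := h1.comp_smul (R := (2 * Real.pi)⁻¹) (inv_ne_zero h2π)
  refine h2.congr (ae_of_all _ fun ξ => ?_)
  have h3 : fourierInt u ξ = g ((2 * Real.pi)⁻¹ • ξ) := fourierInt_eq f ξ
  simp only [smul_inv_smul₀ h2π, h3]

theorem continuous_fourierInt {n : ℕ} {X : Opens (Euc n)} (u : 𝓓(X, ℂ)) :
    Continuous (fourierInt u) := by
  have h : fourierInt u = fun ξ => (FourierTransform.fourier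
      (u.hasCompactSupport.toSchwartzMap u.contDiff) : SchwartzMap (Euc n) ℂ)
      ((2 * Real.pi)⁻¹ • ξ) :=
    funext fun ξ => fourierInt_eq (u.hasCompactSupport.toSchwartzMap u.contDiff) ξ
  rw [h]
  exact (SchwartzMap.continuous _).comp (continuous_const_smul _)

theorem continuous_pdo_integrand {n : ℕ} {s : ℝ} {a : Euc n → Euc n → ℂ} (ha : IsSymbol s a)
    {X : Opens (Euc n)} (u : 𝓓(X, ℂ)) :
    Continuous (fun z : Euc n × Euc n => Complex.exp (Complex.I * ((inner ℝ z.1 z.2 : ℝ) : ℂ)) *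
      a z.1 z.2 * fourierInt u z.2) := by
  have h1 := ha.smooth.continuous
  have h2 := continuous_fourierInt u
  fun_prop

theorem norm_pdo_integrand {n : ℕ} (a : Euc n → Euc n → ℂ) (u : Euc n → ℂ) (x ξ : Euc n) :
    ‖Complex.exp (Complex.I * ((inner ℝ x ξ : ℝ) : ℂ)) * a x ξ * fourierInt u ξ‖ =
      ‖a x ξ‖ * ‖fourierInt u ξ‖ := by
  rw [norm_mul, norm_mul, mul_comm Complex.I, Complex.norm_exp_ofReal_mul_I, one_mul]

theorem integrable_pdo {n : ℕ} {s : ℝ} {a : Euc n → Euc n → ℂ} (ha : IsSymbol s a)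
    {X : Opens (Euc n)} (u : 𝓓(X, ℂ)) (x : Euc n) :
    Integrable (fun ξ : Euc n =>
      Complex.exp (Complex.I * ((inner ℝ x ξ : ℝ) : ℂ)) * a x ξ * fourierInt u ξ) := by
  obtain ⟨C, k, hC⟩ := ha.exists_bound (isCompact_singleton (x := x))
  refine ((integrable_fourierInt u k).const_mul C).mono'
    ((continuous_pdo_integrand ha u).comp (by fun_prop : Continuous fun ξ : Euc n =>
      (x, ξ))).aestronglyMeasurable (ae_of_all _ fun ξ => ?_)
  rw [norm_pdo_integrand, ← mul_assoc]
  exact mul_le_mul_of_nonneg_right (hC x rfl ξ) (norm_nonneg _)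

theorem continuous_pdo {n : ℕ} {s : ℝ} {a : Euc n → Euc n → ℂ} (ha : IsSymbol s a)
    {X : Opens (Euc n)} (u : 𝓓(X, ℂ)) : Continuous (pdo a u) := by
  refine continuous_const.mul (continuous_iff_continuousAt.2 fun x => ?_)
  obtain ⟨C, k, hC⟩ := ha.exists_bound (isCompact_closedBall x 1)
  refine continuousAt_of_dominated
    (bound := fun ξ => C * ((1 + ‖ξ‖ ^ 2) ^ k * ‖fourierInt u ξ‖)) ?_ ?_
    ((integrable_fourierInt u k).const_mul C) ?_
  · exact Eventually.of_forall fun y => (integrable_pdo ha u y).aestronglyMeasurable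
  · filter_upwards [Metric.closedBall_mem_nhds x one_pos] with y hy
    refine ae_of_all _ fun ξ => ?_
    rw [norm_pdo_integrand, ← mul_assoc]
    exact mul_le_mul_of_nonneg_right (hC y hy ξ) (norm_nonneg _)
  · exact ae_of_all _ fun ξ => ((continuous_pdo_integrand ha u).comp
      (by fun_prop : Continuous fun y : Euc n => (y, ξ))).continuousAt

theorem fourierInt_add {n : ℕ} {X : Opens (Euc n)} (u v : 𝓓(X, ℂ)) (ξ : Euc n) :
    fourierInt (u + v : 𝓓(X, ℂ)) ξ = fourierInt u ξ + fourierInt v ξ := by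
  have h : ∀ w : 𝓓(X, ℂ), Integrable (fun y : Euc n =>
      Complex.exp (-(Complex.I * ((inner ℝ y ξ : ℝ) : ℂ))) * w y) := fun w =>
    Continuous.integrable_of_hasCompactSupport
      (Continuous.mul (by fun_prop) w.continuous) w.hasCompactSupport.mul_left
  unfold fourierInt
  rw [← integral_add (h u) (h v)]
  exact integral_congr_ae (ae_of_all _ fun y => mul_add _ (u y) (v y))

theorem fourierInt_smul {n : ℕ} {X : Opens (Euc n)} (c : ℂ) (u : 𝓓(X, ℂ)) (ξ : Euc n) :
    fourierInt (c • u : 𝓓(X, ℂ)) ξ = c * fourierInt u ξ := by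
  unfold fourierInt
  rw [← integral_const_mul]
  refine integral_congr_ae (ae_of_all _ fun y => ?_)
  change _ * (c * u y) = c * (_ * u y)
  ring

theorem pdo_add {n : ℕ} {s : ℝ} {a : Euc n → Euc n → ℂ} (ha : IsSymbol s a)
    {X : Opens (Euc n)} (u v : 𝓓(X, ℂ)) (x : Euc n) :
    pdo a (u + v : 𝓓(X, ℂ)) x = pdo a u x + pdo a v x := by
  unfold pdo
  rw [← mul_add, ← integral_add (integrable_pdo ha u x) (integrable_pdo ha v x)]
  congr 1
  refine integral_congr_ae (ae_of_all _ fun ξ => ?_)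
  simp only [fourierInt_add]
  ring

theorem pdo_smul {n : ℕ} (a : Euc n → Euc n → ℂ) {X : Opens (Euc n)} (c : ℂ) (u : 𝓓(X, ℂ))
    (x : Euc n) : pdo a (c • u : 𝓓(X, ℂ)) x = c * pdo a u x := by
  unfold pdo
  rw [mul_left_comm, ← integral_const_mul c]
  congr 1
  refine integral_congr_ae (ae_of_all _ fun ξ => ?_)
  simp only [fourierInt_smul]
  ring

/-! ### The operator `res ∘ A₀ ∘ ext` -/

/-- `L²(X)`. -/
abbrev L2 {n : ℕ} (X : Opens (Euc n)) : Type :=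
  Lp ℂ 2 ((volume : Measure (Euc n)).restrict (X : Set (Euc n)))

theorem memLp_testFunction {n : ℕ} {X : Opens (Euc n)} (u : 𝓓(X, ℂ)) :
    MemLp u 2 ((volume : Measure (Euc n)).restrict (X : Set (Euc n))) :=
  (u.continuous.memLp_of_hasCompactSupport u.hasCompactSupport).restrict _

/-- The inclusion `C_c^∞(X) → L²(X)`. -/
def testToL2 {n : ℕ} (X : Opens (Euc n)) : 𝓓(X, ℂ) →ₗ[ℂ] L2 X where
  toFun u := (memLp_testFunction u).toLp u
  map_add' u v := by
    rw [← MemLp.toLp_add]; rfl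
  map_smul' c u := by
    rw [RingHom.id_apply, ← MemLp.toLp_const_smul]; rfl

theorem testToL2_injective {n : ℕ} (X : Opens (Euc n)) : Function.Injective (testToL2 X) := by
  rw [← LinearMap.ker_eq_bot, LinearMap.ker_eq_bot']
  intro u hu
  have h1 : u =ᵐ[(volume : Measure (Euc n)).restrict (X : Set (Euc n))] (0 : Euc n → ℂ) :=
    (memLp_testFunction u).coeFn_toLp.symm.trans ((Lp.ext_iff.1 hu).trans (Lp.coeFn_zero _ _ _))
  have h2 := Measure.eqOn_open_of_ae_eq h1 X.isOpen u.continuous.continuousOn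
    continuous_const.continuousOn
  ext x
  by_cases hx : x ∈ (X : Set (Euc n))
  · exact h2 hx
  · exact image_eq_zero_of_notMem_tsupport fun h => hx (u.tsupport_subset h)

theorem memLp_pdo {n : ℕ} {s : ℝ} {a : Euc n → Euc n → ℂ} (ha : IsSymbol s a)
    {X : Opens (Euc n)} (hX : Bornology.IsBounded (X : Set (Euc n))) (u : 𝓓(X, ℂ)) :
    MemLp (pdo a u) 2 ((volume : Measure (Euc n)).restrict (X : Set (Euc n))) := by
  have hK : IsCompact (closure (X : Set (Euc n))) := hX.isCompact_closure
  obtain ⟨C, hC⟩ := hK.exists_bound_of_continuousOn (continuous_pdo ha u).continuousOn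
  have : IsFiniteMeasure ((volume : Measure (Euc n)).restrict (X : Set (Euc n))) :=
    ⟨by simpa using hX.measure_lt_top⟩
  exact MemLp.of_bound (continuous_pdo ha u).aestronglyMeasurable C
    ((ae_restrict_iff' X.isOpen.measurableSet).2
      (ae_of_all _ fun x hx => hC x (subset_closure hx)))

/-- The map `u ↦ (A₀ u)|_X` from `C_c^∞(X)` to `L²(X)`. -/
def pdoToL2 {n : ℕ} {d : ℤ} (σ : ClassicalSymbol n d) (X : Opens (Euc n))
    (hX : Bornology.IsBounded (X : Set (Euc n))) : 𝓓(X, ℂ) →ₗ[ℂ] L2 X where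
  toFun u := (memLp_pdo σ.isSymbol hX u).toLp (pdo σ.toFun u)
  map_add' u v := by
    rw [← MemLp.toLp_add]
    congr 1
    exact funext fun x => pdo_add σ.isSymbol u v x
  map_smul' c u := by
    rw [RingHom.id_apply, ← MemLp.toLp_const_smul]
    congr 1
    exact funext fun x => pdo_smul σ.toFun c u x

/-- The operator `res ∘ A₀ ∘ ext` in `L²(X)` with domain `C_c^∞(X)`. -/
def resOpExt {n : ℕ} {d : ℤ} (σ : ClassicalSymbol n d) (X : Opens (Euc n))
    (hX : Bornology.IsBounded (X : Set (Euc n))) : L2 X →ₗ.[ℂ] L2 X where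
  domain := LinearMap.range (testToL2 X)
  toFun := (pdoToL2 σ X hX).comp
    (LinearEquiv.ofInjective (testToL2 X) (testToL2_injective X)).symm.toLinearMap

/-! ### The Friedrichs extension, resolvents and spectra of unbounded operators -/

section Hilbert

variable {H : Type*} [NormedAddCommGroup H] [InnerProductSpace ℂ H]

/-- Limits in `H` of sequences in the domain of `S` that are Cauchy for the quadratic form
`(S v, v)`. -/
def formLimits (S : H →ₗ.[ℂ] H) : Set H :=
  {u | ∃ v : ℕ → S.domain, Tendsto (fun k => (v k : H)) atTop (𝓝 u) ∧
    Tendsto (fun p : ℕ × ℕ => inner ℂ ((v p.1 - v p.2 : S.domain) : H) (S (v p.1 - v p.2)))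
      atTop (𝓝 0)}

/-- The form domain of `S`: for a symmetric, lower semi-bounded `S` with `(S v, v) ≥ (c - M) ‖v‖²`,
`c > 0`, this is the completion of the domain of `S` for the norm `((S + M) v, v)^{1/2}`, realized
in `H`. The set of limits is then already a subspace; see `mem_formDomain_iff`. -/
def formDomain (S : H →ₗ.[ℂ] H) : Submodule ℂ H := Submodule.span ℂ (formLimits S)

theorem formLimits_add {S : H →ₗ.[ℂ] H}
    (hsymm : ∀ u v : S.domain, inner ℂ (S u) (v : H) = inner ℂ (u : H) (S v))
    {M : ℝ} (hM : ∀ v : S.domain, -M * ‖(v : H)‖ ^ 2 ≤ (inner ℂ (v : H) (S v)).re) {u w : H}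
    (hu : u ∈ formLimits S) (hw : w ∈ formLimits S) : u + w ∈ formLimits S := by
  obtain ⟨v, hv, hqv⟩ := hu
  obtain ⟨z, hz, hqz⟩ := hw
  have him : ∀ d : S.domain, inner ℂ (d : H) (S d) = (((inner ℂ (d : H) (S d)).re : ℝ) : ℂ) := by
    intro d
    have h := hsymm d d
    rw [← inner_conj_symm] at h
    exact (Complex.conj_eq_iff_re.1 h).symm
  have hpar : ∀ d e : S.domain, (inner ℂ ((d + e : S.domain) : H) (S (d + e))).re =
      2 * (inner ℂ (d : H) (S d)).re + 2 * (inner ℂ (e : H) (S e)).re -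
        (inner ℂ ((d - e : S.domain) : H) (S (d - e))).re := by
    intro d e
    simp only [LinearPMap.map_add, LinearPMap.map_sub, Submodule.coe_add, Submodule.coe_sub,
      inner_add_left, inner_add_right, inner_sub_left, inner_sub_right, Complex.add_re,
      Complex.sub_re]
    ring
  refine ⟨fun k => v k + z k, by simpa using hv.add hz, ?_⟩
  have hcauchy : ∀ {y : ℕ → S.domain} {t : H}, Tendsto (fun k => (y k : H)) atTop (𝓝 t) →
      Tendsto (fun p : ℕ × ℕ => ((y p.1 - y p.2 : S.domain) : H)) atTop (𝓝 0) := by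
    intro y t hy
    have h := (hy.comp (tendsto_fst (g := (atTop : Filter ℕ)))).sub
      (hy.comp (tendsto_snd (f := (atTop : Filter ℕ))))
    rw [prod_atTop_atTop_eq] at h
    simpa using h
  set D : ℕ × ℕ → S.domain := fun p => v p.1 - v p.2 with hD
  set E : ℕ × ℕ → S.domain := fun p => z p.1 - z p.2 with hE
  have hD0 : Tendsto (fun p => (D p : H)) atTop (𝓝 0) := hcauchy hv
  have hE0 : Tendsto (fun p => (E p : H)) atTop (𝓝 0) := hcauchy hz
  have hDE : (fun p : ℕ × ℕ => inner ℂ (((v p.1 + z p.1) - (v p.2 + z p.2) : S.domain) : H)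
      (S ((v p.1 + z p.1) - (v p.2 + z p.2)))) =
      fun p => (((inner ℂ ((D p + E p : S.domain) : H) (S (D p + E p))).re : ℝ) : ℂ) := by
    funext p
    rw [← him, add_sub_add_comm]
  rw [hDE, ← Complex.ofReal_zero]
  refine (Complex.continuous_ofReal.tendsto 0).comp ?_
  have hlow : Tendsto (fun p => -M * ‖((D p + E p : S.domain) : H)‖ ^ 2) atTop (𝓝 0) := by
    have h := (((hD0.add hE0).norm.pow 2).const_mul (-M))
    simpa using h
  have hup : Tendsto (fun p => 2 * (inner ℂ (D p : H) (S (D p))).re +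
      2 * (inner ℂ (E p : H) (S (E p))).re + M * ‖((D p - E p : S.domain) : H)‖ ^ 2)
      atTop (𝓝 0) := by
    have h1 := ((Complex.continuous_re.tendsto 0).comp hqv).const_mul 2
    have h2 := ((Complex.continuous_re.tendsto 0).comp hqz).const_mul 2
    have h3 := (((hD0.sub hE0).norm.pow 2).const_mul M)
    have h := (h1.add h2).add h3
    rw [Complex.zero_re, mul_zero, add_zero, sub_zero, norm_zero, zero_pow two_ne_zero, mul_zero,
      add_zero] at h
    exact h
  refine tendsto_of_tendsto_of_tendsto_of_le_of_le hlow hup (fun p => hM _) fun p => ?_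
  have h1 := hpar (D p) (E p)
  have h2 := hM (D p - E p)
  simp only at h1 h2 ⊢
  linarith

theorem formLimits_smul {S : H →ₗ.[ℂ] H} (c : ℂ) {u : H} (hu : u ∈ formLimits S) :
    c • u ∈ formLimits S := by
  obtain ⟨v, hv, hqv⟩ := hu
  refine ⟨fun k => c • v k, by simpa using hv.const_smul c, ?_⟩
  have h := hqv.const_mul (starRingEnd ℂ c * c)
  rw [mul_zero] at h
  refine h.congr fun p => ?_
  rw [← smul_sub, LinearPMap.map_smul, Submodule.coe_smul, inner_smul_left, inner_smul_right,
    mul_assoc]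

theorem mem_formDomain_iff {S : H →ₗ.[ℂ] H}
    (hsymm : ∀ u v : S.domain, inner ℂ (S u) (v : H) = inner ℂ (u : H) (S v))
    {M : ℝ} (hM : ∀ v : S.domain, -M * ‖(v : H)‖ ^ 2 ≤ (inner ℂ (v : H) (S v)).re) {u : H} :
    u ∈ formDomain S ↔ u ∈ formLimits S := by
  refine ⟨fun h => ?_, fun h => Submodule.subset_span h⟩
  refine Submodule.span_induction (fun x hx => hx) ?_ (fun x y _ _ hx hy =>
    formLimits_add hsymm hM hx hy) (fun c x _ hx => formLimits_smul c hx) h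
  exact ⟨fun _ => 0, by simp, by simp⟩

/-- The Friedrichs extension of a densely defined, symmetric, lower semi-bounded operator `S`:
the restriction of the adjoint of `S` to the form domain of `S`. -/
def friedrichsExtension [CompleteSpace H] (S : H →ₗ.[ℂ] H) : H →ₗ.[ℂ] H :=
  S.adjoint.domRestrict (formDomain S)

/-- The bounded operator `R` is the inverse of `A - z`. -/
def IsResolventAt (A : H →ₗ.[ℂ] H) (z : ℂ) (R : H →L[ℂ] H) : Prop :=
  (∀ f : H, ∃ h : R f ∈ A.domain, A ⟨R f, h⟩ - z • R f = f) ∧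
    ∀ u : A.domain, R (A u - z • (u : H)) = u

/-- The resolvent set of `A`. -/
def resolventSetOf (A : H →ₗ.[ℂ] H) : Set ℂ := {z | ∃ R : H →L[ℂ] H, IsResolventAt A z R}

/-- The spectrum of `A`. -/
def spectrumOf (A : H →ₗ.[ℂ] H) : Set ℂ := (resolventSetOf A)ᶜ

/-- `A` has compact resolvent: the resolvent set is non-empty and every `(A - z)⁻¹` is compact. -/
def HasCompactResolvent (A : H →ₗ.[ℂ] H) : Prop :=
  (resolventSetOf A).Nonempty ∧ ∀ z : ℂ, ∀ R : H →L[ℂ] H, IsResolventAt A z R → IsCompactOperator R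

/-- The eigenspace `{u ∈ D(A) : A u = z u}`. -/
def eigenspaceOf (A : H →ₗ.[ℂ] H) (z : ℂ) : Submodule ℂ A.domain :=
  LinearMap.ker (A.toFun - z • A.domain.subtype)

/-- The spectrum of `A` is discrete: it consists of a strictly increasing sequence of real
eigenvalues of finite multiplicity that tends to infinity. -/
def HasDiscreteSpectrum (A : H →ₗ.[ℂ] H) : Prop :=
  ∃ l : ℕ → ℝ, StrictMono l ∧ Tendsto l atTop atTop ∧
    spectrumOf A = Set.range (fun k => (l k : ℂ)) ∧
    ∀ k, eigenspaceOf A (l k) ≠ ⊥ ∧ FiniteDimensional ℂ (eigenspaceOf A (l k))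

end Hilbert

/-! ### Sobolev spaces on an open set -/

/-- `g ∈ L²(X)` is the weak derivative `∂^α u` of `u ∈ L²(X)`. -/
def IsWeakDeriv {n : ℕ} {X : Opens (Euc n)} (α : Fin n → ℕ) (u g : L2 X) : Prop :=
  ∀ φ : 𝓓(X, ℂ), ∫ x in (X : Set (Euc n)), u x * multiDeriv α φ x =
    (-1) ^ (∑ i, α i) * ∫ x in (X : Set (Euc n)), g x * φ x

theorem IsWeakDeriv.unique {n : ℕ} {X : Opens (Euc n)} {α : Fin n → ℕ} {u g g' : L2 X}
    (h : IsWeakDeriv α u g) (h' : IsWeakDeriv α u g') : g = g' := by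
  rw [← sub_eq_zero]
  have hint : ∀ (f : L2 X) (φ : 𝓓(X, ℂ)),
      Integrable (fun x => f x * φ x) (volume.restrict (X : Set (Euc n))) := fun f φ =>
    (Lp.memLp f).integrable_mul (memLp_testFunction φ)
  have hloc : LocallyIntegrableOn ((g - g' : L2 X) : Euc n → ℂ) (X : Set (Euc n)) volume := by
    rw [locallyIntegrableOn_iff X.isOpen.isLocallyClosed]
    intro K hK hKc
    have h1 : LocallyIntegrable ((g - g' : L2 X) : Euc n → ℂ)
        ((volume : Measure (Euc n)).restrict (X : Set (Euc n))) :=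
      (Lp.memLp (g - g')).locallyIntegrable one_le_two
    have h2 := h1.integrableOn_isCompact hKc
    rwa [IntegrableOn, Measure.restrict_restrict_of_subset hK] at h2
  have h0 := X.isOpen.ae_eq_zero_of_integral_contDiff_smul_eq_zero hloc ?_
  · have h1 : ((g - g' : L2 X) : Euc n → ℂ)
        =ᵐ[(volume : Measure (Euc n)).restrict (X : Set (Euc n))] 0 :=
      (ae_restrict_iff' X.isOpen.measurableSet).2 h0
    exact Lp.ext (h1.trans (Lp.coeFn_zero _ _ _).symm)
  intro ψ hψ hψc hψX
  have hts : tsupport (fun x => (ψ x : ℂ)) = tsupport ψ := by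
    simp [tsupport, Function.support, Complex.ofReal_eq_zero]
  let φ : 𝓓(X, ℂ) := ⟨fun x => (ψ x : ℂ), Complex.ofRealCLM.contDiff.comp hψ,
    by rw [HasCompactSupport, hts]; exact hψc, by rw [hts]; exact hψX⟩
  have h1 : ∫ x in (X : Set (Euc n)), g x * φ x = ∫ x in (X : Set (Euc n)), g' x * φ x :=
    mul_left_cancel₀ (pow_ne_zero _ (neg_ne_zero.2 one_ne_zero)) ((h φ).symm.trans (h' φ))
  have h2 : ∫ x, ψ x • (g - g' : L2 X) x =
      ∫ x in (X : Set (Euc n)), ψ x • (g - g' : L2 X) x := by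
    refine (setIntegral_eq_integral_of_forall_compl_eq_zero fun x hx => ?_).symm
    rw [image_eq_zero_of_notMem_tsupport fun h => hx (hψX h), zero_smul]
  rw [h2, ← sub_eq_zero.2 h1, ← integral_sub (hint g φ) (hint g' φ)]
  refine integral_congr_ae ?_
  filter_upwards [Lp.coeFn_sub g g'] with x hx
  rw [hx, Pi.sub_apply, Complex.real_smul]
  change (ψ x : ℂ) * (g x - g' x) = g x * (ψ x : ℂ) - g' x * (ψ x : ℂ)
  ring

/-- The weak derivative `∂^α u ∈ L²(X)`, where it exists (and `0` otherwise). -/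
def weakDeriv {n : ℕ} {X : Opens (Euc n)} (α : Fin n → ℕ) (u : L2 X) : L2 X :=
  open scoped Classical in if h : ∃ g, IsWeakDeriv α u g then h.choose else 0

/-- The multi-indices `α` with `|α| ≤ m`. -/
def multiIndices (n m : ℕ) : Finset (Fin n → ℕ) :=
  (Fintype.piFinset fun _ => Finset.range (m + 1)).filter fun α => ∑ i, α i ≤ m

theorem mem_multiIndices {n m : ℕ} {α : Fin n → ℕ} : α ∈ multiIndices n m ↔ ∑ i, α i ≤ m := by
  simp only [multiIndices, Finset.mem_filter, Fintype.mem_piFinset, Finset.mem_range,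
    and_iff_right_iff_imp]
  exact fun h i => Nat.lt_succ_of_le
    ((Finset.single_le_sum (f := α) (fun _ _ => Nat.zero_le _) (Finset.mem_univ i)).trans h)

/-- The Sobolev space `H^m(X)`. -/
def sobolev {n : ℕ} (X : Opens (Euc n)) (m : ℕ) : Set (L2 X) :=
  {u | ∀ α ∈ multiIndices n m, ∃ g, IsWeakDeriv α u g}

/-- The norm `(∑_{|α| ≤ m} ‖∂^α u‖²_{L²})^{1/2}` of `H^m(X)`, for `u ∈ H^m(X)`. -/
def sobolevNorm {n : ℕ} {X : Opens (Euc n)} (m : ℕ) (u : L2 X) : ℝ :=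
  Real.sqrt (∑ α ∈ multiIndices n m, ‖weakDeriv α u‖ ^ 2)

/-- `H_0^m(X)`, the closure of `C_c^∞(X)` in `H^m(X)`. -/
def sobolevZero {n : ℕ} (X : Opens (Euc n)) (m : ℕ) : Set (L2 X) :=
  {u | u ∈ sobolev X m ∧ ∀ ε > 0, ∃ φ : 𝓓(X, ℂ), sobolevNorm m (u - testToL2 X φ) < ε}

end WeylPDO

end

open WeylPDO

/-! The analytic heart is Gårding's inequality (`ClassicalSymbol.garding`): the quadratic form of
the operator, plus a multiple of the squared `L²` norm, controls `fourierEnergy m`, the `H^m` energy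
computed from Fourier transforms. Everything after that is functional analysis, and the boundary of
`X` never enters, because only zero extensions of test functions are used.

Ellipticity on `X` makes `Re a + C - c (1 + |ξ|²)^m` non-negative over `X`, and, after shrinking
`c`, over a neighbourhood of `X`. Multiplying by a cutoff `ψ` that equals `1` on `X` gives a symbol
`b` with compact `x`-support and `Re b ≥ 0`. By `IsKernelSymbol.re_form_ge` such a symbol has a form
that is non-negative up to `δ` times the energy and a multiple of the squared `L²` norm. To see
this, write the form with the kernel `b̂(η - ζ, ζ)`, the Fourier transform being taken in `x`, and
compare it with the average over `ξ` of `G(ξ - ζ) G(ξ - η) b̂(η - ζ, ξ)`, where `G` is a normalized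
window. The averaged form is an integral of `b(x, ξ)` against squared moduli of wave packets, so its
real part is non-negative. The error is small if `G` is wide, since `G` then changes little under
translation, while over the width of `G` the symbol changes by an arbitrarily small fraction of its
size plus a constant. Schur's test (`integral_kernel_le`) turns these pointwise bounds into a bound
for the form. Since any fixed small loss is allowed, the window need not depend on the frequency.

Gårding's inequality makes `S + M ≥ 1` for the restricted operator `S`. Completing its domain in the
energy inner product and solving the variational problem by duality gives a bounded symmetric
inverse of the Friedrichs extension plus `M`, whence self-adjointness (`IsSemibounded.friedrichs`).
Each `u` in the domain is a limit of test functions that are Cauchy in energy and whose energies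
converge to `((A + M) u, u)`; this gives `D(A) ⊂ H_0^m` and the coercive estimate by passing to the
limit.

Compactness is Rellich's theorem in finite-rank form (`exists_finset_norm_sq_le`): high frequencies
are small compared with the energy, and finitely many exponentials test the low ones. The compact
self-adjoint inverse then yields the discrete spectrum; infinitely many eigenvalues occur because
`L²(X)` is infinite-dimensional. -/

noncomputable section

namespace WeylPDO

/-! ### Friedrichs extensions -/

section Energy

variable {H D : Type*} [NormedAddCommGroup H] [InnerProductSpace ℂ H]
  [NormedAddCommGroup D]

open UniformSpace in
/-- The extension to the completion of the inclusion of an energy space. -/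
def energyMap [InnerProductSpace ℂ D] [CompleteSpace H] (j : D →L[ℂ] H) : Completion D →L[ℂ] H :=
  j.extend (Completion.toComplL (𝕜 := ℂ) (E := D))

theorem energyMap_coe [InnerProductSpace ℂ D] [CompleteSpace H] (j : D →L[ℂ] H) (v : D) :
    energyMap j (v : UniformSpace.Completion D) = j v :=
  ContinuousLinearMap.extend_eq _ (UniformSpace.Completion.denseRange_coe)
    (UniformSpace.Completion.isUniformInducing_coe D) v

theorem exists_energy_limit {v : ℕ → D} (hv : CauchySeq v) :
    ∃ z : UniformSpace.Completion D,
      Tendsto (fun k => (v k : UniformSpace.Completion D)) atTop (𝓝 z) :=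
  cauchySeq_tendsto_of_complete
    (hv.map (UniformSpace.Completion.uniformContinuous_coe D))

/-- If `w` is an energy limit of `v k` and represents `f`, the energies converge to `⟪w, f⟫`. -/
theorem tendsto_energy [InnerProductSpace ℂ D] {j : D →L[ℂ] H} {T : D →ₗ[ℂ] H}
    (hT : ∀ v w : D, inner ℂ v w = inner ℂ (T v) (j w)) {v : ℕ → D} (hv : CauchySeq v) {w f : H}
    (hw : Tendsto (fun k => j (v k)) atTop (𝓝 w))
    (hf : ∀ z : D, inner ℂ (T z) w = inner ℂ (j z) f) :
    Tendsto (fun k => ‖v k‖ ^ 2) atTop (𝓝 (inner ℂ w f).re) := by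
  -- The abstract limit `z` is not identified with `w`, so injectivity of the inclusion on the
  -- completion is not needed. Testing against vectors of `D`, and then along the sequence itself,
  -- gives `‖z‖² = ⟪w, f⟫`.
  obtain ⟨z, hz⟩ := exists_energy_limit hv
  have h1 : ∀ y : D, inner ℂ (y : UniformSpace.Completion D) z = inner ℂ (j y) f := by
    intro y
    rw [← hf]
    refine tendsto_nhds_unique (tendsto_const_nhds.inner hz) ?_
    simp only [UniformSpace.Completion.inner_coe, hT]
    exact tendsto_const_nhds.inner hw
  have h2 : inner ℂ z z = inner ℂ w f := by
    refine tendsto_nhds_unique (hz.inner tendsto_const_nhds) ?_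
    simp only [h1]
    exact hw.inner tendsto_const_nhds
  have h3 : (inner ℂ w f).re = ‖z‖ ^ 2 := by
    rw [← h2]
    exact inner_self_eq_norm_sq (𝕜 := ℂ) z
  rw [h3]
  simpa using hz.norm.pow 2

open ContinuousLinearMap in
/-- The solution operator of the variational problem of an energy space. -/
theorem exists_energy_inverse [InnerProductSpace ℂ D] [CompleteSpace H]
    {j : D →L[ℂ] H} {T : D →ₗ[ℂ] H}
    (hT : ∀ v w : D, inner ℂ v w = inner ℂ (T v) (j w)) :
    ∃ R : H →L[ℂ] H, (∀ f g, inner ℂ (R f) g = inner ℂ f (R g)) ∧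
      ∀ f, (∀ v : D, inner ℂ (T v) (R f) = inner ℂ (j v) f) ∧
        ∃ v : ℕ → D, CauchySeq v ∧ Tendsto (fun k => j (v k)) atTop (𝓝 (R f)) := by
  -- With `J` the extended inclusion, `J* f` is the Riesz representative of the functional that `f`
  -- induces on the energy completion, so `J J*` solves the variational problem, and it is visibly
  -- symmetric.
  refine ⟨energyMap j ∘L adjoint (energyMap j), fun f g => ?_, fun f => ?_⟩
  · simp only [comp_apply]
    rw [← adjoint_inner_right, adjoint_inner_left (energyMap j) _ f |>.symm]
  · set z := adjoint (energyMap j) f with hz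
    obtain ⟨x, hx, hxz⟩ := mem_closure_iff_seq_limit.1
      ((UniformSpace.Completion.denseRange_coe (α := D)) z)
    choose v hv using hx
    have h1 : Tendsto (fun k => (v k : UniformSpace.Completion D)) atTop (𝓝 z) := by
      simpa only [hv] using hxz
    have h2 : Tendsto (fun k => j (v k)) atTop (𝓝 (energyMap j z)) := by
      simpa only [Function.comp_def, energyMap_coe] using
        ((energyMap j).continuous.tendsto z).comp h1
    have h3 : CauchySeq v :=
      (UniformSpace.Completion.isUniformInducing_coe D).cauchy_map_iff.1 h1.cauchySeq
    refine ⟨fun y => ?_, v, h3, h2⟩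
    have h4 : inner ℂ (y : UniformSpace.Completion D) z = inner ℂ (j y) f := by
      rw [hz, adjoint_inner_right, energyMap_coe]
    rw [← h4]
    refine tendsto_nhds_unique (tendsto_const_nhds.inner h2) ?_
    refine (tendsto_const_nhds.inner h1).congr fun k => ?_
    rw [UniformSpace.Completion.inner_coe, hT]

end Energy

/-! ### Energy spaces of semibounded operators and Friedrichs' theorem -/

section Friedrichs

variable {H : Type*} [NormedAddCommGroup H] [InnerProductSpace ℂ H]

/-- The domain of `S`, to be equipped with an energy inner product. -/
def EnergySpace (S : H →ₗ.[ℂ] H) : Type _ := S.domain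

instance (S : H →ₗ.[ℂ] H) : AddCommGroup (EnergySpace S) :=
  inferInstanceAs (AddCommGroup S.domain)

instance (S : H →ₗ.[ℂ] H) : Module ℂ (EnergySpace S) :=
  inferInstanceAs (Module ℂ S.domain)

/-- `S + M`, as a map on the energy space. -/
def energyOp (S : H →ₗ.[ℂ] H) (M : ℝ) : EnergySpace S →ₗ[ℂ] H :=
  S.toFun + (M : ℂ) • S.domain.subtype

theorem energyOp_apply (S : H →ₗ.[ℂ] H) (M : ℝ) (v : S.domain) :
    energyOp S M v = S v + (M : ℂ) • (v : H) := rfl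

/-- The inclusion of the energy space. -/
def energyIncl (S : H →ₗ.[ℂ] H) : EnergySpace S →ₗ[ℂ] H := S.domain.subtype

/-- A symmetric operator `S` such that `S + M ≥ 1`. -/
structure IsSemibounded (S : H →ₗ.[ℂ] H) (M : ℝ) : Prop where
  symm : ∀ u v : S.domain, inner ℂ (S u) (v : H) = inner ℂ (u : H) (S v)
  bound : ∀ v : S.domain, ‖(v : H)‖ ^ 2 ≤ (inner ℂ (v : H) (S v)).re + M * ‖(v : H)‖ ^ 2

variable {S : H →ₗ.[ℂ] H} {M : ℝ}

theorem IsSemibounded.symm_energyOp (hS : IsSemibounded S M) (u v : EnergySpace S) :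
    inner ℂ (energyOp S M u) (energyIncl S v) = inner ℂ (energyIncl S u) (energyOp S M v) := by
  have := hS.symm u v
  change inner ℂ (S u + (M : ℂ) • (u : S.domain).1) (v : S.domain).1 =
    inner ℂ (u : S.domain).1 (S v + (M : ℂ) • (v : S.domain).1)
  rw [inner_add_left, inner_add_right, this, inner_smul_left, inner_smul_right, Complex.conj_ofReal]

theorem inner_self_re (x : H) : (inner ℂ x x).re = ‖x‖ ^ 2 := inner_self_eq_norm_sq (𝕜 := ℂ) x

theorem re_inner_energyOp (S : H →ₗ.[ℂ] H) (M : ℝ) (v : S.domain) :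
    (inner ℂ (v : H) (energyOp S M v)).re = (inner ℂ (v : H) (S v)).re + M * ‖(v : H)‖ ^ 2 := by
  rw [energyOp_apply, inner_add_right, inner_smul_right, Complex.add_re, Complex.re_ofReal_mul,
    inner_self_re]

theorem IsSemibounded.sq_le (hS : IsSemibounded S M) (v : EnergySpace S) :
    ‖energyIncl S v‖ ^ 2 ≤ (inner ℂ (energyIncl S v) (energyOp S M v)).re :=
  (hS.bound v).trans_eq (re_inner_energyOp S M v).symm

/-- The energy inner product `((S + M) u, v)`. -/
@[reducible]
def energyCore (hS : IsSemibounded S M) : InnerProductSpace.Core ℂ (EnergySpace S) where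
  inner u v := inner ℂ (energyOp S M u) (energyIncl S v)
  conj_inner_symm u v := by
    rw [inner_conj_symm]
    exact (hS.symm_energyOp u v).symm
  re_inner_nonneg v := by
    change 0 ≤ (inner ℂ (energyOp S M v) (energyIncl S v)).re
    rw [hS.symm_energyOp]
    exact (sq_nonneg _).trans (hS.sq_le v)
  add_left u v w := by rw [map_add, inner_add_left]
  smul_left u v c := by rw [map_smul, inner_smul_left]
  definite v hv := by
    have h := hS.sq_le v
    rw [← hS.symm_energyOp, hv, Complex.zero_re] at h
    have h1 : energyIncl S v = 0 := by
      rw [← norm_eq_zero]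
      nlinarith [norm_nonneg (energyIncl S v)]
    exact Subtype.ext h1

theorem tendsto_of_norm_sq_tendsto {ι : Type*} {l : Filter ι} {E : Type*} [SeminormedAddCommGroup E]
    {f : ι → E} (h : Tendsto (fun i => ‖f i‖ ^ 2) l (𝓝 0)) : Tendsto f l (𝓝 0) := by
  rw [tendsto_zero_iff_norm_tendsto_zero]
  have := h.sqrt
  simpa [Real.sqrt_sq] using this

theorem cauchySeq_iff_tendsto_sub {E : Type*} [SeminormedAddCommGroup E] {v : ℕ → E} :
    CauchySeq v ↔ Tendsto (fun p : ℕ × ℕ => v p.1 - v p.2) atTop (𝓝 0) := by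
  simp_rw [cauchySeq_iff_tendsto_dist_atTop_0, dist_eq_norm]
  exact tendsto_zero_iff_norm_tendsto_zero.symm

theorem IsSemibounded.inner_im (hS : IsSemibounded S M) (v : S.domain) :
    inner ℂ (v : H) (S v) = (((inner ℂ (v : H) (S v)).re : ℝ) : ℂ) := by
  have h := hS.symm v v
  rw [← inner_conj_symm] at h
  exact (Complex.conj_eq_iff_re.1 h).symm

theorem IsSemibounded.lower (hS : IsSemibounded S M) (v : S.domain) :
    -M * ‖(v : H)‖ ^ 2 ≤ (inner ℂ (v : H) (S v)).re := by
  have := hS.bound v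
  nlinarith [sq_nonneg ‖(v : H)‖]

theorem friedrichsExtension_apply [CompleteSpace H] (u : (friedrichsExtension S).domain) :
    friedrichsExtension S u = S.adjoint ⟨u, u.2.2⟩ := by
  have h : friedrichsExtension S ≤ S.adjoint := LinearPMap.domRestrict_le
  exact h.2 rfl

/-- Friedrichs' theorem. -/
theorem IsSemibounded.friedrichs [CompleteSpace H] (hS : IsSemibounded S M)
    (hd : Dense (S.domain : Set H)) :
    S ≤ friedrichsExtension S ∧ IsSelfAdjoint (friedrichsExtension S) ∧
    (∃ R : H →L[ℂ] H, (∀ f g, inner ℂ (R f) g = inner ℂ f (R g)) ∧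
      IsResolventAt (friedrichsExtension S) (-M : ℝ) R) ∧
    ∀ u : (friedrichsExtension S).domain, ∃ v : ℕ → S.domain,
      Tendsto (fun k => (v k : H)) atTop (𝓝 u) ∧
      Tendsto (fun p : ℕ × ℕ => (inner ℂ ((v p.1 - v p.2 : S.domain) : H)
        (energyOp S M (v p.1 - v p.2 : S.domain))).re) atTop (𝓝 0) ∧
      Tendsto (fun k => (inner ℂ (v k : H) (energyOp S M (v k))).re) atTop
        (𝓝 (inner ℂ (u : H) (friedrichsExtension S u + (M : ℂ) • (u : H))).re) := by
  let _ : NormedAddCommGroup (EnergySpace S) := (energyCore hS).toNormedAddCommGroup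
  let _ : InnerProductSpace ℂ (EnergySpace S) := InnerProductSpace.ofCore (energyCore hS).toCore
  have hT0 : ∀ u v : EnergySpace S, inner ℂ u v = inner ℂ (energyOp S M u) (energyIncl S v) :=
    fun u v => rfl
  have hnorm : ∀ v : EnergySpace S, ‖v‖ ^ 2 = (inner ℂ (energyIncl S v) (energyOp S M v)).re := by
    intro v
    rw [← hS.symm_energyOp, ← hT0]
    exact (inner_self_eq_norm_sq (𝕜 := ℂ) v).symm
  set j : EnergySpace S →L[ℂ] H := (energyIncl S).mkContinuous 1 (fun v => by
    rw [one_mul, ← sq_le_sq₀ (norm_nonneg _) (norm_nonneg _), hnorm]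
    exact hS.sq_le v) with hj
  have hjv : ∀ v, j v = energyIncl S v := fun v => rfl
  have hT : ∀ u v : EnergySpace S, inner ℂ u v = inner ℂ (energyOp S M u) (j v) := hT0
  set A := friedrichsExtension S with hA
  have hadj : ∀ u : A.domain, ∀ v : EnergySpace S,
      inner ℂ (energyOp S M v) (u : H) = inner ℂ (j v) (A u + (M : ℂ) • (u : H)) := by
    intro u v
    have h1 := (LinearPMap.adjoint_isFormalAdjoint (T := S) hd).symm v ⟨u, u.2.2⟩
    rw [← friedrichsExtension_apply] at h1
    change inner ℂ (S v + (M : ℂ) • (v : S.domain).1) (u : H) = inner ℂ (v : S.domain).1 _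
    rw [inner_add_left, inner_add_right, inner_smul_left, inner_smul_right, Complex.conj_ofReal]
    congr 1
  -- A variational solution lies in the domain of the adjoint, and the Friedrichs extension is the
  -- adjoint cut down to the form domain.
  have hmem : ∀ w f : H, w ∈ formDomain S →
      (∀ v : EnergySpace S, inner ℂ (energyOp S M v) w = inner ℂ (j v) f) →
      ∃ h : w ∈ A.domain, A ⟨w, h⟩ + (M : ℂ) • w = f := by
    intro w f hw hwf
    have h1 : ∀ x : S.domain, inner ℂ (f - (M : ℂ) • w) (x : H) = inner ℂ w (S x) := by
      intro x
      have h2 := hwf x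
      change inner ℂ (S x + (M : ℂ) • (x : S.domain).1) w = inner ℂ (x : H) f at h2
      rw [← inner_conj_symm, ← inner_conj_symm w, inner_sub_right, ← h2, inner_add_left,
        inner_smul_left, inner_smul_right, Complex.conj_ofReal, add_sub_cancel_right]
    have h3 : w ∈ S.adjoint.domain := LinearPMap.mem_adjoint_domain_of_exists w ⟨_, h1⟩
    have h4 : w ∈ A.domain := ⟨hw, h3⟩
    refine ⟨h4, ?_⟩
    have h5 : A ⟨w, h4⟩ = f - (M : ℂ) • w := (friedrichsExtension_apply ⟨w, h4⟩).trans
      (LinearPMap.adjoint_apply_eq (T := S) hd ⟨w, h3⟩ h1)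
    rw [h5, sub_add_cancel]
  -- The form domain is defined through `(S v, v)`, the energy through `((S + M) v, v)`. Along
  -- sequences converging in `H` the difference `M ‖v p - v q‖²` tends to zero, so both notions of
  -- Cauchy sequence agree. This step and the next are the two directions.
  have hcs : ∀ (v : ℕ → EnergySpace S) (w : H), CauchySeq v →
      Tendsto (fun k => j (v k)) atTop (𝓝 w) → w ∈ formDomain S := by
    intro v w hv hw
    refine Submodule.subset_span ⟨v, hw, ?_⟩
    have h1 : Tendsto (fun p : ℕ × ℕ => ‖v p.1 - v p.2‖ ^ 2) atTop (𝓝 0) := by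
      simpa using (cauchySeq_iff_tendsto_sub.1 hv).norm.pow 2
    have h2 : Tendsto (fun p : ℕ × ℕ => j (v p.1 - v p.2)) atTop (𝓝 0) := by
      simpa only [map_zero, Function.comp_def] using
        (j.continuous.tendsto 0).comp (cauchySeq_iff_tendsto_sub.1 hv)
    have h3 : Tendsto (fun p : ℕ × ℕ => ‖v p.1 - v p.2‖ ^ 2 - M * ‖j (v p.1 - v p.2)‖ ^ 2)
        atTop (𝓝 0) := by
      simpa using h1.sub ((h2.norm.pow 2).const_mul M)
    rw [← Complex.ofReal_zero]
    refine ((Complex.continuous_ofReal.tendsto 0).comp h3).congr fun p => ?_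
    change (((‖v p.1 - v p.2‖ ^ 2 - M * ‖j (v p.1 - v p.2)‖ ^ 2 : ℝ)) : ℂ) =
      inner ℂ ((v p.1 - v p.2 : EnergySpace S) : S.domain).1 (S (v p.1 - v p.2 : EnergySpace S))
    have h5 := hS.inner_im (v p.1 - v p.2 : EnergySpace S)
    have h4 := re_inner_energyOp S M (v p.1 - v p.2 : EnergySpace S)
    rw [h5, hnorm, Complex.ofReal_inj]
    exact sub_eq_iff_eq_add.2 h4
  have hsc : ∀ w ∈ formDomain S, ∃ v : ℕ → EnergySpace S, CauchySeq v ∧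
      Tendsto (fun k => j (v k)) atTop (𝓝 w) := by
    intro w hw
    obtain ⟨v, hv, hq⟩ := (mem_formDomain_iff hS.symm hS.lower).1 hw
    let v' : ℕ → EnergySpace S := v
    refine ⟨v', ?_, hv⟩
    have h2 : Tendsto (fun p : ℕ × ℕ => energyIncl S (v p.1 - v p.2 : S.domain)) atTop (𝓝 0) :=
      cauchySeq_iff_tendsto_sub.1 hv.cauchySeq
    have h3 := ((Complex.continuous_re.tendsto 0).comp hq).add ((h2.norm.pow 2).const_mul M)
    rw [cauchySeq_iff_tendsto_sub]
    refine tendsto_of_norm_sq_tendsto ?_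
    rw [Complex.zero_re, norm_zero, zero_pow two_ne_zero, mul_zero, add_zero] at h3
    refine h3.congr fun p => ?_
    rw [hnorm]
    exact (re_inner_energyOp S M (v p.1 - v p.2 : S.domain)).symm
  -- Uniqueness in the variational problem, taking the place of closability of the form: with right
  -- side `0` the energies of an approximating sequence tend to `0`, hence so does the sequence in
  -- `H`.
  have hzero : ∀ w ∈ formDomain S, (∀ v : EnergySpace S, inner ℂ (energyOp S M v) w = 0) →
      w = 0 := by
    intro w hw h0
    obtain ⟨v, hv, hvw⟩ := hsc w hw
    have h1 := tendsto_energy (f := 0) hT hv hvw (by simpa using h0)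
    rw [inner_zero_right, Complex.zero_re] at h1
    have h2 := (j.continuous.tendsto 0).comp (tendsto_of_norm_sq_tendsto h1)
    rw [map_zero] at h2
    exact tendsto_nhds_unique hvw h2
  obtain ⟨R, hRs, hR⟩ := exists_energy_inverse hT
  have hRA : ∀ f, ∃ h : R f ∈ A.domain, A ⟨R f, h⟩ + (M : ℂ) • R f = f := by
    intro f
    obtain ⟨h1, v, hv, hvR⟩ := hR f
    exact hmem _ _ (hcs v _ hv hvR) h1
  have hAR : ∀ u : A.domain, R (A u + (M : ℂ) • (u : H)) = u := by
    intro u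
    obtain ⟨h1, v, hv, hvR⟩ := hR (A u + (M : ℂ) • (u : H))
    rw [← sub_eq_zero]
    refine hzero _ (Submodule.sub_mem _ (hcs v _ hv hvR) u.2.1) fun z => ?_
    rw [inner_sub_right, h1, hadj, sub_self]
  have hsymA : ∀ u v : A.domain, inner ℂ (A u) (v : H) = inner ℂ (u : H) (A v) := by
    intro u v
    have h1 := hRs (A u + (M : ℂ) • (u : H)) (A v + (M : ℂ) • (v : H))
    rw [hAR, hAR, inner_add_left, inner_add_right, inner_smul_left, inner_smul_right,
      Complex.conj_ofReal] at h1
    exact (add_right_cancel h1).symm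
  have hSA : S ≤ A := by
    refine ⟨fun u hu => ?_, ?_⟩
    · refine (hmem u (energyOp S M (⟨u, hu⟩ : S.domain)) ?_ ?_).1
      · exact Submodule.subset_span ⟨fun _ => ⟨u, hu⟩, by simp, by simp⟩
      · exact fun v => hS.symm_energyOp v (⟨u, hu⟩ : S.domain)
    · intro x y hxy
      refine ((friedrichsExtension_apply y).trans
        (LinearPMap.adjoint_apply_eq (T := S) hd _ fun z => ?_)).symm
      rw [← hxy]
      exact hS.symm x z
  have hdA : Dense (A.domain : Set H) := hd.mono hSA.1
  have hself : IsSelfAdjoint A := by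
    rw [LinearPMap.isSelfAdjoint_def]
    have h1 : A.IsFormalAdjoint A := hsymA
    have hle := h1.le_adjoint hdA
    refine (LinearPMap.eq_of_le_of_domain_eq hle (le_antisymm hle.1 fun u hu => ?_)).symm
    -- The difference `u - R f` is orthogonal to the range of `A + M`. That range is all of `H`, so
    -- the difference vanishes and `u = R f` lies in the domain of `A`.
    set f := A.adjoint ⟨u, hu⟩ + (M : ℂ) • u with hf
    have h2 : ∀ v : A.domain, inner ℂ (A v + (M : ℂ) • (v : H)) (u - R f) = 0 := by
      intro v
      have h3 := (LinearPMap.adjoint_isFormalAdjoint (T := A) hdA).symm v ⟨u, hu⟩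
      rw [inner_sub_right, ← hRs, hAR, hf, inner_add_left, inner_add_right, h3, inner_smul_left,
        inner_smul_right, Complex.conj_ofReal, sub_self]
    obtain ⟨h4, h5⟩ := hRA (u - R f)
    have h6 := h2 ⟨_, h4⟩
    rw [h5, inner_self_eq_zero, sub_eq_zero] at h6
    rw [h6]
    exact (hRA f).1
  refine ⟨hSA, hself, ⟨R, hRs, ?_, ?_⟩, fun u => ?_⟩
  · intro f
    obtain ⟨h1, h2⟩ := hRA f
    exact ⟨h1, by rw [Complex.ofReal_neg, neg_smul, sub_neg_eq_add, h2]⟩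
  · intro u
    rw [Complex.ofReal_neg, neg_smul, sub_neg_eq_add, hAR]
  · obtain ⟨v, hv, hvu⟩ := hsc u u.2.1
    refine ⟨v, hvu, ?_, ?_⟩
    · have h1 : Tendsto (fun p : ℕ × ℕ => ‖v p.1 - v p.2‖ ^ 2) atTop (𝓝 0) := by
        simpa using (cauchySeq_iff_tendsto_sub.1 hv).norm.pow 2
      exact h1.congr fun p => hnorm _
    · have h1 := tendsto_energy hT hv hvu (hadj u)
      exact h1.congr fun k => hnorm _

end Friedrichs

end WeylPDO

end

noncomputable section

namespace WeylPDO

/-! ### Operators with compact resolvent -/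

section Compact

variable {H : Type*} [NormedAddCommGroup H] [InnerProductSpace ℂ H]

/-- If `u` is orthogonal to `T* V`, then `T u` is orthogonal to `V` and hence small. So `T` is
within `ε` of its composition with the projection onto the finite-dimensional space `T* V`, and a
norm limit of finite-rank operators is compact. -/
theorem isCompactOperator_of_forall_finiteDimensional [CompleteSpace H] {T : H →L[ℂ] H}
    (h : ∀ ε > 0, ∃ V : Submodule ℂ H, FiniteDimensional ℂ V ∧ ∀ u, T u ∈ Vᗮ → ‖T u‖ ≤ ε * ‖u‖) :
    IsCompactOperator T := by
  suffices hT : T ∈ closure {F : H →L[ℂ] H | IsCompactOperator F} from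
    isClosed_setOfPred_isCompactOperator.closure_subset hT
  rw [Metric.mem_closure_iff]
  intro ε hε
  obtain ⟨V, hV, hVT⟩ := h (ε / 2) (half_pos hε)
  set W : Submodule ℂ H := V.map (ContinuousLinearMap.adjoint T).toLinearMap with hW
  refine ⟨T ∘L W.starProjection, ?_, ?_⟩
  · have h1 : IsCompactOperator (T ∘L W.subtypeL) := isCompactOperator_of_locallyCompactSpace_rng _
    exact h1.comp_clm W.orthogonalProjectionOnto
  · rw [dist_eq_norm]
    refine lt_of_le_of_lt (ContinuousLinearMap.opNorm_le_bound _ (half_pos hε).le fun u => ?_)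
      (half_lt_self hε)
    have h2 : u - W.starProjection u ∈ Wᗮ := W.sub_starProjection_mem_orthogonal u
    have h3 : T (u - W.starProjection u) ∈ Vᗮ := by
      rw [Submodule.mem_orthogonal]
      intro v hv
      rw [← ContinuousLinearMap.adjoint_inner_left]
      exact (Submodule.mem_orthogonal _ _).1 h2 _ ⟨v, hv, rfl⟩
    have h4 : ‖u - W.starProjection u‖ ≤ ‖u‖ := by
      have h5 := Submodule.norm_sq_eq_add_norm_sq_starProjection u W
      rw [Submodule.starProjection_orthogonal_val] at h5
      nlinarith [norm_nonneg u, norm_nonneg (u - W.starProjection u)]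
    have h6 := hVT _ h3
    simp only [sub_apply, ContinuousLinearMap.comp_apply, ← map_sub]
    exact h6.trans (by gcongr)

/-- The first resolvent identity, factored so that compactness of one resolvent passes to all
others. -/
theorem IsResolventAt.eq_comp {A : H →ₗ.[ℂ] H} {z w : ℂ} {R Q : H →L[ℂ] H}
    (hR : IsResolventAt A w R) (hQ : IsResolventAt A z Q) :
    Q = R ∘L (ContinuousLinearMap.id ℂ H + (z - w) • Q) := by
  ext f
  obtain ⟨h, h1⟩ := hQ.1 f
  have h2 := hR.2 ⟨Q f, h⟩
  change R (A ⟨Q f, h⟩ - w • Q f) = Q f at h2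
  rw [sub_eq_iff_eq_add.1 h1, add_sub_assoc, ← sub_smul] at h2
  exact h2.symm

theorem hasCompactResolvent_of_isCompactOperator {A : H →ₗ.[ℂ] H} {w : ℂ} {R : H →L[ℂ] H}
    (hR : IsResolventAt A w R) (hc : IsCompactOperator R) : HasCompactResolvent A := by
  refine ⟨⟨w, R, hR⟩, fun z Q hQ => ?_⟩
  rw [hR.eq_comp hQ]
  exact hc.comp_clm _

theorem mem_eigenspaceOf {A : H →ₗ.[ℂ] H} {z : ℂ} {u : A.domain} :
    u ∈ eigenspaceOf A z ↔ A u = z • (u : H) := by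
  rw [eigenspaceOf, LinearMap.mem_ker, LinearMap.sub_apply, sub_eq_zero]
  rfl

theorem IsResolventAt.apply_eigenvector {A : H →ₗ.[ℂ] H} {w z : ℂ} {R : H →L[ℂ] H}
    (hR : IsResolventAt A w R) {u : A.domain} (hu : u ∈ eigenspaceOf A z) :
    (z - w) • R (u : H) = u := by
  rw [← map_smul, sub_smul, ← mem_eigenspaceOf.1 hu, hR.2]

theorem IsResolventAt.mem_domain_of_apply_eq {A : H →ₗ.[ℂ] H} {w μ : ℂ} {R : H →L[ℂ] H}
    (hR : IsResolventAt A w R) (hμ : μ ≠ 0) {f : H} (hf : R f = μ • f) :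
    ∃ h : f ∈ A.domain, (⟨f, h⟩ : A.domain) ∈ eigenspaceOf A (w + μ⁻¹) := by
  obtain ⟨h, h1⟩ := hR.1 (μ⁻¹ • f)
  have h2 : R (μ⁻¹ • f) = f := by rw [map_smul, hf, smul_smul, inv_mul_cancel₀ hμ, one_smul]
  have h3 : f ∈ A.domain := h2 ▸ h
  have h4 : (⟨R (μ⁻¹ • f), h⟩ : A.domain) = ⟨f, h3⟩ := Subtype.ext h2
  refine ⟨h3, mem_eigenspaceOf.2 ?_⟩
  rw [h4, h2, sub_eq_iff_eq_add] at h1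
  rw [h1, ← add_smul, add_comm]

/-- The Fredholm alternative for `R` at `μ = 1 / (z - w)`: either `μ` is an eigenvalue of `R`, which
makes `z` an eigenvalue of `A`, or `μ - R` is invertible and produces a resolvent at `z`. -/
theorem spectrumOf_eq_of_isCompactOperator [CompleteSpace H] {A : H →ₗ.[ℂ] H} {w : ℂ}
    {R : H →L[ℂ] H} (hR : IsResolventAt A w R) (hc : IsCompactOperator R) :
    spectrumOf A = {z | eigenspaceOf A z ≠ ⊥} := by
  ext z
  simp only [spectrumOf, Set.mem_compl_iff, Set.mem_ofPred_eq]
  refine not_congr ⟨?_, fun hz => ?_⟩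
  · rintro ⟨Q, hQ⟩
    rw [Submodule.eq_bot_iff]
    intro u hu
    have h := hQ.apply_eigenvector hu
    rw [sub_self, zero_smul] at h
    exact Subtype.ext h.symm
  · by_cases hzw : z = w
    · exact ⟨R, hzw ▸ hR⟩
    have hzw' : z - w ≠ 0 := sub_ne_zero.2 hzw
    set μ := (z - w)⁻¹ with hμ
    have hμ0 : μ ≠ 0 := inv_ne_zero hzw'
    rcases IsCompactOperator.hasEigenvalue_or_mem_resolventSet hc hμ0 with h | h
    · obtain ⟨f, hf, hf0⟩ := h.exists_hasEigenvector
      rw [Module.End.mem_eigenspace_iff] at hf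
      obtain ⟨h1, h2⟩ := hR.mem_domain_of_apply_eq hμ0 hf
      rw [hμ, inv_inv, add_sub_cancel, hz] at h2
      exact absurd (congrArg Subtype.val h2) hf0
    · obtain ⟨B, hB⟩ := spectrum.mem_resolventSet_iff.1 h
      have hB1 : ∀ u, μ • (B⁻¹).1 u - R ((B⁻¹).1 u) = u := by
        intro u
        have h1 := congrArg (fun T : H →L[ℂ] H => T u) B.mul_inv
        rw [hB] at h1
        simpa [Algebra.algebraMap_eq_smul_one] using h1
      have hB2 : ∀ u, (B⁻¹).1 (μ • u - R u) = u := by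
        intro u
        have h1 := congrArg (fun T : H →L[ℂ] H => T u) B.inv_mul
        rw [hB] at h1
        simpa [Algebra.algebraMap_eq_smul_one] using h1
      -- Applying `R` to `(A - z) u = f` gives `u - (z - w) R u = R f`, that is `(μ - R) u = μ R f`.
      refine ⟨μ • ((B⁻¹).1 ∘L R), fun f => ?_, fun u => ?_⟩
      · set u := (μ • ((B⁻¹).1 ∘L R)) f with hu
        have h1 : μ • u - R u = μ • R f := by
          have := congrArg (fun x => μ • x) (hB1 (R f))
          simp only [smul_sub, ← map_smul] at this
          simpa [hu] using this
        have h2 : R (f + (z - w) • u) = u := by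
          rw [map_add, map_smul]
          have h3 := congrArg (fun x => (z - w) • x) h1
          simp only [smul_sub, smul_smul, hμ, mul_inv_cancel₀ hzw', one_smul] at h3
          rw [← h3, sub_add_cancel]
        obtain ⟨h4, h5⟩ := hR.1 (f + (z - w) • u)
        have h6 : u ∈ A.domain := h2 ▸ h4
        have h7 : (⟨R (f + (z - w) • u), h4⟩ : A.domain) = ⟨u, h6⟩ := Subtype.ext h2
        rw [h7, h2] at h5
        refine ⟨h6, ?_⟩
        rw [sub_eq_iff_eq_add] at h5 ⊢
        rw [h5]
        module
      · have h1 : A u - z • (u : H) = (A u - w • (u : H)) - (z - w) • (u : H) := by module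
        rw [h1]
        simp only [smul_apply, ContinuousLinearMap.comp_apply]
        rw [map_sub R (A u - w • (u : H)), hR.2]
        rw [← map_smul, smul_sub, ← map_smul, smul_smul, hμ, inv_mul_cancel₀ hzw', one_smul, ← hμ,
          hB2]

/-- Finiteness of the lower sections gives a least element and finite intervals, and infinitude then
excludes a maximum, so `L` is order isomorphic to `ℕ`. -/
theorem exists_strictMono_range {L : Set ℝ} (hL : L.Infinite)
    (hfin : ∀ c, (L ∩ Set.Iic c).Finite) :
    ∃ l : ℕ → ℝ, StrictMono l ∧ Tendsto l atTop atTop ∧ Set.range l = L := by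
  obtain ⟨l₀, hl₀⟩ := hL.nonempty
  let _ : LocallyFiniteOrder L := LocallyFiniteOrder.ofFiniteIcc fun a b =>
    Set.Finite.of_finite_image (f := Subtype.val)
      ((hfin b).subset (by rintro _ ⟨x, hx, rfl⟩; exact ⟨x.2, hx.2⟩)) Subtype.val_injective.injOn
  obtain ⟨b, hb, hbmin⟩ := Set.exists_min_image _ id (hfin l₀) ⟨l₀, hl₀, Set.mem_Iic.2 le_rfl⟩
  let _ : OrderBot L :=
    { bot := ⟨b, hb.1⟩
      bot_le := fun x => by
        rcases le_total (x : ℝ) l₀ with h | h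
        · exact hbmin x ⟨x.2, h⟩
        · exact le_trans (b := l₀) hb.2 h }
  have : NoMaxOrder L := ⟨fun a => by
    by_contra! h
    exact hL ((hfin a).subset fun x hx => ⟨hx, h ⟨x, hx⟩⟩)⟩
  let _ : SuccOrder L := LinearLocallyFiniteOrder.succOrder L
  let _ : PredOrder L := LinearLocallyFiniteOrder.predOrder L
  let e : L ≃o ℕ := orderIsoNatOfLinearSuccPredArch
  have hmono : StrictMono fun k => (e.symm k : ℝ) := fun a b hab => e.symm.strictMono hab
  have hrange : Set.range (fun k => (e.symm k : ℝ)) = L := by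
    ext x
    refine ⟨?_, fun hx => ⟨e ⟨x, hx⟩, by simp⟩⟩
    rintro ⟨k, rfl⟩
    exact (e.symm k).2
  refine ⟨fun k => e.symm k, hmono, ?_, hrange⟩
  refine tendsto_atTop_atTop_of_monotone hmono.monotone fun c => ?_
  by_contra! h
  refine hL ((hfin c).subset fun x hx => ⟨hx, ?_⟩)
  rw [← hrange] at hx
  obtain ⟨k, rfl⟩ := hx
  exact (h k).le

/-- A semibounded operator with compact self-adjoint resolvent on an infinite-dimensional space
has discrete spectrum. -/
theorem hasDiscreteSpectrum_of_isCompactOperator [CompleteSpace H] {A : H →ₗ.[ℂ] H} {M : ℝ}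
    {R : H →L[ℂ] H} (hR : IsResolventAt A (-M : ℝ) R) (hc : IsCompactOperator R)
    (hs : ∀ f g, inner ℂ (R f) g = inner ℂ f (R g))
    (hpos : ∀ u : A.domain, ‖(u : H)‖ ^ 2 ≤ (inner ℂ (u : H) (A u + (M : ℂ) • (u : H))).re)
    (hinf : ¬ FiniteDimensional ℂ H) : HasDiscreteSpectrum A := by
  have hs' : R.toLinearMap.IsSymmetric := hs
  -- An eigenvector of `A` for `z` is one of `R` for `1 / (z + M)`. Symmetry of `R` makes this
  -- number real, and `hpos` tested on the eigenvector gives `z + M ≥ 1`.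
  have hreal : ∀ z, eigenspaceOf A z ≠ ⊥ →
      ∃ l : ℝ, z = l ∧ 1 ≤ l + M ∧ ∃ f, ‖f‖ = 1 ∧ R f = ((l + M : ℝ) : ℂ)⁻¹ • f := by
    intro z hz
    obtain ⟨u, hu, hu0⟩ := Submodule.exists_mem_ne_zero_of_ne_bot hz
    have hu0' : (u : H) ≠ 0 := fun h => hu0 (Subtype.ext h)
    have h1 := hR.apply_eigenvector hu
    have hzM : z - ((-M : ℝ) : ℂ) ≠ 0 := by
      intro h
      rw [h, zero_smul] at h1
      exact hu0' h1.symm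
    have h2 : R (u : H) = (z - ((-M : ℝ) : ℂ))⁻¹ • (u : H) := by
      conv_rhs => rw [← h1]
      rw [smul_smul, inv_mul_cancel₀ hzM, one_smul]
    have h3 : Module.End.HasEigenvalue R.toLinearMap ((z - ((-M : ℝ) : ℂ))⁻¹) :=
      Module.End.hasEigenvalue_of_hasEigenvector ⟨Module.End.mem_eigenspace_iff.2 h2, hu0'⟩
    have h4 := hs'.conj_eigenvalue_eq_self h3
    rw [map_inv₀, inv_inj, map_sub, Complex.conj_ofReal, sub_left_inj] at h4
    obtain ⟨l, rfl⟩ := Complex.conj_eq_iff_real.1 h4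
    have h5 := hpos u
    rw [mem_eigenspaceOf.1 hu, ← add_smul, inner_smul_right, ← Complex.ofReal_add,
      Complex.re_ofReal_mul, inner_self_re] at h5
    have h6 : 0 < ‖(u : H)‖ ^ 2 := by positivity
    refine ⟨l, rfl, by nlinarith, ((‖(u : H)‖ : ℂ)⁻¹) • (u : H), ?_, ?_⟩
    · rw [norm_smul, norm_inv, Complex.norm_real, norm_norm,
        inv_mul_cancel₀ (norm_ne_zero_iff.2 hu0')]
    · rw [map_smul, h2, smul_comm]
      congr 2
      push_cast
      ring
  set L : Set ℝ := {l | eigenspaceOf A (l : ℂ) ≠ ⊥} with hLdef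
  have hspec : spectrumOf A = (fun l : ℝ => (l : ℂ)) '' L := by
    rw [spectrumOf_eq_of_isCompactOperator hR hc]
    ext z
    refine ⟨fun hz => ?_, ?_⟩
    · obtain ⟨l, rfl, -⟩ := hreal z hz
      exact ⟨l, hz, rfl⟩
    · rintro ⟨l, hl, rfl⟩
      exact hl
  have hfd : ∀ l ∈ L, FiniteDimensional ℂ (Module.End.eigenspace R.toLinearMap
      (((l + M : ℝ) : ℂ)⁻¹)) := by
    intro l hl
    obtain ⟨l', h, h1, -⟩ := hreal l hl
    rw [Complex.ofReal_inj] at h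
    subst h
    refine ContinuousLinearMap.finite_dimensional_eigenspace hc _ (inv_ne_zero ?_)
    exact_mod_cast (by linarith : l + M ≠ 0)
  have hfin : ∀ c, (L ∩ Set.Iic c).Finite := by
    intro c
    by_contra hinf'
    -- Infinitely many eigenvalues below `c` would give orthonormal `f k` whose images `R (f k)` are
    -- mutually orthogonal and of norm at least `1 / (c + M)`. No subsequence of these is Cauchy,
    -- against compactness of `R`.
    let e := Set.Infinite.natEmbedding _ hinf'
    have h1 : ∀ k, ∃ f : H, ‖f‖ = 1 ∧ R f = (((e k : ℝ) + M : ℝ) : ℂ)⁻¹ • f ∧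
        1 ≤ (e k : ℝ) + M := by
      intro k
      obtain ⟨l, h, h1, f, hf⟩ := hreal _ (e k).2.1
      rw [Complex.ofReal_inj] at h
      rw [h]
      exact ⟨f, hf.1, hf.2, h1⟩
    choose f hf1 hfR hfM using h1
    have horth : ∀ i j, i ≠ j → inner ℂ (f i) (f j) = 0 := by
      intro i j hij
      have h2 := hs (f i) (f j)
      rw [hfR, hfR, inner_smul_left, inner_smul_right, map_inv₀, Complex.conj_ofReal] at h2
      by_contra h3
      have h4 := mul_right_cancel₀ h3 h2
      rw [inv_inj, Complex.ofReal_inj, add_left_inj] at h4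
      exact hij (e.injective (Subtype.ext h4))
    obtain ⟨K, hK, hK'⟩ := hc.image_closedBall_subset_compact (f := R.toLinearMap) 1
    obtain ⟨y, -, ψ, hψ, hψy⟩ := hK.tendsto_subseq (x := fun k => R (f k))
      (fun k => hK' ⟨f k, by simp [hf1], rfl⟩)
    have h2 := hψy.cauchySeq
    have h0 : 1 ≤ c + M := (hfM 0).trans (by have := (e 0).2.2; simpa using this)
    rw [Metric.cauchySeq_iff'] at h2
    obtain ⟨N, hN⟩ := h2 ((c + M)⁻¹) (by positivity)
    have h3 := hN (N + 1) (Nat.le_succ N)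
    simp only [Function.comp_apply, dist_eq_norm] at h3
    have h4 : ‖R (f (ψ N))‖ ^ 2 ≤ ‖R (f (ψ (N + 1))) - R (f (ψ N))‖ ^ 2 := by
      rw [@norm_sub_sq ℂ]
      have h5 : inner ℂ (R (f (ψ (N + 1)))) (R (f (ψ N))) = 0 := by
        rw [hfR, hfR, inner_smul_left, inner_smul_right, horth _ _ (by
          rw [Ne, hψ.injective.eq_iff]; omega), mul_zero, mul_zero]
      rw [h5]
      simp
    have h6 : (c + M)⁻¹ ≤ ‖R (f (ψ N))‖ := by
      rw [hfR, norm_smul, hf1, mul_one, norm_inv, Complex.norm_real,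
        Real.norm_of_nonneg (by linarith [hfM (ψ N)])]
      have h7 : (e (ψ N) : ℝ) ≤ c := (e (ψ N)).2.2
      exact inv_anti₀ (by linarith [hfM (ψ N)]) (by linarith)
    have h8 := (sq_le_sq₀ (norm_nonneg _) (norm_nonneg _)).1 h4
    linarith
  -- The eigenspaces of `R` have dense sum and `R` has trivial kernel, so with finitely many
  -- eigenvalues of `A` the whole space would be a finite sum of finite-dimensional eigenspaces.
  have hLinf : L.Infinite := by
    intro hLf
    apply hinf
    have hV := ContinuousLinearMap.orthogonalComplement_iSup_eigenspaces_eq_bot hc hs'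
    have hle : (⨆ μ, Module.End.eigenspace R.toLinearMap μ) ≤
        ⨆ l : L, Module.End.eigenspace R.toLinearMap (((l + M : ℝ) : ℂ)⁻¹) := by
      refine iSup_le fun μ f hf => ?_
      by_cases hf0 : f = 0
      · rw [hf0]
        exact Submodule.zero_mem _
      have hfR : R f = μ • f := Module.End.mem_eigenspace_iff.1 hf
      have hμ : μ ≠ 0 := by
        rintro rfl
        obtain ⟨h, h1⟩ := hR.1 f
        have h2 : (⟨R f, h⟩ : A.domain) = 0 := Subtype.ext (hfR.trans (zero_smul _ _))
        rw [h2, hfR, LinearPMap.map_zero, zero_smul, smul_zero, sub_zero] at h1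
        exact hf0 h1.symm
      obtain ⟨h, h1⟩ := hR.mem_domain_of_apply_eq hμ hfR
      have h2 : eigenspaceOf A (((-M : ℝ) : ℂ) + μ⁻¹) ≠ ⊥ := fun h3 => by
        rw [h3] at h1
        exact hf0 (congrArg Subtype.val ((Submodule.mem_bot ℂ).1 h1))
      obtain ⟨l, hl, -⟩ := hreal _ h2
      have hl' : l ∈ L := by rw [hLdef, Set.mem_ofPred_eq, ← hl]; exact h2
      refine Submodule.mem_iSup_of_mem (⟨l, hl'⟩ : L) ?_
      have h5 : ((l + M : ℝ) : ℂ)⁻¹ = μ := by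
        rw [Complex.ofReal_add, ← hl, Complex.ofReal_neg, neg_add_cancel_comm, inv_inv]
      rw [h5]
      exact hf
    have : Finite L := hLf
    have : ∀ l : L, FiniteDimensional ℂ (Module.End.eigenspace R.toLinearMap
        (((l + M : ℝ) : ℂ)⁻¹)) := fun l => hfd l l.2
    set V : Submodule ℂ H := ⨆ l : L, Module.End.eigenspace R.toLinearMap (((l + M : ℝ) : ℂ)⁻¹)
    have hfdV : FiniteDimensional ℂ V := Submodule.finite_iSup _
    have hV' : Vᗮ = ⊥ := eq_bot_iff.2 (hV ▸ Submodule.orthogonal_le hle)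
    have hVtop : V = ⊤ := (Submodule.orthogonal_eq_bot_iff).1 hV'
    rw [hVtop] at hfdV
    exact Module.Finite.equiv (Submodule.topEquiv (R := ℂ) (M := H))
  obtain ⟨l, hl1, hl2, hl3⟩ := exists_strictMono_range hLinf hfin
  refine ⟨l, hl1, hl2, ?_, fun k => ?_⟩
  · rw [hspec, ← hl3, ← Set.range_comp]
    rfl
  · have hk : l k ∈ L := hl3 ▸ Set.mem_range_self k
    refine ⟨hk, ?_⟩
    have := hfd _ hk
    have hmem : ∀ u : eigenspaceOf A (l k), ((u : A.domain) : H) ∈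
        Module.End.eigenspace R.toLinearMap (((l k + M : ℝ) : ℂ)⁻¹) := by
      intro u
      obtain ⟨l', h, h1, -⟩ := hreal _ hk
      rw [Complex.ofReal_inj] at h
      rw [Module.End.mem_eigenspace_iff]
      have h2 := hR.apply_eigenvector u.2
      have h3 : ((l k + M : ℝ) : ℂ) ≠ 0 := by exact_mod_cast (by linarith : l k + M ≠ 0)
      have h4 : (l k : ℂ) - ((-M : ℝ) : ℂ) = ((l k + M : ℝ) : ℂ) := by push_cast; ring
      rw [h4] at h2
      conv_rhs => rw [← h2]
      rw [smul_smul, inv_mul_cancel₀ h3, one_smul]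
      rfl
    exact FiniteDimensional.of_injective
      (((A.domain.subtype ∘ₗ (eigenspaceOf A (l k)).subtype)).codRestrict _ hmem)
      (fun a b hab => by
        have h := congrArg Subtype.val hab
        exact Subtype.ext (Subtype.ext h))

end Compact

end WeylPDO

end

noncomputable section

namespace WeylPDO

/-! ### Quadratic forms on the Fourier side -/

/-- The weight `1 + |ξ|²`. -/
def jap {n : ℕ} (ξ : Euc n) : ℝ := 1 + ‖ξ‖ ^ 2

section

variable {n : ℕ}

theorem one_le_jap (ξ : Euc n) : 1 ≤ jap ξ := by
  unfold jap
  nlinarith [sq_nonneg ‖ξ‖]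

theorem jap_pos (ξ : Euc n) : 0 < jap ξ := one_pos.trans_le (one_le_jap ξ)

@[fun_prop]
theorem continuous_jap : Continuous (jap : Euc n → ℝ) := by
  unfold jap
  fun_prop

/-- Peetre's inequality. It moves a weight from one frequency to another at the price of a weight in
the difference, which the decay of the kernel absorbs. -/
theorem jap_le_mul (ξ η : Euc n) : jap ξ ≤ 2 * jap (η - ξ) * jap η := by
  have h : ‖ξ‖ ≤ ‖η‖ + ‖η - ξ‖ := by
    have := norm_sub_le η (η - ξ)
    rwa [sub_sub_cancel] at this
  unfold jap
  have h1 : ‖ξ‖ ^ 2 ≤ (‖η‖ + ‖η - ξ‖) ^ 2 := by gcongr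
  nlinarith [sq_nonneg (‖η‖ - ‖η - ξ‖), mul_nonneg (sq_nonneg ‖η‖) (sq_nonneg ‖η - ξ‖)]

theorem jap_pow_le_mul (m : ℕ) (ξ η : Euc n) :
    jap ξ ^ m ≤ (2 ^ m * jap (η - ξ) ^ m) * jap η ^ m := by
  rw [← mul_pow, ← mul_pow]
  exact pow_le_pow_left₀ (jap_pos _).le (jap_le_mul ξ η) m

theorem jap_le_add {R : ℝ} {ξ ζ : Euc n} (h : ‖ξ - ζ‖ ≤ R) : jap ξ ≤ 2 * (jap ζ + R ^ 2) := by
  have h1 : ‖ξ‖ ≤ ‖ζ‖ + R := by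
    have := norm_add_le (ξ - ζ) ζ
    rw [sub_add_cancel] at this
    linarith
  unfold jap
  have h2 : ‖ξ‖ ^ 2 ≤ (‖ζ‖ + R) ^ 2 := by gcongr
  nlinarith [sq_nonneg (‖ζ‖ - R)]

theorem jap_pow_le_add (m : ℕ) {R : ℝ} {ξ ζ : Euc n} (h : ‖ξ - ζ‖ ≤ R) :
    jap ξ ^ m ≤ 4 ^ m * (jap ζ ^ m + (R ^ 2) ^ m) := by
  have h1 : (jap ζ + R ^ 2) ^ m ≤ 2 ^ m * (jap ζ ^ m + (R ^ 2) ^ m) := by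
    refine (add_pow_le (jap_pos ζ).le (sq_nonneg R) m).trans ?_
    have := jap_pos ζ
    gcongr
    · exact one_le_two
    · exact Nat.sub_le m 1
  calc jap ξ ^ m ≤ (2 * (jap ζ + R ^ 2)) ^ m := pow_le_pow_left₀ (jap_pos ξ).le (jap_le_add h) m
    _ = 2 ^ m * (jap ζ + R ^ 2) ^ m := mul_pow _ _ _
    _ ≤ 2 ^ m * (2 ^ m * (jap ζ ^ m + (R ^ 2) ^ m)) := by gcongr
    _ = _ := by rw [← mul_assoc, ← mul_pow]; norm_num

/-- A normalized window that varies slowly. -/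
theorem exists_window (n : ℕ) {ε : ℝ} (hε : 0 < ε) :
    ∃ (R : ℝ) (G : Euc n → ℝ), 0 < R ∧ Continuous G ∧ (∀ ξ, R < ‖ξ‖ → G ξ = 0) ∧
      ∫ ξ, G ξ ^ 2 = 1 ∧ ∀ h, ∫ ξ, |G ξ| * |G ξ - G (ξ - h)| ≤ ε * ‖h‖ := by
  -- A tent function suffices: only continuity, compact support and the Lipschitz bound are used.
  set g : Euc n → ℝ := fun ξ => max 0 (1 - ‖ξ‖) with hg
  have hgc : Continuous g := by fun_prop
  have hg0 : ∀ ξ, 0 ≤ g ξ := fun ξ => le_max_left _ _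
  have hgs : ∀ ξ, ξ ∉ Metric.closedBall (0 : Euc n) 1 → g ξ = 0 := by
    intro ξ hξ
    rw [mem_closedBall_zero_iff, not_le] at hξ
    exact max_eq_left (by linarith)
  have hgcs : HasCompactSupport g := HasCompactSupport.intro (isCompact_closedBall _ _) hgs
  have hgi : Integrable g := hgc.integrable_of_hasCompactSupport hgcs
  set A := ∫ ξ, g ξ with hA
  set c := ∫ ξ, g ξ ^ 2 with hc
  have hA0 : 0 ≤ A := integral_nonneg hg0
  have hc0 : 0 < c := by
    refine Continuous.integral_pos_of_hasCompactSupport_nonneg_nonzero (x := 0) (by fun_prop) ?_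
      (fun ξ => sq_nonneg _) (by simp [hg])
    exact HasCompactSupport.intro (isCompact_closedBall 0 1) fun ξ hξ => by rw [hgs ξ hξ]; simp
  have hlip : ∀ x y : Euc n, |g x - g y| ≤ ‖x - y‖ := by
    intro x y
    refine (abs_max_sub_max_le_max 0 (1 - ‖x‖) 0 (1 - ‖y‖)).trans (max_le (by simp) ?_)
    rw [sub_sub_sub_cancel_left, norm_sub_rev]
    exact abs_norm_sub_norm_le y x
  clear_value g
  -- Dilating by `R` divides the Lipschitz constant by `R`. After normalization the translation
  -- error is at most `A / (c R) ‖h‖`, which this choice makes at most `ε ‖h‖`.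
  set R := A / (c * ε) + 1 with hR
  have hR0 : 0 < R := by positivity
  set lam := (√(R ^ n * c))⁻¹ with hlam
  have hl0 : 0 ≤ lam := by positivity
  have hlam2 : lam ^ 2 * (R ^ n * c) = 1 := by
    rw [hlam, inv_pow, Real.sq_sqrt (by positivity), inv_mul_cancel₀ (by positivity)]
  have hscale : ∀ F : Euc n → ℝ, ∫ ξ, F (R⁻¹ • ξ) = R ^ n * ∫ ξ, F ξ := by
    intro F
    rw [Measure.integral_comp_inv_smul_of_nonneg _ _ hR0.le]
    simp
  refine ⟨R, fun ξ => lam * g (R⁻¹ • ξ), hR0, by fun_prop, fun ξ hξ => ?_, ?_, fun h => ?_⟩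
  · simp only
    rw [hgs, mul_zero]
    rw [mem_closedBall_zero_iff, norm_smul, Real.norm_of_nonneg (by positivity), not_le,
      ← div_eq_inv_mul, lt_div_iff₀ hR0, one_mul]
    exact hξ
  · simp only [mul_pow]
    rw [integral_const_mul, hscale (fun ξ => g ξ ^ 2), hlam2]
  · have hi : Integrable fun ξ => g (R⁻¹ • ξ) := hgi.comp_smul (inv_ne_zero hR0.ne')
    calc ∫ ξ, |lam * g (R⁻¹ • ξ)| * |lam * g (R⁻¹ • ξ) - lam * g (R⁻¹ • (ξ - h))|
        ≤ ∫ ξ, lam ^ 2 * (R⁻¹ * ‖h‖) * g (R⁻¹ • ξ) := by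
          refine integral_mono_of_nonneg
            (ae_of_all _ fun ξ => mul_nonneg (abs_nonneg _) (abs_nonneg _)) (hi.const_mul _)
            (ae_of_all _ fun ξ => ?_)
          have h1 := hlip (R⁻¹ • ξ) (R⁻¹ • (ξ - h))
          rw [← smul_sub, sub_sub_cancel, norm_smul, Real.norm_of_nonneg (by positivity)] at h1
          simp only
          rw [← mul_sub, abs_mul, abs_mul, abs_of_nonneg hl0, abs_of_nonneg (hg0 _)]
          calc lam * g (R⁻¹ • ξ) * (lam * |g (R⁻¹ • ξ) - g (R⁻¹ • (ξ - h))|)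
              ≤ lam * g (R⁻¹ • ξ) * (lam * (R⁻¹ * ‖h‖)) := by
                have := hg0 (R⁻¹ • ξ)
                gcongr
            _ = _ := by ring
      _ = lam ^ 2 * (R⁻¹ * ‖h‖) * (R ^ n * A) := by rw [integral_const_mul, hscale]
      _ = (lam ^ 2 * (R ^ n * c)) * (A / (c * R)) * ‖h‖ := by field_simp
      _ ≤ ε * ‖h‖ := by
          rw [hlam2, one_mul]
          gcongr
          rw [div_le_iff₀ (by positivity)]
          have h2 : c * ε * R = A + c * ε := by rw [hR]; field_simp
          nlinarith [mul_pos hc0 hε]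

/-- The oscillating factor `e^{i x·ξ}`. -/
def osc (x ξ : Euc n) : ℂ := Complex.exp (Complex.I * ((inner ℝ x ξ : ℝ) : ℂ))

theorem norm_osc (x ξ : Euc n) : ‖osc x ξ‖ = 1 := by
  rw [osc, mul_comm, Complex.norm_exp_ofReal_mul_I]

@[fun_prop]
theorem continuous_osc : Continuous fun z : Euc n × Euc n => osc z.1 z.2 := by
  unfold osc
  fun_prop

@[fun_prop]
theorem Continuous.osc {X : Type*} [TopologicalSpace X] {f g : X → Euc n} (hf : Continuous f)
    (hg : Continuous g) : Continuous fun x => osc (f x) (g x) :=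
  continuous_osc.comp (hf.prodMk hg)

theorem osc_mul_conj (x ζ η : Euc n) : osc x ζ * starRingEnd ℂ (osc x η) =
    Complex.exp (-(Complex.I * ((inner ℝ x (η - ζ) : ℝ) : ℂ))) := by
  rw [osc, osc, ← Complex.exp_conj, ← Complex.exp_add, inner_sub_right]
  congr 1
  simp
  ring

theorem fourierInt_eq_osc (u : Euc n → ℂ) (ξ : Euc n) :
    fourierInt u ξ = ∫ y, starRingEnd ℂ (osc y ξ) * u y := by
  unfold fourierInt
  congr 1
  ext y
  rw [osc, ← Complex.exp_conj]
  simp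

theorem continuous_fourierInt_param {b : Euc n → Euc n → ℂ}
    (hb : Continuous fun z : Euc n × Euc n => b z.1 z.2) {K : Set (Euc n)} (hK : IsCompact K)
    (hbK : ∀ x ∉ K, ∀ ξ, b x ξ = 0) :
    Continuous fun z : Euc n × Euc n => fourierInt (fun x => b x z.2) z.1 := by
  simp only [fourierInt_eq_osc]
  have h : ∀ z : Euc n × Euc n, ∫ y, starRingEnd ℂ (osc y z.1) * b y z.2 =
      ∫ y in K, starRingEnd ℂ (osc y z.1) * b y z.2 := by
    intro z
    refine (setIntegral_eq_integral_of_forall_compl_eq_zero fun x hx => ?_).symm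
    rw [hbK x hx, mul_zero]
  simp only [h]
  refine continuous_parametric_integral_of_continuous (f := fun (z : Euc n × Euc n) (y : Euc n) =>
    starRingEnd ℂ (osc y z.1) * b y z.2) ?_ hK
  have h1 := hb.comp (by fun_prop : Continuous fun p : (Euc n × Euc n) × Euc n => (p.2, p.1.2))
  simp only [Function.comp_def] at h1
  simp only [Function.uncurry_def]
  exact (Complex.continuous_conj.comp (by fun_prop)).mul h1

/-- The bilinear form of a superposition of plane waves, on the Fourier side. -/
theorem integral_osc_mul_conj {B : Euc n → Euc n → ℂ}
    (hB : Continuous fun z : Euc n × Euc n => B z.1 z.2) {K : Set (Euc n)} (hK : IsCompact K)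
    (hBK : ∀ x ∉ K, ∀ ξ, B x ξ = 0) {F : Euc n → ℝ} (hF : Integrable F)
    (hBF : ∀ x ξ, ‖B x ξ‖ ≤ F ξ) {h : Euc n → ℂ} (hh : Continuous h) (hhi : Integrable h) :
    ∫ x, (∫ ζ, osc x ζ * B x ζ) * starRingEnd ℂ (∫ η, osc x η * h η) =
      ∫ p : Euc n × Euc n, starRingEnd ℂ (h p.2) * fourierInt (fun x => B x p.1) (p.2 - p.1) := by
  have h1 : ∀ x, (∫ ζ, osc x ζ * B x ζ) * starRingEnd ℂ (∫ η, osc x η * h η) =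
      ∫ p : Euc n × Euc n, (osc x p.1 * B x p.1) * starRingEnd ℂ (osc x p.2 * h p.2) := by
    intro x
    rw [← integral_conj]
    exact (integral_prod_mul (fun ζ => osc x ζ * B x ζ)
      (fun η => starRingEnd ℂ (osc x η * h η))).symm
  simp only [h1]
  have hc : Continuous fun q : Euc n × (Euc n × Euc n) =>
      (osc q.1 q.2.1 * B q.1 q.2.1) * starRingEnd ℂ (osc q.1 q.2.2 * h q.2.2) := by
    have h2 := hB.comp (by fun_prop : Continuous fun q : Euc n × (Euc n × Euc n) => (q.1, q.2.1))
    simp only [Function.comp_def] at h2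
    exact ((by fun_prop : Continuous fun q : Euc n × (Euc n × Euc n) => osc q.1 q.2.1).mul h2).mul
      (Complex.continuous_conj.comp (by fun_prop))
  rw [integral_integral_swap]
  · refine integral_congr_ae (ae_of_all _ fun p => ?_)
    simp only [fourierInt]
    rw [← integral_const_mul]
    refine integral_congr_ae (ae_of_all _ fun x => ?_)
    simp only
    rw [← osc_mul_conj, map_mul]
    ring
  · have hKi : Integrable (K.indicator fun _ : Euc n => (1 : ℝ)) :=
      (integrable_indicator_iff hK.measurableSet).2 (integrableOn_const hK.measure_lt_top.ne)
    refine (hKi.mul_prod (hF.mul_prod hhi.norm)).mono' hc.aestronglyMeasurable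
      (ae_of_all _ fun q => ?_)
    simp only [Function.uncurry_def]
    rw [norm_mul, norm_mul, RCLike.norm_conj, norm_mul, norm_osc, norm_osc, one_mul, one_mul]
    by_cases hq : q.1 ∈ K
    · rw [Set.indicator_of_mem hq, one_mul]
      gcongr
      exact hBF _ _
    · rw [Set.indicator_of_notMem hq, hBK _ hq]
      simp

/-- Schur's test for a convolution kernel. -/
theorem integral_kernel_le {m : ℕ} {k : Euc n → ℝ} (hk0 : ∀ h, 0 ≤ k h)
    (hk : Integrable fun h => k h * jap h ^ m) {f : Euc n → ℂ}
    (hf2 : Integrable fun ξ => jap ξ ^ m * ‖f ξ‖ ^ 2) (hf0 : Integrable fun ξ => ‖f ξ‖ ^ 2)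
    {δ C : ℝ} (hδ : 0 ≤ δ) (hC : 0 ≤ C) {Φ : Euc n × Euc n → ℂ}
    (hΦ : ∀ p : Euc n × Euc n, ‖Φ p‖ ≤
      ‖f p.1‖ * ‖f p.2‖ * (k (p.2 - p.1) * (δ * jap p.1 ^ m + C))) :
    ‖∫ p, Φ p‖ ≤ 2 ^ m * (∫ h, k h * jap h ^ m) *
      (δ * (∫ ξ, jap ξ ^ m * ‖f ξ‖ ^ 2) + C * ∫ ξ, ‖f ξ‖ ^ 2) := by
  -- `κ` dominates `k` and also contains the Peetre factor. After `|f(ζ)| |f(η)|` is split into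
  -- squares, the weight at `ζ` can thus be replaced by the weight at `η` in the term with
  -- `|f(η)|²`.
  set κ : Euc n → ℝ := fun h => 2 ^ m * (k h * jap h ^ m) with hκ
  have hκi : Integrable κ := hk.const_mul _
  have hκ0 : ∀ h, 0 ≤ κ h := fun h => by
    have := jap_pos h
    have := hk0 h
    positivity
  set w : Euc n → ℝ := fun ξ => δ * (jap ξ ^ m * ‖f ξ‖ ^ 2) + C * ‖f ξ‖ ^ 2 with hw
  have hwi : Integrable w := (hf2.const_mul δ).add (hf0.const_mul C)
  have hI1 : Integrable (fun p : Euc n × Euc n => κ (p.2 - p.1) * w p.1) := by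
    have h1 := (Integrable.convolution_integrand (ContinuousLinearMap.mul ℝ ℝ) hwi hκi).swap
    refine h1.congr (ae_of_all _ fun p => ?_)
    simp [mul_comm]
  have hI2 : Integrable (fun p : Euc n × Euc n => κ (p.2 - p.1) * w p.2) := by
    have hκi' : Integrable (fun h => κ (-h)) := hκi.comp_neg
    have h1 := (Integrable.convolution_integrand (ContinuousLinearMap.mul ℝ ℝ) hwi hκi')
    refine h1.congr (ae_of_all _ fun p => ?_)
    simp [mul_comm]
  have hE1 : ∫ p : Euc n × Euc n, κ (p.2 - p.1) * w p.1 = (∫ h, κ h) * ∫ ξ, w ξ := by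
    rw [Measure.volume_eq_prod, integral_prod _ hI1]
    simp only [integral_mul_const]
    simp only [integral_sub_right_eq_self]
    rw [integral_const_mul]
  have hE2 : ∫ p : Euc n × Euc n, κ (p.2 - p.1) * w p.2 = (∫ h, κ h) * ∫ ξ, w ξ := by
    rw [Measure.volume_eq_prod, integral_prod_symm _ hI2]
    simp only [integral_mul_const]
    simp only [integral_sub_left_eq_self]
    rw [integral_const_mul]
  have hpt : ∀ p : Euc n × Euc n, ‖Φ p‖ ≤
      2⁻¹ * (κ (p.2 - p.1) * w p.1 + κ (p.2 - p.1) * w p.2) := by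
    rintro ⟨ζ, η⟩
    refine (hΦ _).trans ?_
    simp only
    have hJ : ∀ ξ : Euc n, 0 < jap ξ ^ m := fun ξ => pow_pos (jap_pos ξ) m
    have hkh := hk0 (η - ζ)
    have h1 : k (η - ζ) * (δ * jap ζ ^ m + C) ≤ κ (η - ζ) * (δ * jap η ^ m + C) := by
      have h2 : δ * jap ζ ^ m + C ≤ (2 ^ m * jap (η - ζ) ^ m) * (δ * jap η ^ m + C) := by
        have h3 : 1 ≤ 2 ^ m * jap (η - ζ) ^ m :=
          one_le_mul_of_one_le_of_one_le (one_le_pow₀ one_le_two) (one_le_pow₀ (one_le_jap _))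
        have h4 := jap_pow_le_mul m ζ η
        nlinarith
      calc _ ≤ k (η - ζ) * ((2 ^ m * jap (η - ζ) ^ m) * (δ * jap η ^ m + C)) := by gcongr
        _ = _ := by rw [hκ]; ring
    have h1' : k (η - ζ) * (δ * jap ζ ^ m + C) ≤ κ (η - ζ) * (δ * jap ζ ^ m + C) := by
      have h3 : 1 ≤ 2 ^ m * jap (η - ζ) ^ m :=
        one_le_mul_of_one_le_of_one_le (one_le_pow₀ one_le_two) (one_le_pow₀ (one_le_jap _))
      have h5 : k (η - ζ) ≤ κ (η - ζ) := by
        rw [hκ]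
        simp only
        nlinarith
      have := hJ ζ
      gcongr
    have hX0 : 0 ≤ k (η - ζ) * (δ * jap ζ ^ m + C) := by
      have := hJ ζ
      positivity
    have h6 : ‖f ζ‖ * ‖f η‖ ≤ 2⁻¹ * (‖f ζ‖ ^ 2 + ‖f η‖ ^ 2) := by
      nlinarith [sq_nonneg (‖f ζ‖ - ‖f η‖)]
    calc ‖f ζ‖ * ‖f η‖ * (k (η - ζ) * (δ * jap ζ ^ m + C))
        ≤ 2⁻¹ * (‖f ζ‖ ^ 2 + ‖f η‖ ^ 2) * (k (η - ζ) * (δ * jap ζ ^ m + C)) := by gcongr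
      _ = 2⁻¹ * (‖f ζ‖ ^ 2 * (k (η - ζ) * (δ * jap ζ ^ m + C)) +
            ‖f η‖ ^ 2 * (k (η - ζ) * (δ * jap ζ ^ m + C))) := by ring
      _ ≤ 2⁻¹ * (‖f ζ‖ ^ 2 * (κ (η - ζ) * (δ * jap ζ ^ m + C)) +
            ‖f η‖ ^ 2 * (κ (η - ζ) * (δ * jap η ^ m + C))) := by gcongr
      _ = _ := by rw [hw]; ring
  calc ‖∫ p, Φ p‖ ≤ ∫ p : Euc n × Euc n,
        2⁻¹ * (κ (p.2 - p.1) * w p.1 + κ (p.2 - p.1) * w p.2) :=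
        norm_integral_le_of_norm_le ((hI1.add hI2).const_mul _) (ae_of_all _ hpt)
    _ = (∫ h, κ h) * ∫ ξ, w ξ := by
        rw [integral_const_mul, integral_add hI1 hI2, hE1, hE2]
        ring
    _ = _ := by
        rw [hκ, hw, integral_const_mul, integral_add (hf2.const_mul δ) (hf0.const_mul C),
          integral_const_mul, integral_const_mul]

end

end WeylPDO

end

/-! ### Kernel symbols and almost non-negativity of their forms -/

noncomputable section

namespace WeylPDO

section

variable {n : ℕ}

/-- A symbol `b(x, ξ)` with compact `x`-support `K`, growing at most like `⟨ξ⟩^{2m}` and varying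
slowly in `ξ`, with estimates on the partial Fourier transform in `x` in terms of a kernel `k`. -/
structure IsKernelSymbol (m : ℕ) (K : Set (Euc n)) (k : Euc n → ℝ) (b : Euc n → Euc n → ℂ) :
    Prop where
  continuous : Continuous fun z : Euc n × Euc n => b z.1 z.2
  support : ∀ x ∉ K, ∀ ξ, b x ξ = 0
  growth : ∃ C : ℝ, 0 ≤ C ∧ ∀ x ξ, ‖b x ξ‖ ≤ C * jap ξ ^ m
  fourier : ∀ η ξ, ‖fourierInt (fun x => b x ξ) η‖ ≤ k η * jap ξ ^ m
  slow : ∀ R : ℝ, ∀ δ > 0, ∃ C : ℝ, 0 ≤ C ∧ ∀ η ξ ζ : Euc n, ‖ξ - ζ‖ ≤ R →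
    ‖fourierInt (fun x => b x ξ) η - fourierInt (fun x => b x ζ) η‖ ≤ k η * (δ * jap ζ ^ m + C)

theorem IsKernelSymbol.continuous_fourierInt {m : ℕ} {K : Set (Euc n)} (hK : IsCompact K)
    {k : Euc n → ℝ} {b : Euc n → Euc n → ℂ} (hb : IsKernelSymbol m K k b) {Y : Type*}
    [TopologicalSpace Y] {f g : Y → Euc n} (hf : Continuous f) (hg : Continuous g) :
    Continuous fun y => fourierInt (fun x => b x (g y)) (f y) := by
  have h1 := continuous_fourierInt_param hb.continuous hK hb.support
  generalize hF : (fun z : Euc n × Euc n => fourierInt (fun x => b x z.2) z.1) = F at h1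
  have h2 : (fun y => fourierInt (fun x => b x (g y)) (f y)) = F ∘ fun y => (f y, g y) := by
    rw [← hF]
    rfl
  rw [h2]
  exact h1.comp (hf.prodMk hg)

/-- The kernel of the localized quadratic form. -/
def windowKernel (G : Euc n → ℝ) (b : Euc n → Euc n → ℂ) (p : Euc n × Euc n) (ξ : Euc n) : ℂ :=
  (G (ξ - p.1) * G (ξ - p.2) : ℝ) * fourierInt (fun x => b x ξ) (p.2 - p.1)

/-- Since `∫ G² = 1`, the unlocalized kernel is itself an average against `G(ξ - ζ)²`. Two
replacements remain: the symbol at `ζ` by the symbol at `ξ`, with `|ξ - ζ| ≤ R`, controlled by slow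
variation; and one factor `G(ξ - ζ)` by `G(ξ - η)`, controlled by the translation bound on the
window, which costs the factor `1 + |η - ζ|`. -/
theorem IsKernelSymbol.norm_sub_windowKernel_le {m : ℕ} {K : Set (Euc n)} (hK : IsCompact K)
    {k : Euc n → ℝ} {b : Euc n → Euc n → ℂ} (hb : IsKernelSymbol m K k b) (hk0 : ∀ h, 0 ≤ k h)
    {R ε δ C : ℝ} {G : Euc n → ℝ} (hε0 : 0 ≤ ε) (hδ : 0 < δ) (hC : 0 ≤ C)
    (hGc : Continuous G) (hGR : ∀ ξ, R < ‖ξ‖ → G ξ = 0)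
    (hG1 : ∫ ξ, G ξ ^ 2 = 1) (hGε : ∀ h, ∫ ξ, |G ξ| * |G ξ - G (ξ - h)| ≤ ε * ‖h‖)
    (hslow : ∀ η ξ ζ : Euc n, ‖ξ - ζ‖ ≤ R →
      ‖fourierInt (fun x => b x ξ) η - fourierInt (fun x => b x ζ) η‖ ≤ k η * (δ * jap ζ ^ m + C))
    (p : Euc n × Euc n) :
    ‖fourierInt (fun x => b x p.1) (p.2 - p.1) - ∫ ξ, windowKernel G b p ξ‖ ≤
      k (p.2 - p.1) * (1 + ‖p.2 - p.1‖) *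
        ((δ + 4 ^ m * ε) * jap p.1 ^ m + (C + 4 ^ m * (R ^ 2) ^ m * ε)) := by
  obtain ⟨ζ, η⟩ := p
  simp only
  set h := η - ζ with hh
  have hbc' : Continuous fun ξ => fourierInt (fun x => b x ξ) h :=
    hb.continuous_fourierInt hK continuous_const continuous_id
  have hsub : ∀ ξ, ξ - η = ξ - ζ - h := fun ξ => by rw [hh]; abel
  have hcs : ∀ F : Euc n → ℝ, (∀ ξ, G (ξ - ζ) = 0 → F ξ = 0) → HasCompactSupport F := by
    intro F hF
    refine HasCompactSupport.intro (isCompact_closedBall ζ R) fun ξ hξ => hF ξ (hGR _ ?_)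
    rwa [Metric.mem_closedBall, dist_eq_norm, not_le] at hξ
  have hcs' : ∀ F : Euc n → ℂ, (∀ ξ, G (ξ - ζ) = 0 → F ξ = 0) → HasCompactSupport F := by
    intro F hF
    refine HasCompactSupport.intro (isCompact_closedBall ζ R) fun ξ hξ => hF ξ (hGR _ ?_)
    rwa [Metric.mem_closedBall, dist_eq_norm, not_le] at hξ
  have hi1 : Integrable fun ξ => G (ξ - ζ) ^ 2 :=
    Continuous.integrable_of_hasCompactSupport (by fun_prop) (hcs _ fun ξ hξ => by simp [hξ])
  have hi2 : Integrable fun ξ => |G (ξ - ζ)| * |G (ξ - ζ) - G (ξ - ζ - h)| :=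
    Continuous.integrable_of_hasCompactSupport (by fun_prop) (hcs _ fun ξ hξ => by simp [hξ])
  have hi3 : Integrable fun ξ => ((G (ξ - ζ) ^ 2 : ℝ) : ℂ) * fourierInt (fun x => b x ζ) h :=
    hi1.ofReal.mul_const _
  have hi4 : Integrable (windowKernel G b (ζ, η)) := by
    refine Continuous.integrable_of_hasCompactSupport ?_ (hcs' _ fun ξ hξ => ?_)
    · unfold windowKernel
      exact (Complex.continuous_ofReal.comp (by fun_prop)).mul hbc'
    · simp [windowKernel, hξ]
  have hI1 : ∫ ξ, G (ξ - ζ) ^ 2 = 1 := by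
    rw [integral_sub_right_eq_self (fun ξ => G ξ ^ 2) ζ, hG1]
  have hI2 : ∫ ξ, |G (ξ - ζ)| * |G (ξ - ζ) - G (ξ - ζ - h)| ≤ ε * ‖h‖ := by
    rw [integral_sub_right_eq_self (fun ξ => |G ξ| * |G ξ - G (ξ - h)|) ζ]
    exact hGε h
  have h1 : fourierInt (fun x => b x ζ) h =
      ∫ ξ, ((G (ξ - ζ) ^ 2 : ℝ) : ℂ) * fourierInt (fun x => b x ζ) h := by
    rw [integral_mul_const, integral_complex_ofReal, hI1, Complex.ofReal_one, one_mul]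
  rw [h1, ← integral_sub hi3 hi4]
  have hkh := hk0 h
  have hJ : 0 < jap ζ ^ m := pow_pos (jap_pos _) m
  have hε : 0 ≤ ε * ‖h‖ := le_trans (integral_nonneg fun ξ =>
    mul_nonneg (abs_nonneg _) (abs_nonneg _)) (hGε h)
  have hpt : ∀ ξ, ‖((G (ξ - ζ) ^ 2 : ℝ) : ℂ) * fourierInt (fun x => b x ζ) h -
      windowKernel G b (ζ, η) ξ‖ ≤ k h * (δ * jap ζ ^ m + C) * G (ξ - ζ) ^ 2 +
        k h * (4 ^ m * (jap ζ ^ m + (R ^ 2) ^ m)) *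
          (|G (ξ - ζ)| * |G (ξ - ζ) - G (ξ - ζ - h)|) := by
    intro ξ
    by_cases hξ : G (ξ - ζ) = 0
    · simp [windowKernel, hξ]
    have hξR : ‖ξ - ζ‖ ≤ R := by
      by_contra hcon
      exact hξ (hGR _ (not_le.1 hcon))
    have e1 : ((G (ξ - ζ) ^ 2 : ℝ) : ℂ) * fourierInt (fun x => b x ζ) h -
        windowKernel G b (ζ, η) ξ =
        -(((G (ξ - ζ) ^ 2 : ℝ) : ℂ) *
          (fourierInt (fun x => b x ξ) h - fourierInt (fun x => b x ζ) h)) +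
        ((G (ξ - ζ) * (G (ξ - ζ) - G (ξ - ζ - h)) : ℝ) : ℂ) * fourierInt (fun x => b x ξ) h := by
      simp only [windowKernel, hsub ξ, ← hh]
      push_cast
      ring
    rw [e1]
    refine (norm_add_le _ _).trans (add_le_add ?_ ?_)
    · rw [norm_neg, norm_mul, Complex.norm_real, Real.norm_of_nonneg (sq_nonneg _), mul_comm]
      gcongr
      exact hslow h ξ ζ hξR
    · rw [norm_mul, Complex.norm_real, Real.norm_eq_abs, abs_mul, mul_comm]
      gcongr
      refine (hb.fourier h ξ).trans ?_
      gcongr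
      exact jap_pow_le_add m hξR
  refine (norm_integral_le_of_norm_le ((hi1.const_mul _).add (hi2.const_mul _))
    (ae_of_all _ hpt)).trans ?_
  simp only [Pi.add_apply]
  rw [integral_add (hi1.const_mul _) (hi2.const_mul _), integral_const_mul, integral_const_mul,
    hI1, mul_one]
  have hR2 : 0 ≤ (R ^ 2) ^ m := by positivity
  have hε' : 0 ≤ ε * ‖h‖ * ‖h‖ := mul_nonneg hε (norm_nonneg _)
  calc k h * (δ * jap ζ ^ m + C) + k h * (4 ^ m * (jap ζ ^ m + (R ^ 2) ^ m)) *
        ∫ ξ, |G (ξ - ζ)| * |G (ξ - ζ) - G (ξ - ζ - h)|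
      ≤ k h * (δ * jap ζ ^ m + C) + k h * (4 ^ m * (jap ζ ^ m + (R ^ 2) ^ m)) * (ε * ‖h‖) := by
        gcongr
    _ ≤ k h * (1 + ‖h‖) * (δ * jap ζ ^ m + C) +
        k h * (4 ^ m * (jap ζ ^ m + (R ^ 2) ^ m)) * (ε * (1 + ‖h‖)) := by
        have hn := norm_nonneg h
        gcongr
        · nlinarith
        · linarith
    _ = _ := by ring

/-- In the first two variables this is a convolution integrand, and the third is independent of
them. It serves as the majorant for Fubini's theorem in the average over windows. -/
theorem integrable_window_mul {G : Euc n → ℝ} {R : ℝ} (hGc : Continuous G)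
    (hGR : ∀ ξ, R < ‖ξ‖ → G ξ = 0) {g h : Euc n → ℝ} (hg : Integrable g) (hh : Integrable h) :
    Integrable fun q : Euc n × (Euc n × Euc n) => |G (q.1 - q.2.1)| * g q.2.1 * h q.2.2 := by
  have hGi : Integrable fun ξ => |G ξ| := by
    refine Continuous.integrable_of_hasCompactSupport (by fun_prop)
      (HasCompactSupport.intro (isCompact_closedBall 0 R) fun ξ hξ => ?_)
    rw [mem_closedBall_zero_iff, not_le] at hξ
    rw [hGR ξ hξ, abs_zero]
  have h1 := Integrable.convolution_integrand (ContinuousLinearMap.mul ℝ ℝ) hg hGi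
  have h2 := h1.mul_prod hh
  have h3 := (measurePreserving_prodAssoc (volume : Measure (Euc n)) (volume : Measure (Euc n))
    (volume : Measure (Euc n))).symm
  have h4 := h3.integrable_comp_of_integrable h2
  refine h4.congr (ae_of_all _ fun q => ?_)
  simp [MeasurableEquiv.prodAssoc, mul_comm, mul_left_comm]

/-- A form of the sharp Gårding inequality with an arbitrarily small loss: a kernel symbol with
non-negative real part has an almost non-negative quadratic form. -/
theorem IsKernelSymbol.re_form_ge {m : ℕ} {K : Set (Euc n)} (hK : IsCompact K)
    {k : Euc n → ℝ} {b : Euc n → Euc n → ℂ} (hb : IsKernelSymbol m K k b) (hk0 : ∀ h, 0 ≤ k h)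
    (hk1 : ∃ C, ∀ h, k h ≤ C) (hk : Integrable fun h => k h * (1 + ‖h‖) * jap h ^ m)
    (hre : ∀ x ξ, 0 ≤ (b x ξ).re) {δ : ℝ} (hδ : 0 < δ) :
    ∃ C : ℝ, 0 ≤ C ∧ ∀ f : Euc n → ℂ, Continuous f → Integrable (fun ξ => jap ξ ^ m * ‖f ξ‖) →
      Integrable (fun ξ => jap ξ ^ m * ‖f ξ‖ ^ 2) →
      -(δ * ∫ ξ, jap ξ ^ m * ‖f ξ‖ ^ 2) - C * (∫ ξ, ‖f ξ‖ ^ 2) ≤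
        (∫ x, (∫ ζ, osc x ζ * (b x ζ * f ζ)) * starRingEnd ℂ (∫ η, osc x η * f η)).re := by
  set A : ℝ := 2 ^ m * ∫ h, k h * (1 + ‖h‖) * jap h ^ m with hA
  have hA0 : 0 ≤ A := mul_nonneg (by positivity) (integral_nonneg fun h =>
    mul_nonneg (mul_nonneg (hk0 h) (by positivity)) (pow_pos (jap_pos h) m).le)
  -- `A` is the constant of Schur's test. Symbol variation and window translation each contribute
  -- `δ'` (the latter because `ε = δ' / 4 ^ m`), for a total of `2 A δ' ≤ δ`.
  set δ' : ℝ := δ / (2 * (A + 1)) with hδ'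
  have hδ'0 : 0 < δ' := by positivity
  obtain ⟨R, G, hR, hGc, hGR, hG1, hGε⟩ := exists_window n (ε := δ' / 4 ^ m) (by positivity)
  obtain ⟨C, hC, hslow⟩ := hb.slow R δ' hδ'0
  set C' := C + 4 ^ m * (R ^ 2) ^ m * (δ' / 4 ^ m) with hC'
  have hC'0 : 0 ≤ C' := by positivity
  refine ⟨A * C', by positivity, fun f hf hf1 hf2 => ?_⟩
  have hJ1 : ∀ ξ : Euc n, 1 ≤ jap ξ ^ m := fun ξ => one_le_pow₀ (one_le_jap ξ)
  have hfi : Integrable f := by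
    refine hf1.mono' hf.aestronglyMeasurable (ae_of_all _ fun ξ => ?_)
    exact le_mul_of_one_le_left (norm_nonneg _) (hJ1 ξ)
  have hf0 : Integrable fun ξ => ‖f ξ‖ ^ 2 := by
    refine hf2.mono' (by fun_prop) (ae_of_all _ fun ξ => ?_)
    rw [Real.norm_of_nonneg (sq_nonneg _)]
    exact le_mul_of_one_le_left (sq_nonneg _) (hJ1 ξ)
  obtain ⟨Cb, hCb0, hCb⟩ := hb.growth
  obtain ⟨Ck, hCk⟩ := hk1
  have hCk0 : 0 ≤ Ck := (hk0 0).trans (hCk 0)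
  have hfmul : ∀ (c : ℂ) (u : Euc n → ℂ) (η : Euc n),
      fourierInt (fun x => u x * c) η = fourierInt u η * c := by
    intro c u η
    unfold fourierInt
    rw [← integral_mul_const]
    simp only [mul_assoc]
  have hQ1 : ∫ x, (∫ ζ, osc x ζ * (b x ζ * f ζ)) * starRingEnd ℂ (∫ η, osc x η * f η) =
      ∫ p : Euc n × Euc n, starRingEnd ℂ (f p.2) * f p.1 *
        fourierInt (fun x => b x p.1) (p.2 - p.1) := by
    rw [integral_osc_mul_conj (B := fun x ζ => b x ζ * f ζ) (F := fun ζ => Cb * (jap ζ ^ m * ‖f ζ‖))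
      (hb.continuous.mul (by fun_prop)) hK (fun x hx ξ => by rw [hb.support x hx, zero_mul])
      (hf1.const_mul _) (fun x ξ => by
        rw [norm_mul, ← mul_assoc]
        gcongr
        exact hCb x ξ) hf hfi]
    simp only [hfmul]
    congr 1
    ext p
    ring
  obtain ⟨Gb, hGb⟩ : ∃ Gb : ℝ, ∀ ξ, |G ξ| ≤ Gb := by
    obtain ⟨Gb, h⟩ := (isCompact_closedBall (0 : Euc n) R).exists_bound_of_continuousOn
      hGc.continuousOn
    refine ⟨max Gb 0, fun ξ => ?_⟩
    by_cases hξ : ‖ξ‖ ≤ R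
    · exact (h ξ (mem_closedBall_zero_iff.2 hξ)).trans (le_max_left _ _)
    · rw [hGR ξ (not_le.1 hξ), abs_zero]
      exact le_max_right _ _
  have hGb0 : 0 ≤ Gb := (abs_nonneg _).trans (hGb 0)
  -- the localized quadratic form
  set Φ : Euc n → Euc n × Euc n → ℂ := fun ξ p =>
    starRingEnd ℂ (f p.2) * f p.1 * windowKernel G b p ξ with hΦ
  -- With `ξ` frozen the symbol no longer depends on the integration frequencies and factors out,
  -- leaving `∫ b(x, ξ) |∫ e^{i x·η} G(ξ - η) f(η) dη|² dx`.
  have hQ2 : ∀ ξ, 0 ≤ (∫ p, Φ ξ p).re := by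
    intro ξ
    have h1 := integral_osc_mul_conj (B := fun x ζ => b x ξ * ((G (ξ - ζ) : ℂ) * f ζ))
      (F := fun ζ => Cb * jap ξ ^ m * (Gb * ‖f ζ‖)) (h := fun η => (G (ξ - η) : ℂ) * f η)
      ((hb.continuous.comp (by fun_prop : Continuous fun z : Euc n × Euc n => (z.1, ξ))).mul
        (by fun_prop)) hK (fun x hx ξ => by rw [hb.support x hx, zero_mul])
      ((hfi.norm.const_mul _).const_mul _) (fun x ζ => by
        rw [norm_mul, norm_mul, Complex.norm_real, Real.norm_eq_abs]
        have := jap_pos ξ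
        gcongr
        · exact hCb x ξ
        · exact hGb _) (by fun_prop)
      ((hfi.norm.const_mul Gb).mono' (by fun_prop) (ae_of_all _ fun ζ => by
        rw [norm_mul, Complex.norm_real, Real.norm_eq_abs]
        gcongr
        exact hGb _))
    have h2 : ∫ p, Φ ξ p =
        ∫ x, b x ξ * ((‖∫ η, osc x η * ((G (ξ - η) : ℂ) * f η)‖ ^ 2 : ℝ) : ℂ) := by
      have h3 : ∫ p, Φ ξ p = ∫ p : Euc n × Euc n,
          starRingEnd ℂ ((G (ξ - p.2) : ℂ) * f p.2) *
          fourierInt (fun x => b x ξ * ((G (ξ - p.1) : ℂ) * f p.1)) (p.2 - p.1) := by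
        congr 1
        ext p
        rw [hfmul, hΦ, map_mul, Complex.conj_ofReal]
        simp only [windowKernel]
        push_cast
        ring
      rw [h3, ← h1]
      congr 1
      ext x
      have h4 : ∫ ζ, osc x ζ * (b x ξ * ((G (ξ - ζ) : ℂ) * f ζ)) =
          b x ξ * ∫ ζ, osc x ζ * ((G (ξ - ζ) : ℂ) * f ζ) := by
        rw [← integral_const_mul]
        congr 1
        ext ζ
        ring
      rw [h4, mul_assoc, Complex.mul_conj, Complex.normSq_eq_norm_sq]
    rw [h2]
    -- Integrability need not be established: otherwise the integral is `0` by convention and the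
    -- claim still holds.
    by_cases hint : Integrable fun x =>
        b x ξ * ((‖∫ η, osc x η * ((G (ξ - η) : ℂ) * f η)‖ ^ 2 : ℝ) : ℂ)
    · have h5 := integral_re hint
      simp only [RCLike.re_eq_complex_re] at h5
      rw [← h5]
      refine integral_nonneg fun x => ?_
      simp only [Pi.zero_apply]
      rw [Complex.re_mul_ofReal]
      exact mul_nonneg (hre x ξ) (sq_nonneg _)
    · rw [integral_undef hint, Complex.zero_re]
  have hwk : Continuous fun q : Euc n × (Euc n × Euc n) => windowKernel G b q.2 q.1 := by
    unfold windowKernel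
    refine (Complex.continuous_ofReal.comp (by fun_prop)).mul ?_
    exact hb.continuous_fourierInt hK (by fun_prop) (by fun_prop)
  have hΦi : Integrable (Function.uncurry Φ) (volume.prod volume) := by
    have h1 := (integrable_window_mul hGc hGR hf1 hfi.norm).const_mul
      (Gb * (Ck * (4 ^ m * (1 + (R ^ 2) ^ m))))
    refine h1.mono' ?_ (ae_of_all _ fun q => ?_)
    · refine Continuous.aestronglyMeasurable ?_
      simp only [Function.uncurry_def, hΦ]
      refine Continuous.mul ?_ hwk
      exact (Complex.continuous_conj.comp (by fun_prop)).mul (by fun_prop)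
    · obtain ⟨ξ, ζ, η⟩ := q
      simp only [Function.uncurry_def, hΦ, windowKernel]
      rw [norm_mul, norm_mul, RCLike.norm_conj, norm_mul, Complex.norm_real, Real.norm_eq_abs,
        abs_mul]
      by_cases hξ : ‖ξ - ζ‖ ≤ R
      · have h2 : ‖fourierInt (fun x => b x ξ) (η - ζ)‖ ≤
            Ck * (4 ^ m * (1 + (R ^ 2) ^ m) * jap ζ ^ m) := by
          refine (hb.fourier _ _).trans (mul_le_mul (hCk _) ?_ (pow_pos (jap_pos _) m).le hCk0)
          refine (jap_pow_le_add m hξ).trans ?_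
          rw [mul_assoc]
          gcongr
          nlinarith [hJ1 ζ, pow_nonneg (sq_nonneg R) m]
        calc ‖f η‖ * ‖f ζ‖ * (|G (ξ - ζ)| * |G (ξ - η)| *
              ‖fourierInt (fun x => b x ξ) (η - ζ)‖)
            ≤ ‖f η‖ * ‖f ζ‖ * (|G (ξ - ζ)| * Gb *
              (Ck * (4 ^ m * (1 + (R ^ 2) ^ m) * jap ζ ^ m))) := by
              gcongr
              exact hGb _
          _ = _ := by ring
      · rw [hGR _ (not_le.1 hξ)]
        simp
  have hQ3 : 0 ≤ (∫ p, ∫ ξ, Φ ξ p).re := by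
    rw [← integral_integral_swap hΦi]
    have h1 := integral_re hΦi.integral_prod_left
    simp only [RCLike.re_eq_complex_re, Function.uncurry_def] at h1
    rw [← h1]
    exact integral_nonneg hQ2
  have hi1 : Integrable fun p : Euc n × Euc n => starRingEnd ℂ (f p.2) * f p.1 *
        fourierInt (fun x => b x p.1) (p.2 - p.1) := by
    have h1 := (hf1.mul_prod hfi.norm).const_mul Ck
    refine h1.mono' ?_ (ae_of_all _ fun p => ?_)
    · refine Continuous.aestronglyMeasurable (Continuous.mul ?_ ?_)
      · exact (Complex.continuous_conj.comp (by fun_prop)).mul (by fun_prop)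
      · exact hb.continuous_fourierInt hK (by fun_prop) (by fun_prop)
    · rw [norm_mul, norm_mul, RCLike.norm_conj]
      have h2 : ‖fourierInt (fun x => b x p.1) (p.2 - p.1)‖ ≤ Ck * jap p.1 ^ m :=
        (hb.fourier _ _).trans (by have := jap_pos p.1; gcongr; exact hCk _)
      calc _ ≤ ‖f p.2‖ * ‖f p.1‖ * (Ck * jap p.1 ^ m) := by gcongr
        _ = _ := by ring
  have hdiff : ∫ p : Euc n × Euc n, (starRingEnd ℂ (f p.2) * f p.1 *
        (fourierInt (fun x => b x p.1) (p.2 - p.1) - ∫ ξ, windowKernel G b p ξ)) =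
      (∫ p : Euc n × Euc n, starRingEnd ℂ (f p.2) * f p.1 *
        fourierInt (fun x => b x p.1) (p.2 - p.1)) - ∫ p, ∫ ξ, Φ ξ p := by
    have h1 : Integrable fun p => ∫ ξ, Φ ξ p := hΦi.integral_prod_right
    rw [← integral_sub hi1 h1]
    congr 1
    ext p
    simp only [hΦ]
    rw [integral_const_mul, mul_sub]
  have hbound := integral_kernel_le (m := m) (k := fun h => k h * (1 + ‖h‖))
    (fun h => mul_nonneg (hk0 h) (by positivity)) hk hf2 hf0
    (δ := δ' + 4 ^ m * (δ' / 4 ^ m)) (C := C') (by positivity) hC'0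
    (Φ := fun p => starRingEnd ℂ (f p.2) * f p.1 *
        (fourierInt (fun x => b x p.1) (p.2 - p.1) - ∫ ξ, windowKernel G b p ξ)) (fun p => by
      rw [norm_mul, norm_mul, RCLike.norm_conj, mul_comm ‖f p.2‖]
      gcongr
      exact hb.norm_sub_windowKernel_le hK hk0 (by positivity) hδ'0 hC hGc hGR hG1 hGε hslow p)
  rw [hdiff, ← hA] at hbound
  rw [hQ1]
  have h6 := (abs_le.1 ((Complex.abs_re_le_norm _).trans hbound)).1
  rw [Complex.sub_re] at h6
  have h7 : A * (δ' + 4 ^ m * (δ' / 4 ^ m)) ≤ δ := by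
    rw [mul_div_cancel₀ _ (by positivity), hδ']
    have : A * (δ / (2 * (A + 1)) + δ / (2 * (A + 1))) = δ * (A / (A + 1)) := by field_simp; ring
    rw [this]
    have h8 : A / (A + 1) ≤ 1 := by rw [div_le_one (by positivity)]; linarith
    nlinarith
  have h8 : 0 ≤ ∫ ξ, jap ξ ^ m * ‖f ξ‖ ^ 2 := integral_nonneg fun ξ =>
    mul_nonneg (zero_le_one.trans (hJ1 ξ)) (sq_nonneg _)
  nlinarith [mul_le_mul_of_nonneg_right h7 h8]

end

end WeylPDO

end

noncomputable section

namespace WeylPDO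

/-! ### Iterated partial derivatives and decay of Fourier transforms -/

section

variable {n : ℕ}

theorem contDiff_partialDeriv (i : Fin n) {f : Euc n → ℂ} (hf : ContDiff ℝ ∞ f) :
    ContDiff ℝ ∞ (partialDeriv i f) :=
  (hf.fderiv_right (m := ∞) (by simp)).clm_apply contDiff_const

theorem contDiff_partialDeriv_iterate (i : Fin n) (k : ℕ) {f : Euc n → ℂ} (hf : ContDiff ℝ ∞ f) :
    ContDiff ℝ ∞ ((partialDeriv i)^[k] f) := by
  induction k generalizing f with
  | zero => exact hf
  | succ k ih => exact ih (contDiff_partialDeriv i hf)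

theorem tsupport_partialDeriv_subset (i : Fin n) (f : Euc n → ℂ) :
    tsupport (partialDeriv i f) ⊆ tsupport f := by
  refine closure_minimal (fun x hx => ?_) (isClosed_tsupport f)
  by_contra h
  refine hx ?_
  have h1 : fderiv ℝ f x = 0 := by
    by_contra h2
    exact h (support_fderiv_subset ℝ h2)
  simp [partialDeriv, h1]

theorem tsupport_partialDeriv_iterate_subset (i : Fin n) (k : ℕ) (f : Euc n → ℂ) :
    tsupport ((partialDeriv i)^[k] f) ⊆ tsupport f := by
  induction k generalizing f with
  | zero => exact subset_rfl
  | succ k ih => exact (ih _).trans (tsupport_partialDeriv_subset i f)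

theorem partialDeriv_add (i : Fin n) {f g : Euc n → ℂ} (hf : ContDiff ℝ ∞ f)
    (hg : ContDiff ℝ ∞ g) :
    partialDeriv i (fun x => f x + g x) = fun x => partialDeriv i f x + partialDeriv i g x := by
  ext x
  simp only [partialDeriv]
  rw [fderiv_fun_add (hf.differentiable (by simp) x) (hg.differentiable (by simp) x)]
  rfl

theorem partialDeriv_sub (i : Fin n) {f g : Euc n → ℂ} (hf : ContDiff ℝ ∞ f)
    (hg : ContDiff ℝ ∞ g) :
    partialDeriv i (fun x => f x - g x) = fun x => partialDeriv i f x - partialDeriv i g x := by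
  ext x
  simp only [partialDeriv]
  rw [fderiv_fun_sub (hf.differentiable (by simp) x) (hg.differentiable (by simp) x)]
  rfl

theorem partialDeriv_mul (i : Fin n) {f g : Euc n → ℂ} (hf : ContDiff ℝ ∞ f)
    (hg : ContDiff ℝ ∞ g) :
    partialDeriv i (fun x => f x * g x) =
      fun x => partialDeriv i f x * g x + f x * partialDeriv i g x := by
  ext x
  simp only [partialDeriv]
  rw [fderiv_fun_mul (hf.differentiable (by simp) x) (hg.differentiable (by simp) x)]
  simp
  ring

theorem partialDeriv_iterate_add (i : Fin n) (k : ℕ) {f g : Euc n → ℂ} (hf : ContDiff ℝ ∞ f)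
    (hg : ContDiff ℝ ∞ g) : (partialDeriv i)^[k] (fun x => f x + g x) =
      fun x => (partialDeriv i)^[k] f x + (partialDeriv i)^[k] g x := by
  induction k generalizing f g with
  | zero => rfl
  | succ k ih =>
    simp only [Function.iterate_succ_apply]
    rw [partialDeriv_add i hf hg, ih (contDiff_partialDeriv i hf) (contDiff_partialDeriv i hg)]

theorem partialDeriv_iterate_sub (i : Fin n) (k : ℕ) {f g : Euc n → ℂ} (hf : ContDiff ℝ ∞ f)
    (hg : ContDiff ℝ ∞ g) : (partialDeriv i)^[k] (fun x => f x - g x) =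
      fun x => (partialDeriv i)^[k] f x - (partialDeriv i)^[k] g x := by
  induction k generalizing f g with
  | zero => rfl
  | succ k ih =>
    simp only [Function.iterate_succ_apply]
    rw [partialDeriv_sub i hf hg, ih (contDiff_partialDeriv i hf) (contDiff_partialDeriv i hg)]

/-- A quantitative consequence of the Leibniz rule. -/
theorem exists_partialDeriv_iterate_mul_bound {ψ : Euc n → ℂ} (hψ : ContDiff ℝ ∞ ψ)
    (hψc : HasCompactSupport ψ) (i : Fin n) (k : ℕ) :
    ∃ C : ℝ, 0 ≤ C ∧ ∀ g : Euc n → ℂ, ContDiff ℝ ∞ g → ∀ B : ℝ, 0 ≤ B →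
      (∀ j ≤ k, ∀ x ∈ tsupport ψ, ‖(partialDeriv i)^[j] g x‖ ≤ B) →
      ∀ x, ‖(partialDeriv i)^[k] (fun x => ψ x * g x) x‖ ≤ C * B := by
  induction k generalizing ψ with
  | zero =>
    obtain ⟨C, hC⟩ := hψc.exists_bound_of_continuous hψ.continuous
    have hC0 : 0 ≤ C := (norm_nonneg _).trans (hC 0)
    refine ⟨C, hC0, fun g _ B hB hg x => ?_⟩
    simp only [Function.iterate_zero, id_eq, norm_mul]
    by_cases hx : x ∈ tsupport ψ
    · exact mul_le_mul (hC x) (hg 0 le_rfl x hx) (norm_nonneg _) hC0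
    · rw [image_eq_zero_of_notMem_tsupport hx, norm_zero, zero_mul]
      positivity
  | succ k ih =>
    -- The induction runs over all `ψ`, so that it applies both to `(∂ψ) g` and to `ψ (∂g)`.
    have hsub := tsupport_partialDeriv_subset i ψ
    obtain ⟨C₁, hC₁, h₁⟩ := ih (contDiff_partialDeriv i hψ)
      (hψc.of_isClosed_subset (isClosed_tsupport _) hsub)
    obtain ⟨C₂, hC₂, h₂⟩ := ih hψ hψc
    refine ⟨C₁ + C₂, by positivity, fun g hg B hB hgB x => ?_⟩
    rw [Function.iterate_succ_apply, partialDeriv_mul i hψ hg,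
      partialDeriv_iterate_add i k ((contDiff_partialDeriv i hψ).mul hg)
        (hψ.mul (contDiff_partialDeriv i hg)), add_mul]
    refine (norm_add_le _ _).trans (add_le_add ?_ ?_)
    · exact h₁ g hg B hB (fun j hj y hy => hgB j (hj.trans k.le_succ) y (hsub hy)) x
    · exact h₂ _ (contDiff_partialDeriv i hg) B hB
        (fun j hj y hy => hgB (j + 1) (Nat.succ_le_succ hj) y hy) x

theorem fourierInt_partialDeriv (i : Fin n) {f : Euc n → ℂ} (hf : ContDiff ℝ ∞ f)
    (hfc : HasCompactSupport f) (ξ : Euc n) :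
    fourierInt (partialDeriv i f) ξ = (Complex.I * (ξ i : ℂ)) * fourierInt f ξ := by
  set e : Euc n → ℂ := fun y => Complex.exp (-(Complex.I * ((inner ℝ y ξ : ℝ) : ℂ))) with he
  set L : Euc n →L[ℝ] ℂ := Complex.ofRealCLM ∘L innerSL ℝ ξ with hL
  have hLy : ∀ y, ((inner ℝ y ξ : ℝ) : ℂ) = L y := fun y => by
    rw [hL, real_inner_comm]
    rfl
  have hed : ∀ y, HasFDerivAt e (e y • (-(Complex.I • L))) y := by
    intro y
    have h1 : HasFDerivAt (fun y => -(Complex.I * L y)) (-(Complex.I • L)) y :=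
      ((L.hasFDerivAt).const_smul Complex.I).neg
    have h2 := h1.cexp
    simp only [he, hLy]
    exact h2
  have hec : Continuous e := continuous_iff_continuousAt.2 fun y => (hed y).continuousAt
  have hev : ∀ y, fderiv ℝ e y (EuclideanSpace.single i 1) = -(Complex.I * (ξ i : ℂ)) * e y := by
    intro y
    rw [(hed y).fderiv]
    have : L (EuclideanSpace.single i 1) = (ξ i : ℂ) := by
      rw [← hLy, EuclideanSpace.inner_single_left]
      simp
    change e y * (-(Complex.I * L (EuclideanSpace.single i 1))) = _
    rw [this]
    ring
  have hec' : Continuous fun y => fderiv ℝ e y (EuclideanSpace.single i 1) := by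
    simp only [hev]
    fun_prop
  have hdc := (contDiff_partialDeriv i hf).continuous
  have hds : HasCompactSupport (partialDeriv i f) :=
    hfc.of_isClosed_subset (isClosed_tsupport _) (tsupport_partialDeriv_subset i f)
  have key := integral_mul_fderiv_eq_neg_fderiv_mul_of_integrable (μ := volume) (f := e) (g := f)
    (v := EuclideanSpace.single i 1)
    ((hec'.mul hf.continuous).integrable_of_hasCompactSupport hfc.mul_left)
    ((hec.mul hdc).integrable_of_hasCompactSupport hds.mul_left)
    ((hec.mul hf.continuous).integrable_of_hasCompactSupport hfc.mul_left)
    (fun y _ => (hed y).differentiableAt) (fun y _ => hf.differentiable (by simp) y)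
  have h3 : fourierInt (partialDeriv i f) ξ = ∫ x, e x * fderiv ℝ f x (EuclideanSpace.single i 1) :=
    rfl
  rw [h3, key, ← integral_neg, fourierInt, ← integral_const_mul]
  refine integral_congr_ae (ae_of_all _ fun y => ?_)
  change -(fderiv ℝ e y (EuclideanSpace.single i 1) * f y) = _ * (e y * f y)
  rw [hev]
  ring

theorem hasCompactSupport_partialDeriv (i : Fin n) {f : Euc n → ℂ} (hf : HasCompactSupport f) :
    HasCompactSupport (partialDeriv i f) :=
  hf.of_isClosed_subset (isClosed_tsupport _) (tsupport_partialDeriv_subset i f)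

theorem fourierInt_partialDeriv_iterate (i : Fin n) (k : ℕ) {f : Euc n → ℂ} (hf : ContDiff ℝ ∞ f)
    (hfc : HasCompactSupport f) (ξ : Euc n) :
    fourierInt ((partialDeriv i)^[k] f) ξ = (Complex.I * (ξ i : ℂ)) ^ k * fourierInt f ξ := by
  induction k generalizing f with
  | zero => simp
  | succ k ih =>
    rw [Function.iterate_succ_apply, ih (contDiff_partialDeriv i hf)
      (hasCompactSupport_partialDeriv i hfc), fourierInt_partialDeriv i hf hfc]
    ring

theorem norm_fourierInt_le {K : Set (Euc n)} (hK : IsCompact K) {f : Euc n → ℂ} {B : ℝ}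
    (hfK : ∀ x ∉ K, f x = 0) (hfB : ∀ x, ‖f x‖ ≤ B) (ξ : Euc n) :
    ‖fourierInt f ξ‖ ≤ volume.real K * B := by
  rw [fourierInt_eq_osc, ← setIntegral_eq_integral_of_forall_compl_eq_zero (s := K)
    (fun x hx => by rw [hfK x hx, mul_zero]), mul_comm]
  refine norm_setIntegral_le_of_norm_le_const hK.measure_lt_top fun x _ => ?_
  rw [norm_mul, RCLike.norm_conj, norm_osc, one_mul]
  exact hfB x

/-- Either all coordinates are at most `1` in modulus or the largest one dominates. Thus pure
derivatives `∂ᵢ^{2N}` already give decay in every direction, and no mixed `x`-derivatives are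
needed. -/
theorem jap_pow_le_sum (N : ℕ) (η : Euc n) :
    jap η ^ N ≤ (n + 1) ^ N * (1 + ∑ i, |η i| ^ (2 * N)) := by
  have hJ : jap η = 1 + ∑ i, |η i| ^ 2 := by
    rw [jap, EuclideanSpace.norm_sq_eq]
    simp
  have hS : 0 ≤ ∑ i, |η i| ^ (2 * N) := Finset.sum_nonneg fun i _ => by positivity
  have hmul : ∀ {t : ℝ}, jap η ≤ (n + 1) * t → t ^ N ≤ 1 + ∑ i, |η i| ^ (2 * N) →
      jap η ^ N ≤ (n + 1) ^ N * (1 + ∑ i, |η i| ^ (2 * N)) := by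
    intro t h1 h2
    calc jap η ^ N ≤ ((n + 1) * t) ^ N := pow_le_pow_left₀ (jap_pos η).le h1 N
      _ = (n + 1) ^ N * t ^ N := mul_pow _ _ _
      _ ≤ _ := by gcongr
  by_cases h : ∀ i, |η i| ^ 2 ≤ 1
  · refine hmul (t := 1) ?_ (by rw [one_pow]; linarith)
    rw [hJ]
    have := Finset.sum_le_card_nsmul Finset.univ (fun i => |η i| ^ 2) 1 fun i _ => h i
    simp only [Finset.card_univ, Fintype.card_fin, nsmul_eq_mul, mul_one] at this
    linarith
  · push Not at h
    obtain ⟨i₁, hi₁⟩ := h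
    obtain ⟨i₀, -, hi₀⟩ := Finset.exists_max_image Finset.univ (fun i => |η i| ^ 2)
      ⟨i₁, Finset.mem_univ _⟩
    have h1 := hi₀ i₁ (Finset.mem_univ _)
    refine hmul (t := |η i₀| ^ 2) ?_ ?_
    · rw [hJ]
      have := Finset.sum_le_card_nsmul Finset.univ (fun i => |η i| ^ 2) (|η i₀| ^ 2)
        fun i hi => hi₀ i hi
      simp only [Finset.card_univ, Fintype.card_fin, nsmul_eq_mul] at this
      linarith
    · rw [← pow_mul]
      have := Finset.single_le_sum (f := fun i => |η i| ^ (2 * N)) (fun i _ => by positivity)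
        (Finset.mem_univ i₀)
      simp only at this
      linarith

/-- Decay of the Fourier transform of a product `ψ g` in terms of derivatives of `g`. -/
theorem exists_fourierInt_mul_bound {ψ : Euc n → ℂ} (hψ : ContDiff ℝ ∞ ψ)
    (hψc : HasCompactSupport ψ) (N : ℕ) :
    ∃ C : ℝ, 0 ≤ C ∧ ∀ g : Euc n → ℂ, ContDiff ℝ ∞ g → ∀ B : ℝ, 0 ≤ B →
      (∀ x ∈ tsupport ψ, ‖g x‖ ≤ B) →
      (∀ i, ∀ j ≤ 2 * N, ∀ x ∈ tsupport ψ, ‖(partialDeriv i)^[j] g x‖ ≤ B) →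
      ∀ η, ‖fourierInt (fun x => ψ x * g x) η‖ ≤ C * (jap η ^ N)⁻¹ * B := by
  obtain ⟨C₀, hC₀⟩ := hψc.exists_bound_of_continuous hψ.continuous
  have hC₀0 : 0 ≤ C₀ := (norm_nonneg _).trans (hC₀ 0)
  choose C hC hCb using fun i => exists_partialDeriv_iterate_mul_bound hψ hψc i (2 * N)
  set V := volume.real (tsupport ψ) with hV
  have hV0 : 0 ≤ V := measureReal_nonneg
  have hS0 : 0 ≤ ∑ i, C i := Finset.sum_nonneg fun i _ => hC i
  refine ⟨(n + 1) ^ N * (V * (C₀ + ∑ i, C i)), by positivity, fun g hg B hB hg0 hgB η => ?_⟩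
  have hzero : ∀ x ∉ tsupport ψ, ψ x * g x = 0 := fun x hx => by
    rw [image_eq_zero_of_notMem_tsupport hx, zero_mul]
  have hts : tsupport (fun x => ψ x * g x) ⊆ tsupport ψ := tsupport_mul_subset_left
  have h0 : ‖fourierInt (fun x => ψ x * g x) η‖ ≤ V * (C₀ * B) := by
    refine norm_fourierInt_le hψc hzero (fun x => ?_) η
    by_cases hx : x ∈ tsupport ψ
    · rw [norm_mul]
      exact mul_le_mul (hC₀ x) (hg0 x hx) (norm_nonneg _) hC₀0
    · rw [hzero x hx, norm_zero]
      positivity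
  have h1 : ∀ i, |η i| ^ (2 * N) * ‖fourierInt (fun x => ψ x * g x) η‖ ≤ V * (C i * B) := by
    intro i
    have h2 := fourierInt_partialDeriv_iterate i (2 * N) (hψ.mul hg)
      (hψc.of_isClosed_subset (isClosed_tsupport _) hts) η
    have h3 := congrArg norm h2
    rw [norm_mul, norm_pow, norm_mul, Complex.norm_I, one_mul, Complex.norm_real,
      Real.norm_eq_abs] at h3
    rw [← h3]
    refine norm_fourierInt_le hψc (fun x hx => ?_) (hCb i g hg B hB fun j hj x hx =>
      hgB i j hj x hx) η
    exact image_eq_zero_of_notMem_tsupport fun h =>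
      hx (hts (tsupport_partialDeriv_iterate_subset i _ _ h))
  have hJ : 0 < jap η ^ N := pow_pos (jap_pos η) N
  rw [mul_right_comm, ← div_eq_mul_inv, le_div_iff₀ hJ]
  set u := ‖fourierInt (fun x => ψ x * g x) η‖ with hu
  have hu0 : 0 ≤ u := norm_nonneg _
  calc u * jap η ^ N ≤ u * ((n + 1) ^ N * (1 + ∑ i, |η i| ^ (2 * N))) := by
        gcongr
        exact jap_pow_le_sum N η
    _ = (n + 1) ^ N * (u + ∑ i, |η i| ^ (2 * N) * u) := by
        rw [← Finset.sum_mul]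
        ring
    _ ≤ (n + 1) ^ N * (V * (C₀ * B) + ∑ i, V * (C i * B)) := by
        refine mul_le_mul_of_nonneg_left (add_le_add h0 (Finset.sum_le_sum fun i _ => h1 i)) ?_
        positivity
    _ = _ := by
        rw [← Finset.mul_sum, ← Finset.sum_mul]
        ring

/-- The mean value inequality in terms of partial derivatives. -/
theorem norm_sub_le_of_partialDeriv_le {f : Euc n → ℂ} (hf : ContDiff ℝ ∞ f) {s : Set (Euc n)}
    (hs : Convex ℝ s) {C : ℝ} (hC : ∀ x ∈ s, ∀ i, ‖partialDeriv i f x‖ ≤ C) {x y : Euc n}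
    (hx : x ∈ s) (hy : y ∈ s) : ‖f y - f x‖ ≤ n * C * ‖y - x‖ := by
  refine hs.norm_image_sub_le_of_norm_fderiv_le (𝕜 := ℝ)
    (fun z _ => hf.differentiable (by simp) z) (fun z hz => ?_) hx hy
  have hC0 : 0 ≤ n * C := by
    rcases Nat.eq_zero_or_pos n with rfl | hn
    · simp
    · exact mul_nonneg (Nat.cast_nonneg _) ((norm_nonneg _).trans (hC z hz ⟨0, hn⟩))
  refine ContinuousLinearMap.opNorm_le_bound _ hC0 fun v => ?_
  have hv : v = ∑ i, v i • EuclideanSpace.single i (1 : ℝ) := by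
    ext j
    simp [Pi.single_apply]
  have h1 : fderiv ℝ f z v = ∑ i, v i • partialDeriv i f z := by
    conv_lhs => rw [hv]
    simp [partialDeriv]
  rw [h1]
  calc ‖∑ i, v i • partialDeriv i f z‖ ≤ ∑ _i : Fin n, ‖v‖ * C := by
        refine norm_sum_le_of_le _ fun i _ => ?_
        rw [norm_smul]
        exact mul_le_mul (EuclideanSpace.norm_eq v ▸ PiLp.norm_apply_le v i) (hC z hz i)
          (norm_nonneg _) (norm_nonneg _)
    _ = n * C * ‖v‖ := by
        simp
        ring

/-! ### Mixed derivatives of symbols -/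

theorem multiDeriv_single (i : Fin n) (k : ℕ) (f : Euc n → ℂ) :
    multiDeriv (Pi.single i k) f = (partialDeriv i)^[k] f := by
  unfold multiDeriv
  have h : ∀ l : List (Fin n), l.Nodup → l.foldr (fun j g =>
      (partialDeriv j)^[(Pi.single i k : Fin n → ℕ) j] g) f =
      if i ∈ l then (partialDeriv i)^[k] f else f := by
    intro l hl
    induction l with
    | nil => simp
    | cons j l ih =>
      rw [List.foldr_cons, ih hl.of_cons]
      by_cases hj : j = i
      · subst hj
        have : j ∉ l := (List.nodup_cons.1 hl).1
        simp [this]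
      · rw [Pi.single_eq_of_ne hj]
        have : i ≠ j := fun h => hj h.symm
        simp [this]
  rw [h _ (List.nodup_finRange n)]
  simp

/-! ### Commuting directional derivatives on the product of position and frequency space -/

section

variable {V : Type*} [NormedAddCommGroup V] [NormedSpace ℝ V]

/-- The derivative of `F` in the direction `v`. -/
def dirDeriv (v : V) (F : V → ℂ) : V → ℂ :=
  fun z => fderiv ℝ F z v

theorem contDiff_dirDeriv (v : V) {F : V → ℂ} (hF : ContDiff ℝ ∞ F) :
    ContDiff ℝ ∞ (dirDeriv v F) :=
  (hF.fderiv_right (m := ∞) (by simp)).clm_apply contDiff_const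

theorem contDiff_dirDeriv_iterate (v : V) (k : ℕ) {F : V → ℂ}
    (hF : ContDiff ℝ ∞ F) : ContDiff ℝ ∞ ((dirDeriv v)^[k] F) := by
  induction k generalizing F with
  | zero => exact hF
  | succ k ih => exact ih (contDiff_dirDeriv v hF)

theorem dirDeriv_comm (v w : V) {F : V → ℂ} (hF : ContDiff ℝ ∞ F) :
    dirDeriv v (dirDeriv w F) = dirDeriv w (dirDeriv v F) := by
  have h : ∀ u u' z, dirDeriv u (dirDeriv u' F) z = fderiv ℝ (fderiv ℝ F) z u u' := by
    intro u u' z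
    have hd : DifferentiableAt ℝ (fderiv ℝ F) z :=
      (hF.fderiv_right (m := ∞) (by simp)).differentiable (by simp) z
    change fderiv ℝ (fun z => fderiv ℝ F z u') z u = _
    rw [fderiv_clm_apply hd (by fun_prop)]
    simp
  ext z
  rw [h, h]
  exact (hF.contDiffAt.isSymmSndFDerivAt (by
    rw [minSmoothness_of_isRCLikeNormedField]
    exact WithTop.coe_le_coe.2 le_top)) v w

theorem dirDeriv_iterate_comm (v w : V) (k : ℕ) {F : V → ℂ}
    (hF : ContDiff ℝ ∞ F) :
    dirDeriv v ((dirDeriv w)^[k] F) = (dirDeriv w)^[k] (dirDeriv v F) := by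
  induction k generalizing F with
  | zero => rfl
  | succ k ih =>
    rw [Function.iterate_succ_apply, ih (contDiff_dirDeriv w hF), dirDeriv_comm v w hF]
    rfl

end

theorem partialDeriv_left_iterate (i : Fin n) (k : ℕ) {F : Euc n × Euc n → ℂ}
    (hF : ContDiff ℝ ∞ F) (ξ : Euc n) : (partialDeriv i)^[k] (fun y => F (y, ξ)) =
      fun x => (dirDeriv (EuclideanSpace.single i 1, 0))^[k] F (x, ξ) := by
  induction k generalizing F with
  | zero => rfl
  | succ k ih =>
    rw [Function.iterate_succ_apply, Function.iterate_succ_apply, ← ih (contDiff_dirDeriv _ hF)]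
    congr 1
    ext x
    have h := (HasFDerivAt.comp (f := fun e => (e, ξ)) x
      (hF.differentiable (by simp) (x, ξ)).hasFDerivAt (hasFDerivAt_prodMk_left x ξ)).fderiv
    simp only [Function.comp_def] at h
    simp [partialDeriv, dirDeriv, h]

theorem partialDeriv_right (j : Fin n) {F : Euc n × Euc n → ℂ} (hF : ContDiff ℝ ∞ F)
    (x ξ : Euc n) : partialDeriv j (fun η => F (x, η)) ξ =
      dirDeriv (0, EuclideanSpace.single j 1) F (x, ξ) := by
  have h := (HasFDerivAt.comp (f := fun e => (x, e)) ξ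
    (hF.differentiable (by simp) (x, ξ)).hasFDerivAt (hasFDerivAt_prodMk_right x ξ)).fderiv
  simp only [Function.comp_def] at h
  simp [partialDeriv, dirDeriv, h]

theorem symbolDeriv_zero_single (i : Fin n) (k : ℕ) (a : Euc n → Euc n → ℂ) (x ξ : Euc n) :
    symbolDeriv 0 (Pi.single i k) a x ξ = (partialDeriv i)^[k] (fun y => a y ξ) x := by
  rw [symbolDeriv, multiDeriv_single]
  simp only [multiDeriv_zero]

/-- `∂_ξ` and `∂_x` commute. -/
theorem partialDeriv_partialDeriv_iterate {a : Euc n → Euc n → ℂ}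
    (ha : ContDiff ℝ ∞ fun z : Euc n × Euc n => a z.1 z.2) (i j : Fin n) (k : ℕ) (x ξ : Euc n) :
    partialDeriv j (fun η => (partialDeriv i)^[k] (fun y => a y η) x) ξ =
      symbolDeriv (Pi.single j 1) (Pi.single i k) a x ξ := by
  -- The symbol estimates have `∂_ξ` innermost, whereas the mean value inequality in `ξ` needs it
  -- outermost. Both orders become directional derivatives of one function on the product, where
  -- second derivatives are symmetric.
  set F : Euc n × Euc n → ℂ := fun z => a z.1 z.2 with hF
  have h1 : ∀ η, (partialDeriv i)^[k] (fun y => a y η) =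
      fun x => (dirDeriv (EuclideanSpace.single i 1, 0))^[k] F (x, η) :=
    partialDeriv_left_iterate i k ha
  rw [symbolDeriv, multiDeriv_single]
  simp only [h1, multiDeriv_single, Function.iterate_one]
  have h2 : ∀ y, partialDeriv j (fun η => a y η) ξ =
      dirDeriv (0, EuclideanSpace.single j 1) F (y, ξ) := fun y => partialDeriv_right j ha y ξ
  simp only [h2]
  rw [partialDeriv_left_iterate i k (contDiff_dirDeriv _ ha) ξ,
    partialDeriv_right j (contDiff_dirDeriv_iterate _ k ha), dirDeriv_iterate_comm _ _ k ha]

theorem contDiff_partialDeriv_iterate_right {a : Euc n → Euc n → ℂ}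
    (ha : ContDiff ℝ ∞ fun z : Euc n × Euc n => a z.1 z.2) (i : Fin n) (k : ℕ) (x : Euc n) :
    ContDiff ℝ ∞ fun ξ => (partialDeriv i)^[k] (fun y => a y ξ) x := by
  have h1 : ∀ η, (partialDeriv i)^[k] (fun y => a y η) =
      fun x => (dirDeriv (EuclideanSpace.single i 1, 0))^[k] (fun z => a z.1 z.2) (x, η) :=
    partialDeriv_left_iterate i k ha
  simp only [h1]
  exact (contDiff_dirDeriv_iterate _ k ha).comp (contDiff_const.prodMk contDiff_id)

end

end WeylPDO

end

noncomputable section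

namespace WeylPDO

/-! ### Estimates for classical symbols -/

/-- Lower-order terms are absorbed: for `J ≥ C / δ` the extra power beats the constant, and for
smaller `J` the left side is bounded. -/
theorem exists_mul_pow_pred_le {m : ℕ} (hm : 0 < m) {C δ : ℝ} (hC : 0 ≤ C) (hδ : 0 < δ) :
    ∃ C' : ℝ, 0 ≤ C' ∧ ∀ J : ℝ, 1 ≤ J → C * J ^ (m - 1) ≤ δ * J ^ m + C' := by
  refine ⟨C * (C / δ) ^ (m - 1), by positivity, fun J hJ => ?_⟩
  have hJ0 : 0 < J := one_pos.trans_le hJ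
  rcases le_total (C / δ) J with h | h
  · have h1 : C ≤ δ * J := by rwa [div_le_iff₀' hδ] at h
    have h2 : J ^ m = J * J ^ (m - 1) := by rw [← pow_succ', Nat.sub_add_cancel hm]
    calc C * J ^ (m - 1) ≤ δ * J * J ^ (m - 1) := by gcongr
      _ = δ * J ^ m := by rw [h2, mul_assoc]
      _ ≤ _ := le_add_of_nonneg_right (by positivity)
  · calc C * J ^ (m - 1) ≤ C * (C / δ) ^ (m - 1) := by gcongr
      _ ≤ _ := le_add_of_nonneg_left (by positivity)

/-- The same absorption for half a power. As `J` stands for `1 + |ξ|²`, the exponent `m - 1/2`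
corresponds to symbol order `2m - 1`. -/
theorem exists_mul_rpow_le (m : ℕ) {C δ : ℝ} (hC : 0 ≤ C) (hδ : 0 < δ) :
    ∃ C' : ℝ, 0 ≤ C' ∧ ∀ J : ℝ, 1 ≤ J →
      C * J ^ ((m : ℝ) - 1 / 2) ≤ δ * J ^ m + C' := by
  refine ⟨C * ((C / δ) ^ 2) ^ m, by positivity, fun J hJ => ?_⟩
  have hJ0 : 0 < J := one_pos.trans_le hJ
  rcases le_total (C / δ) √J with h | h
  · have h1 : C ≤ δ * √J := by rwa [div_le_iff₀' hδ] at h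
    have h2 : √J * J ^ ((m : ℝ) - 1 / 2) = J ^ m := by
      rw [Real.sqrt_eq_rpow, ← Real.rpow_add hJ0, ← Real.rpow_natCast]
      congr 1
      ring
    calc C * J ^ ((m : ℝ) - 1 / 2) ≤ δ * √J * J ^ ((m : ℝ) - 1 / 2) := by gcongr
      _ = δ * J ^ m := by rw [mul_assoc, h2]
      _ ≤ _ := le_add_of_nonneg_right (by positivity)
  · have h1 : J ≤ (C / δ) ^ 2 := by
      rw [← Real.sq_sqrt hJ0.le]
      gcongr
    calc C * J ^ ((m : ℝ) - 1 / 2) ≤ C * J ^ (m : ℝ) := by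
          gcongr
          linarith
      _ ≤ C * ((C / δ) ^ 2) ^ m := by
          rw [Real.rpow_natCast]
          gcongr
      _ ≤ _ := le_add_of_nonneg_left (by positivity)

section

variable {n m : ℕ} {a : Euc n → Euc n → ℂ}

theorem IsSymbol.exists_partialDeriv_bound {s : ℝ} (ha : IsSymbol s a) (hs : s = 2 * m)
    {K : Set (Euc n)} (hK : IsCompact K) (i : Fin n) (k : ℕ) :
    ∃ C : ℝ, 0 ≤ C ∧ ∀ x ∈ K, ∀ ξ,
      ‖(partialDeriv i)^[k] (fun y => a y ξ) x‖ ≤ C * jap ξ ^ m := by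
  obtain ⟨C, hC⟩ := ha.bound K hK 0 (Pi.single i k)
  refine ⟨|C|, abs_nonneg C, fun x hx ξ => ?_⟩
  have h := hC x hx ξ
  rw [symbolDeriv_zero_single] at h
  refine h.trans ?_
  have h1 : (s - ∑ i : Fin n, (((0 : Fin n → ℕ) i : ℕ) : ℝ)) / 2 = (m : ℝ) := by
    rw [hs]
    simp
  rw [h1, Real.rpow_natCast]
  have := jap_pos ξ
  exact mul_le_mul_of_nonneg_right (le_abs_self C) (by unfold jap at this; positivity)

theorem IsSymbol.exists_mixedDeriv_bound {s : ℝ} (ha : IsSymbol s a) (hs : s = 2 * m)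
    {K : Set (Euc n)} (hK : IsCompact K) (i : Fin n) (k : ℕ) :
    ∃ C : ℝ, 0 ≤ C ∧ ∀ x ∈ K, ∀ ξ j,
      ‖partialDeriv j (fun η => (partialDeriv i)^[k] (fun y => a y η) x) ξ‖ ≤
        C * jap ξ ^ ((m : ℝ) - 1 / 2) := by
  choose C hC using fun j => ha.bound K hK (Pi.single j 1) (Pi.single i k)
  refine ⟨∑ j, |C j|, Finset.sum_nonneg fun j _ => abs_nonneg _, fun x hx ξ j => ?_⟩
  rw [partialDeriv_partialDeriv_iterate ha.smooth]
  refine (hC j x hx ξ).trans ?_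
  have h1 : (s - ∑ l : Fin n, (((Pi.single j 1 : Fin n → ℕ) l : ℕ) : ℝ)) / 2 =
      (m : ℝ) - 1 / 2 := by
    have : ∑ l : Fin n, (((Pi.single j 1 : Fin n → ℕ) l : ℕ) : ℝ) = 1 := by
      simp [Pi.single_apply]
    rw [hs, this]
    ring
  rw [h1]
  have h2 : C j ≤ ∑ j, |C j| := (le_abs_self _).trans
    (Finset.single_le_sum (f := fun j => |C j|) (fun j _ => abs_nonneg _) (Finset.mem_univ j))
  exact mul_le_mul_of_nonneg_right h2 (Real.rpow_nonneg (jap_pos ξ).le _)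

/-- One `ξ`-derivative lowers the order from `2m` to `2m - 1`, so on a ball of fixed radius the mean
value inequality gives a variation of lower order, which is absorbed into a small multiple of the
weight plus a constant. -/
theorem IsSymbol.exists_slow_bound {s : ℝ} (ha : IsSymbol s a) (hs : s = 2 * m)
    {K : Set (Euc n)} (hK : IsCompact K) (i : Fin n) (k : ℕ) (R : ℝ) {δ : ℝ} (hδ : 0 < δ) :
    ∃ C : ℝ, 0 ≤ C ∧ ∀ x ∈ K, ∀ ξ ζ : Euc n, ‖ξ - ζ‖ ≤ R →
      ‖(partialDeriv i)^[k] (fun y => a y ξ) x - (partialDeriv i)^[k] (fun y => a y ζ) x‖ ≤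
        δ * jap ζ ^ m + C := by
  obtain ⟨D, hD, hDb⟩ := ha.exists_mixedDeriv_bound hs hK i k
  rcases lt_or_ge R 0 with hR | hR
  · exact ⟨0, le_rfl, fun x _ ξ ζ h => absurd ((norm_nonneg _).trans h) (not_le.2 hR)⟩
  -- The denominator compensates the factor `4 ^ m` from comparing weights on the ball and the
  -- factor at most `n R` from the mean value inequality.
  set δ' := δ / (4 ^ m * (n * R + 1)) with hδ'
  have hδ'0 : 0 < δ' := by positivity
  obtain ⟨C', hC', hC'b⟩ := exists_mul_rpow_le m hD hδ'0
  refine ⟨δ * (R ^ 2) ^ m + (n * R + 1) * C', by positivity, fun x hx ξ ζ h => ?_⟩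
  have hJ : 0 < jap ζ ^ m := pow_pos (jap_pos ζ) m
  set B := δ' * (4 ^ m * (jap ζ ^ m + (R ^ 2) ^ m)) + C' with hB
  have hB0 : 0 ≤ B := by positivity
  have h1 : ∀ p ∈ Metric.closedBall ζ R, ∀ j,
      ‖partialDeriv j (fun η => (partialDeriv i)^[k] (fun y => a y η) x) p‖ ≤ B := by
    intro p hp j
    rw [Metric.mem_closedBall, dist_eq_norm] at hp
    refine (hDb x hx p j).trans ((hC'b _ (one_le_jap p)).trans ?_)
    rw [hB]
    gcongr
    exact jap_pow_le_add m hp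
  have h2 := norm_sub_le_of_partialDeriv_le (contDiff_partialDeriv_iterate_right ha.smooth i k x)
    (convex_closedBall ζ R) h1 (Metric.mem_closedBall_self hR)
    (y := ξ) (by rwa [Metric.mem_closedBall, dist_eq_norm])
  refine h2.trans ?_
  calc n * B * ‖ξ - ζ‖ ≤ n * B * R := by gcongr
    _ ≤ (n * R + 1) * B := by nlinarith
    _ = _ := by
        rw [hB, hδ']
        field_simp
        ring

/-- Localized symbols of order `2m` are kernel symbols. -/
theorem IsSymbol.isKernelSymbol (hn : 0 < n) {s : ℝ} (ha : IsSymbol s a) (hs : s = 2 * m)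
    {ψ : Euc n → ℂ} (hψ : ContDiff ℝ ∞ ψ) (hψc : HasCompactSupport ψ) (N : ℕ) :
    ∃ C : ℝ, 0 ≤ C ∧
      IsKernelSymbol m (tsupport ψ) (fun η => C * (jap η ^ N)⁻¹) (fun x ξ => ψ x * a x ξ) := by
  obtain ⟨C₁, hC₁, hF⟩ := exists_fourierInt_mul_bound hψ hψc N
  have hJ : ∀ ξ : Euc n, 0 < jap ξ ^ m := fun ξ => pow_pos (jap_pos ξ) m
  have hsm : ∀ ξ, ContDiff ℝ ∞ fun x => a x ξ := fun ξ =>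
    ha.smooth.comp (contDiff_id.prodMk contDiff_const)
  set i₀ : Fin n := ⟨0, hn⟩
  obtain ⟨B, hB0, hB⟩ : ∃ B : ℝ, 0 ≤ B ∧ ∀ i, ∀ j ≤ 2 * N, ∀ x ∈ tsupport ψ, ∀ ξ,
      ‖(partialDeriv i)^[j] (fun y => a y ξ) x‖ ≤ B * jap ξ ^ m := by
    choose C hC hCb using fun p : Fin n × Fin (2 * N + 1) =>
      ha.exists_partialDeriv_bound hs hψc p.1 p.2
    refine ⟨∑ p, C p, Finset.sum_nonneg fun p _ => hC p, fun i j hj x hx ξ => ?_⟩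
    refine (hCb (i, ⟨j, Nat.lt_succ_of_le hj⟩) x hx ξ).trans
      (mul_le_mul_of_nonneg_right ?_ (hJ ξ).le)
    exact Finset.single_le_sum (fun p _ => hC p) (Finset.mem_univ _)
  -- One kernel must serve two estimates: the summand `B` covers the size of the transform, the
  -- summand `1` its variation in `ξ`.
  refine ⟨C₁ * (B + 1), by positivity, ⟨?_, ?_, ?_, ?_, ?_⟩⟩
  · exact (hψ.continuous.comp continuous_fst).mul ha.smooth.continuous
  · intro x hx ξ
    rw [image_eq_zero_of_notMem_tsupport hx, zero_mul]
  · obtain ⟨C₀, hC₀⟩ := hψc.exists_bound_of_continuous hψ.continuous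
    have hC₀0 : 0 ≤ C₀ := (norm_nonneg _).trans (hC₀ 0)
    refine ⟨C₀ * B, by positivity, fun x ξ => ?_⟩
    by_cases hx : x ∈ tsupport ψ
    · rw [norm_mul, mul_assoc]
      exact mul_le_mul (hC₀ x) (hB i₀ 0 (Nat.zero_le _) x hx ξ) (norm_nonneg _) hC₀0
    · rw [image_eq_zero_of_notMem_tsupport hx, zero_mul, norm_zero]
      have := hJ ξ
      positivity
  · intro η ξ
    have h1 := hF _ (hsm ξ) (B * jap ξ ^ m) (mul_nonneg hB0 (hJ ξ).le)
      (fun x hx => hB i₀ 0 (Nat.zero_le _) x hx ξ) (fun i j hj x hx => hB i j hj x hx ξ) η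
    refine h1.trans ?_
    have hη : 0 < (jap η ^ N)⁻¹ := inv_pos.2 (pow_pos (jap_pos η) N)
    have h2 : 0 ≤ C₁ * (jap η ^ N)⁻¹ * jap ξ ^ m := by have := hJ ξ; positivity
    nlinarith
  · intro R δ hδ
    choose C hC hCb using fun p : Fin n × Fin (2 * N + 1) =>
      ha.exists_slow_bound hs hψc p.1 p.2 R hδ
    have hS : 0 ≤ ∑ p, C p := Finset.sum_nonneg fun p _ => hC p
    refine ⟨∑ p, C p, hS, fun η ξ ζ h => ?_⟩
    have h0 : ∀ i, ∀ j ≤ 2 * N, ∀ x ∈ tsupport ψ,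
        ‖(partialDeriv i)^[j] (fun y => a y ξ - a y ζ) x‖ ≤ δ * jap ζ ^ m + ∑ p, C p := by
      intro i j hj x hx
      rw [partialDeriv_iterate_sub i j (hsm ξ) (hsm ζ)]
      refine (hCb (i, ⟨j, Nat.lt_succ_of_le hj⟩) x hx ξ ζ h).trans ?_
      gcongr
      exact Finset.single_le_sum (fun p _ => hC p) (Finset.mem_univ _)
    have hX : 0 ≤ δ * jap ζ ^ m + ∑ p, C p := by have := hJ ζ; positivity
    have h1 := hF _ ((hsm ξ).sub (hsm ζ)) _ hX (h0 i₀ 0 (Nat.zero_le _)) h0 η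
    have h2 : fourierInt (fun x => ψ x * a x ξ) η - fourierInt (fun x => ψ x * a x ζ) η =
        fourierInt (fun x => ψ x * (a x ξ - a x ζ)) η := by
      have hint : ∀ ξ, Integrable fun x => starRingEnd ℂ (osc x η) * (ψ x * a x ξ) := fun ξ =>
        Continuous.integrable_of_hasCompactSupport
          ((Complex.continuous_conj.comp (by fun_prop)).mul
            (hψ.continuous.mul (hsm ξ).continuous)) hψc.mul_right.mul_left
      simp only [fourierInt_eq_osc]
      rw [← integral_sub (hint ξ) (hint ζ)]
      congr 1
      ext x
      ring
    rw [h2]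
    refine h1.trans ?_
    have hη : 0 < (jap η ^ N)⁻¹ := inv_pos.2 (pow_pos (jap_pos η) N)
    have h3 : 0 ≤ C₁ * (jap η ^ N)⁻¹ * (δ * jap ζ ^ m + ∑ p, C p) := by positivity
    nlinarith [mul_nonneg hB0 h3]

/-- Localized multiples of the weight are kernel symbols. -/
theorem isKernelSymbol_jap (hm : 0 < m) {ψ : Euc n → ℂ} (hψ : ContDiff ℝ ∞ ψ)
    (hψc : HasCompactSupport ψ) (N : ℕ) (c C : ℝ) :
    ∃ D : ℝ, 0 ≤ D ∧ IsKernelSymbol m (tsupport ψ) (fun η => D * (jap η ^ N)⁻¹)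
      (fun x ξ => ψ x * ((C - c * jap ξ ^ m : ℝ) : ℂ)) := by
  obtain ⟨C₁, hC₁, hF⟩ := exists_fourierInt_mul_bound hψ hψc N
  obtain ⟨C₀, hC₀⟩ := hψc.exists_bound_of_continuous hψ.continuous
  have hC₀0 : 0 ≤ C₀ := (norm_nonneg _).trans (hC₀ 0)
  have hJ1 : ∀ ξ : Euc n, 1 ≤ jap ξ ^ m := fun ξ => one_le_pow₀ (one_le_jap ξ)
  have hp : ∀ ξ : Euc n, |C - c * jap ξ ^ m| ≤ (|C| + |c|) * jap ξ ^ m := by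
    intro ξ
    refine (abs_sub _ _).trans ?_
    rw [abs_mul, abs_of_nonneg (zero_le_one.trans (hJ1 ξ)), add_mul]
    have := mul_le_mul_of_nonneg_left (hJ1 ξ) (abs_nonneg C)
    linarith
  obtain ⟨C₂, hC₂0, hC₂⟩ : ∃ C₂ : ℝ, 0 ≤ C₂ ∧ ∀ η, ‖fourierInt ψ η‖ ≤ C₂ * (jap η ^ N)⁻¹ := by
    have h1 : ∀ (i : Fin n) (j : ℕ) (x : Euc n),
        ‖(partialDeriv i)^[j] (fun _ => (1 : ℂ)) x‖ ≤ 1 := by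
      intro i j x
      rcases j with _ | j
      · simp
      · have h2 : ∀ k, (partialDeriv i)^[k] (fun _ => (0 : ℂ)) = fun _ => 0 := by
          intro k
          induction k with
          | zero => rfl
          | succ k ih =>
            rw [Function.iterate_succ_apply']
            ext x
            simp [ih, partialDeriv]
        have h3 : partialDeriv i (fun _ => (1 : ℂ)) = fun _ => 0 := by
          ext x
          simp [partialDeriv]
        rw [Function.iterate_succ_apply, h3, h2, norm_zero]
        exact zero_le_one
    refine ⟨C₁, hC₁, fun η => ?_⟩
    have h2 := hF (fun _ => 1) contDiff_const 1 zero_le_one (fun x _ => by simp)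
      (fun i j _ x _ => h1 i j x) η
    simpa using h2
  have hfour : ∀ η ξ : Euc n, fourierInt (fun x => ψ x * ((C - c * jap ξ ^ m : ℝ) : ℂ)) η =
      fourierInt ψ η * ((C - c * jap ξ ^ m : ℝ) : ℂ) := by
    intro η ξ
    simp only [fourierInt_eq_osc]
    rw [← integral_mul_const]
    simp only [mul_assoc]
  refine ⟨C₂ * (|C| + |c| + 1), by positivity, ⟨?_, ?_, ?_, ?_, ?_⟩⟩
  · exact (hψ.continuous.comp continuous_fst).mul (Complex.continuous_ofReal.comp (by fun_prop))
  · intro x hx ξ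
    rw [image_eq_zero_of_notMem_tsupport hx, zero_mul]
  · refine ⟨C₀ * (|C| + |c|), by positivity, fun x ξ => ?_⟩
    rw [norm_mul, Complex.norm_real, Real.norm_eq_abs, mul_assoc]
    exact mul_le_mul (hC₀ x) (hp ξ) (abs_nonneg _) hC₀0
  · intro η ξ
    rw [hfour, norm_mul, Complex.norm_real, Real.norm_eq_abs]
    refine (mul_le_mul (hC₂ η) (hp ξ) (abs_nonneg _) ((norm_nonneg _).trans (hC₂ η))).trans ?_
    have h1 : 0 ≤ C₂ * (jap η ^ N)⁻¹ * jap ξ ^ m := mul_nonneg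
      ((norm_nonneg _).trans (hC₂ η)) (zero_le_one.trans (hJ1 ξ))
    nlinarith
  · intro R δ hδ
    rcases lt_or_ge R 0 with hR | hR
    · exact ⟨0, le_rfl, fun η ξ ζ h => absurd ((norm_nonneg _).trans h) (not_le.2 hR)⟩
    set L : ℝ := m * (2 + 2 * R ^ 2) ^ (m - 1) with hL
    have hL0 : 0 ≤ L := by positivity
    -- `|J(ξ) - J(ζ)| ≤ τ J(ζ) + R² / τ + R²`
    set τ : ℝ := δ / (2 * (L + 1)) with hτ
    have hτ0 : 0 < τ := by positivity
    obtain ⟨C₃, hC₃, hC₃b⟩ := exists_mul_pow_pred_le hm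
      (C := L * (R ^ 2 / τ + R ^ 2)) (by positivity) (half_pos hδ)
    refine ⟨C₃, hC₃, fun η ξ ζ h => ?_⟩
    rw [hfour, hfour, ← mul_sub, norm_mul, ← Complex.ofReal_sub, Complex.norm_real,
      Real.norm_eq_abs]
    have e1 : (C - c * jap ξ ^ m) - (C - c * jap ζ ^ m) = -(c * (jap ξ ^ m - jap ζ ^ m)) := by ring
    rw [e1, abs_neg, abs_mul]
    have hζ := one_le_jap ζ
    have h1 : |jap ξ - jap ζ| ≤ τ * jap ζ + (R ^ 2 / τ + R ^ 2) := by
      have h2 : |‖ξ‖ - ‖ζ‖| ≤ R := (abs_norm_sub_norm_le ξ ζ).trans h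
      have h3 : |jap ξ - jap ζ| = |‖ξ‖ - ‖ζ‖| * (‖ξ‖ + ‖ζ‖) := by
        rw [jap, jap, ← abs_of_nonneg (add_nonneg (norm_nonneg ξ) (norm_nonneg ζ)), ← abs_mul]
        congr 1
        ring
      have h4 : ‖ξ‖ ≤ ‖ζ‖ + R := by linarith [(abs_le.1 h2).2]
      have h5 : 2 * R * ‖ζ‖ ≤ τ * ‖ζ‖ ^ 2 + R ^ 2 / τ := by
        have h6 : τ * ‖ζ‖ ^ 2 + R ^ 2 / τ - 2 * R * ‖ζ‖ = (τ * ‖ζ‖ - R) ^ 2 / τ := by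
          field_simp
          ring
        have h7 : 0 ≤ (τ * ‖ζ‖ - R) ^ 2 / τ := by positivity
        linarith
      rw [h3]
      calc |‖ξ‖ - ‖ζ‖| * (‖ξ‖ + ‖ζ‖) ≤ R * (‖ζ‖ + R + ‖ζ‖) := by gcongr
        _ = 2 * R * ‖ζ‖ + R ^ 2 := by ring
        _ ≤ τ * ‖ζ‖ ^ 2 + R ^ 2 / τ + R ^ 2 := by linarith
        _ ≤ _ := by rw [jap]; linarith
    have hmax : max |jap ξ| |jap ζ| ≤ (2 + 2 * R ^ 2) * jap ζ := by
      rw [abs_of_pos (jap_pos ξ), abs_of_pos (jap_pos ζ)]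
      refine max_le ((jap_le_add h).trans ?_) ?_ <;> nlinarith [sq_nonneg R]
    -- The difference of `m`-th powers costs one difference times a power `m - 1`. The part with `τ`
    -- is at most half of the allowed `δ`, and the constant part leaves a power `m - 1` that is
    -- absorbed into the other half.
    have h2 : |jap ξ ^ m - jap ζ ^ m| ≤ δ * jap ζ ^ m + C₃ := by
      have hpow : jap ζ ^ m = jap ζ * jap ζ ^ (m - 1) := by
        rw [← pow_succ', Nat.sub_add_cancel hm]
      calc |jap ξ ^ m - jap ζ ^ m|
          ≤ |jap ξ - jap ζ| * m * max |jap ξ| |jap ζ| ^ (m - 1) := abs_pow_sub_pow_le _ _ _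
        _ ≤ (τ * jap ζ + (R ^ 2 / τ + R ^ 2)) * m * ((2 + 2 * R ^ 2) * jap ζ) ^ (m - 1) := by
            gcongr
        _ = (L * τ) * jap ζ ^ m + (L * (R ^ 2 / τ + R ^ 2)) * jap ζ ^ (m - 1) := by
            rw [hpow, mul_pow, hL]
            ring
        _ ≤ (δ / 2) * jap ζ ^ m + ((δ / 2) * jap ζ ^ m + C₃) := by
            have h8 : L * τ ≤ δ / 2 := by
              have : L * τ = (δ / 2) * (L / (L + 1)) := by rw [hτ]; field_simp
              rw [this]
              have : L / (L + 1) ≤ 1 := by rw [div_le_one (by positivity)]; linarith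
              nlinarith
            have h9 := hC₃b _ hζ
            have := hJ1 ζ
            gcongr
        _ = _ := by ring
    have hη : 0 ≤ C₂ * (jap η ^ N)⁻¹ := (norm_nonneg _).trans (hC₂ η)
    have hX : 0 ≤ δ * jap ζ ^ m + C₃ := (abs_nonneg _).trans h2
    calc ‖fourierInt ψ η‖ * (|c| * |jap ξ ^ m - jap ζ ^ m|)
        ≤ (C₂ * (jap η ^ N)⁻¹) * (|c| * (δ * jap ζ ^ m + C₃)) := by
          gcongr
          exact hC₂ η
      _ ≤ (C₂ * (jap η ^ N)⁻¹) * ((|C| + |c| + 1) * (δ * jap ζ ^ m + C₃)) := by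
          gcongr
          linarith [abs_nonneg C]
      _ = _ := by ring

theorem IsKernelSymbol.add {K : Set (Euc n)} (hK : IsCompact K) {k l : Euc n → ℝ}
    {b d : Euc n → Euc n → ℂ} (hb : IsKernelSymbol m K k b) (hd : IsKernelSymbol m K l d) :
    IsKernelSymbol m K (fun η => k η + l η) (fun x ξ => b x ξ + d x ξ) := by
  have hadd : ∀ η ξ, fourierInt (fun x => b x ξ + d x ξ) η =
      fourierInt (fun x => b x ξ) η + fourierInt (fun x => d x ξ) η := by
    intro η ξ
    have hint : ∀ {k} {b : Euc n → Euc n → ℂ}, IsKernelSymbol m K k b →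
        Integrable fun x => starRingEnd ℂ (osc x η) * b x ξ := fun hb =>
      Continuous.integrable_of_hasCompactSupport
        ((Complex.continuous_conj.comp (by fun_prop)).mul
          (hb.continuous.comp (by fun_prop : Continuous fun x : Euc n => (x, ξ))))
        (HasCompactSupport.intro hK fun x hx => by rw [hb.support x hx, mul_zero])
    simp only [fourierInt_eq_osc]
    rw [← integral_add (hint hb) (hint hd)]
    simp only [mul_add]
  refine ⟨hb.continuous.add hd.continuous, fun x hx ξ => ?_, ?_, fun η ξ => ?_,
    fun R δ hδ => ?_⟩
  · rw [hb.support x hx, hd.support x hx, add_zero]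
  · obtain ⟨C, hC, h⟩ := hb.growth
    obtain ⟨D, hD, h'⟩ := hd.growth
    refine ⟨C + D, by positivity, fun x ξ => (norm_add_le _ _).trans ?_⟩
    rw [add_mul]
    exact add_le_add (h x ξ) (h' x ξ)
  · rw [hadd, add_mul]
    exact (norm_add_le _ _).trans (add_le_add (hb.fourier η ξ) (hd.fourier η ξ))
  · obtain ⟨C, hC, h⟩ := hb.slow R δ hδ
    obtain ⟨D, hD, h'⟩ := hd.slow R δ hδ
    have hk0 : ∀ η, 0 ≤ k η := fun η => by
      have h1 := (norm_nonneg _).trans (hb.fourier η 0)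
      exact nonneg_of_mul_nonneg_left h1 (pow_pos (jap_pos 0) m)
    have hl0 : ∀ η, 0 ≤ l η := fun η => by
      have h1 := (norm_nonneg _).trans (hd.fourier η 0)
      exact nonneg_of_mul_nonneg_left h1 (pow_pos (jap_pos 0) m)
    refine ⟨C + D, by positivity, fun η ξ ζ hξ => ?_⟩
    rw [hadd, hadd, add_sub_add_comm]
    refine (norm_add_le _ _).trans ((add_le_add (h η ξ ζ hξ) (h' η ξ ζ hξ)).trans ?_)
    nlinarith [mul_nonneg (hk0 η) hD, mul_nonneg (hl0 η) hC]

end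

end WeylPDO

end

noncomputable section

namespace WeylPDO

/-! ### Gårding's inequality -/

section

variable {n m : ℕ}

theorem ClassicalSymbol.order_eq (m : ℕ) : (((2 * m : ℤ)) : ℝ) = 2 * (m : ℝ) := by
  push_cast
  ring

/-- The symbol is bounded below by a multiple of the weight on the region of ellipticity. -/
theorem ClassicalSymbol.exists_lower_bound (σ : ClassicalSymbol n (2 * m)) {X : Set (Euc n)}
    (hX : Bornology.IsBounded X) (hn : 0 < n) {C₀ : ℝ} (hC₀ : 0 < C₀)
    (hell : ∀ x ∈ X, ∀ ξ : Euc n, ξ ≠ 0 → C₀ * ‖ξ‖ ^ (2 * m) ≤ (σ.principal x ξ).re) :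
    ∃ c C : ℝ, 0 < c ∧ 0 ≤ C ∧ ∀ x ∈ X, ∀ ξ, c * jap ξ ^ m - C ≤ (σ.toFun x ξ).re := by
  have hK : IsCompact (closure X) := hX.isCompact_closure
  obtain ⟨C₁, hC₁⟩ := (σ.expansion 1).bound _ hK 0 0
  obtain ⟨C₂, hC₂0, hC₂⟩ := σ.isSymbol.exists_partialDeriv_bound
    (ClassicalSymbol.order_eq m) hK ⟨0, hn⟩ 0
  obtain ⟨R₀, hR₀⟩ := σ.cutoff_compact.isBounded.subset_closedBall (0 : Euc n)
  set R := max R₀ 1 with hR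
  -- For `|ξ| ≥ 1` the weight is at most `2 |ξ|²`, so ellipticity gives `2 c` times its `m`-th
  -- power. One `c` is spent on the remainder of order `2m - 1`. For `|ξ| ≤ R`, where the cutoff may
  -- be non-zero, the bound comes from the additive constant.
  set c := C₀ / 2 ^ (m + 1) with hc
  have hc0 : 0 < c := by positivity
  obtain ⟨C', hC'0, hC'⟩ := exists_mul_rpow_le m (abs_nonneg C₁) hc0
  refine ⟨c, C' + (c + C₂) * (1 + R ^ 2) ^ m, hc0, by positivity, fun x hx ξ => ?_⟩
  have hJ : 0 < jap ξ ^ m := pow_pos (jap_pos ξ) m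
  by_cases hξ : ‖ξ‖ ≤ R
  · have h1 := hC₂ x (subset_closure hx) ξ
    simp only [Function.iterate_zero, id_eq] at h1
    have h2 : jap ξ ^ m ≤ (1 + R ^ 2) ^ m := by
      refine pow_le_pow_left₀ (jap_pos ξ).le ?_ m
      unfold jap
      gcongr
    have h3 := (abs_le.1 ((Complex.abs_re_le_norm _).trans h1)).1
    nlinarith [mul_le_mul_of_nonneg_left h2 (add_nonneg hc0.le hC₂0)]
  · push Not at hξ
    have h1 : 1 < ‖ξ‖ := (le_max_right _ _).trans_lt hξ
    have hξ0 : ξ ≠ 0 := by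
      rintro rfl
      simp at h1
      linarith
    have hcut : σ.cutoff ξ = 0 := by
      refine image_eq_zero_of_notMem_tsupport fun h => ?_
      have := hR₀ h
      rw [mem_closedBall_zero_iff] at this
      exact absurd (this.trans (le_max_left _ _)) (not_le.2 hξ)
    have h2 := hC₁ x (subset_closure hx) ξ
    simp only [symbolDeriv, multiDeriv_zero, Finset.range_one, Finset.sum_singleton, hcut, sub_zero,
      Complex.ofReal_one, one_mul] at h2
    have h3 : ((((2 * m : ℤ)) : ℝ) - ((1 : ℕ) : ℝ) -
        ∑ i : Fin n, (((0 : Fin n → ℕ) i : ℕ) : ℝ)) / 2 = (m : ℝ) - 1 / 2 := by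
      rw [ClassicalSymbol.order_eq]
      simp
      ring
    rw [h3] at h2
    have h4 : C₁ * (1 + ‖ξ‖ ^ 2) ^ ((m : ℝ) - 1 / 2) ≤ c * jap ξ ^ m + C' :=
      (mul_le_mul_of_nonneg_right (le_abs_self C₁)
        (Real.rpow_nonneg (jap_pos ξ).le _)).trans (hC' _ (one_le_jap ξ))
    have h5 := (abs_le.1 ((Complex.abs_re_le_norm _).trans (h2.trans h4))).1
    rw [Complex.sub_re] at h5
    have h6 := hell x hx ξ hξ0
    have h7 : jap ξ ^ m ≤ 2 ^ m * ‖ξ‖ ^ (2 * m) := by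
      rw [pow_mul, ← mul_pow]
      refine pow_le_pow_left₀ (jap_pos ξ).le ?_ m
      unfold jap
      nlinarith
    have h8 : 2 * c * jap ξ ^ m ≤ C₀ * ‖ξ‖ ^ (2 * m) := by
      calc 2 * c * jap ξ ^ m ≤ 2 * c * (2 ^ m * ‖ξ‖ ^ (2 * m)) := by gcongr
        _ = _ := by
          rw [hc, pow_succ]
          field_simp
    have h9 : 0 ≤ (c + C₂) * (1 + R ^ 2) ^ m := by positivity
    change (2 * c * jap ξ ^ m : ℝ) ≤ _ at h8
    have h10 : (σ.principal x ξ).re = (σ.part 0 x ξ).re := rfl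
    linarith

/-- The lower bound persists on a neighbourhood of the region of ellipticity. -/
theorem ClassicalSymbol.exists_lower_bound_thickening (σ : ClassicalSymbol n (2 * m))
    {X : Set (Euc n)} (hX : Bornology.IsBounded X) (hn : 0 < n) {C₀ : ℝ} (hC₀ : 0 < C₀)
    (hell : ∀ x ∈ X, ∀ ξ : Euc n, ξ ≠ 0 → C₀ * ‖ξ‖ ^ (2 * m) ≤ (σ.principal x ξ).re) :
    ∃ c C ε : ℝ, 0 < c ∧ 0 ≤ C ∧ 0 < ε ∧ ∀ x ∈ Metric.thickening ε X, ∀ ξ,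
      c * jap ξ ^ m - C ≤ (σ.toFun x ξ).re := by
  obtain ⟨c, C, hc, hC, hcC⟩ := σ.exists_lower_bound hX hn hC₀ hell
  obtain ⟨R, hR⟩ := hX.subset_closedBall (0 : Euc n)
  choose D hD hDb using fun i => σ.isSymbol.exists_partialDeriv_bound
    (ClassicalSymbol.order_eq m) (isCompact_closedBall (0 : Euc n) (R + 1)) i 1
  have hS : 0 ≤ ∑ i, D i := Finset.sum_nonneg fun i _ => hD i
  set T := n * ∑ i, D i with hT
  have hT0 : 0 ≤ T := by positivity
  -- The bound `1` keeps `y` in the ball where the symbol estimates were taken. The other bound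
  -- keeps the variation of the symbol in `x`, at most `T |y - x|` times the weight to the power
  -- `m`, below half of the gain `c`.
  refine ⟨c / 2, C, min 1 (c / (2 * (T + 1))), by positivity, hC, by positivity, fun y hy ξ => ?_⟩
  obtain ⟨x, hx, hxy⟩ := Metric.mem_thickening_iff.1 hy
  have hx' := hR hx
  rw [mem_closedBall_zero_iff] at hx'
  have hd1 : dist y x < 1 := hxy.trans_le (min_le_left _ _)
  have hd2 : dist y x < c / (2 * (T + 1)) := hxy.trans_le (min_le_right _ _)
  rw [dist_eq_norm] at hd1 hd2
  have hy' : ‖y‖ ≤ R + 1 := by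
    have := norm_add_le (y - x) x
    rw [sub_add_cancel] at this
    linarith
  have hJ : 0 < jap ξ ^ m := pow_pos (jap_pos ξ) m
  have h1 := norm_sub_le_of_partialDeriv_le
    (σ.isSymbol.smooth.comp (contDiff_id.prodMk contDiff_const) :
      ContDiff ℝ ∞ fun x => σ.toFun x ξ)
    (convex_closedBall (0 : Euc n) (R + 1)) (C := (∑ i, D i) * jap ξ ^ m)
    (fun z hz i => (hDb i z hz ξ).trans (mul_le_mul_of_nonneg_right
      (Finset.single_le_sum (fun i _ => hD i) (Finset.mem_univ i)) hJ.le))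
    (x := x) (y := y) (mem_closedBall_zero_iff.2 (by linarith)) (mem_closedBall_zero_iff.2 hy')
  have h2 := (abs_le.1 ((Complex.abs_re_le_norm _).trans h1)).1
  rw [Complex.sub_re] at h2
  change _ ≤ (σ.toFun y ξ).re - (σ.toFun x ξ).re at h2
  have h3 : n * ((∑ i, D i) * jap ξ ^ m) * ‖y - x‖ ≤ c / 2 * jap ξ ^ m := by
    have h4 : T * ‖y - x‖ ≤ c / 2 := by
      calc T * ‖y - x‖ ≤ (T + 1) * (c / (2 * (T + 1))) := by gcongr; linarith
        _ = c / 2 := by field_simp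
    calc n * ((∑ i, D i) * jap ξ ^ m) * ‖y - x‖ = (T * ‖y - x‖) * jap ξ ^ m := by rw [hT]; ring
      _ ≤ _ := by gcongr
  have h5 := hcC x hx ξ
  linarith

/-- The function is built to vanish off the `ε / 2`-thickening, which leaves room for its closed
support inside the open `ε`-thickening. -/
theorem exists_cutoff {X : Set (Euc n)} (hX : Bornology.IsBounded X) {ε : ℝ} (hε : 0 < ε) :
    ∃ ψ : Euc n → ℝ, ContDiff ℝ ∞ ψ ∧ HasCompactSupport ψ ∧ (∀ x, 0 ≤ ψ x) ∧
      (∀ x ∈ X, ψ x = 1) ∧ tsupport ψ ⊆ Metric.thickening ε X := by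
  have hcl : closure X ⊆ Metric.thickening (ε / 2) X :=
    Metric.closure_subset_thickening (by positivity) X
  have hdisj : Disjoint (Metric.thickening (ε / 2) X)ᶜ (closure X) :=
    Set.disjoint_left.2 fun x hx hx' => hx (hcl hx')
  obtain ⟨f, hf0, hf1, hf⟩ := exists_contMDiffMap_zero_one_of_isClosed (n := ⊤)
    (modelWithCornersSelf ℝ (Euc n)) Metric.isOpen_thickening.isClosed_compl isClosed_closure hdisj
  have hsupp : tsupport f ⊆ Metric.cthickening (ε / 2) X := by
    refine closure_minimal (fun x hx => ?_) Metric.isClosed_cthickening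
    by_contra h
    exact hx (hf0 fun h' => h (Metric.thickening_subset_cthickening _ _ h'))
  refine ⟨f, f.contMDiff.contDiff, ?_, fun x => (hf x).1, fun x hx => hf1 (subset_closure hx), ?_⟩
  · exact (hX.cthickening.isCompact_closure).of_isClosed_subset (isClosed_tsupport _)
      (hsupp.trans subset_closure)
  · exact hsupp.trans (Metric.cthickening_subset_thickening' hε (by linarith) X)

/-! ### Fourier inversion and Plancherel's theorem for test functions -/

theorem integral_comp_two_pi_smul (F : Euc n → ℂ) :
    ∫ ξ, F ((2 * Real.pi)⁻¹ • ξ) = (((2 * Real.pi) ^ n : ℝ) : ℂ) * ∫ ξ, F ξ := by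
  rw [Measure.integral_comp_inv_smul_of_nonneg _ _ (by positivity)]
  simp

theorem testFunction_inversion {X : Opens (Euc n)} (φ : 𝓓(X, ℂ)) (x : Euc n) :
    φ x = (((2 * Real.pi) ^ n : ℝ) : ℂ)⁻¹ * ∫ ξ, osc x ξ * fourierInt φ ξ := by
  set f : SchwartzMap (Euc n) ℂ := φ.hasCompactSupport.toSchwartzMap φ.contDiff with hf
  have h1 : ∀ ξ, fourierInt φ ξ = (FourierTransform.fourier f : SchwartzMap (Euc n) ℂ)
      ((2 * Real.pi)⁻¹ • ξ) := fun ξ => fourierInt_eq f ξ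
  have h2 : ∀ ξ, osc x ξ * fourierInt φ ξ = (fun η => osc x ((2 * Real.pi) • η) *
      (FourierTransform.fourier f : SchwartzMap (Euc n) ℂ) η) ((2 * Real.pi)⁻¹ • ξ) := by
    intro ξ
    simp only [h1]
    rw [smul_inv_smul₀ (by positivity)]
  simp only [h2]
  rw [integral_comp_two_pi_smul (fun η => osc x ((2 * Real.pi) • η) *
      (FourierTransform.fourier f : SchwartzMap (Euc n) ℂ) η), inv_mul_cancel_left₀ (by
        rw [Complex.ofReal_ne_zero]; positivity)]
  have h3 : FourierTransformInv.fourierInv (FourierTransform.fourier f) = f :=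
    FourierTransform.fourierInv_fourier_eq f
  have h4 := congrArg (fun g : SchwartzMap (Euc n) ℂ => g x) h3
  simp only [SchwartzMap.fourierInv_coe, Real.fourierInv_eq'] at h4
  refine (h4.trans rfl).symm.trans ?_
  refine integral_congr_ae (ae_of_all _ fun η => ?_)
  simp only [osc, smul_eq_mul, inner_smul_right, real_inner_comm x η]
  congr 2
  push_cast
  ring

theorem integral_norm_sq_fourierInt {X : Opens (Euc n)} (φ : 𝓓(X, ℂ)) :
    ∫ ξ, ‖fourierInt φ ξ‖ ^ 2 = (2 * Real.pi) ^ n * ∫ x, ‖φ x‖ ^ 2 := by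
  set f : SchwartzMap (Euc n) ℂ := φ.hasCompactSupport.toSchwartzMap φ.contDiff with hf
  have h1 : ∀ ξ, fourierInt φ ξ = (FourierTransform.fourier f : SchwartzMap (Euc n) ℂ)
      ((2 * Real.pi)⁻¹ • ξ) := fun ξ => fourierInt_eq f ξ
  simp only [h1]
  rw [Measure.integral_comp_inv_smul_of_nonneg volume
    (fun η => ‖(FourierTransform.fourier f : SchwartzMap (Euc n) ℂ) η‖ ^ 2)
    (R := 2 * Real.pi) (by positivity), SchwartzMap.integral_norm_sq_fourier]
  simp
  rfl

theorem exists_fourierInt_bound {X : Opens (Euc n)} (φ : 𝓓(X, ℂ)) :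
    ∃ C, ∀ ξ, ‖fourierInt φ ξ‖ ≤ C := by
  refine ⟨∫ x, ‖φ x‖, fun ξ => ?_⟩
  rw [fourierInt_eq_osc]
  refine (norm_integral_le_integral_norm _).trans_eq ?_
  simp only [norm_mul, RCLike.norm_conj, norm_osc, one_mul]

theorem integrable_jap_mul_fourierInt_sq {X : Opens (Euc n)} (φ : 𝓓(X, ℂ)) (k : ℕ) :
    Integrable fun ξ : Euc n => jap ξ ^ k * ‖fourierInt φ ξ‖ ^ 2 := by
  obtain ⟨C, hC⟩ := exists_fourierInt_bound φ
  have hc := continuous_fourierInt φ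
  refine ((integrable_fourierInt φ k).const_mul C).mono' (by fun_prop) (ae_of_all _ fun ξ => ?_)
  have hJ : 0 < jap ξ ^ k := pow_pos (jap_pos ξ) k
  rw [Real.norm_of_nonneg (by positivity), sq]
  calc jap ξ ^ k * (‖fourierInt φ ξ‖ * ‖fourierInt φ ξ‖)
      ≤ jap ξ ^ k * (C * ‖fourierInt φ ξ‖) := by gcongr; exact hC ξ
    _ = _ := by rw [jap]; ring

theorem integral_osc_mul_conj_testFunction {X : Opens (Euc n)} (φ : 𝓓(X, ℂ)) (ξ : Euc n) :
    ∫ x, osc x ξ * starRingEnd ℂ (φ x) = starRingEnd ℂ (fourierInt φ ξ) := by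
  rw [fourierInt_eq_osc, ← integral_conj]
  simp

end

end WeylPDO

end

/-! ### Proof of Gårding's inequality for elliptic symbols -/

noncomputable section

namespace WeylPDO

section

variable {n m : ℕ}

theorem integral_osc_mul_integral {X : Opens (Euc n)} (φ : 𝓓(X, ℂ)) {g : Euc n → ℂ}
    (hg : Integrable g) :
    ∫ x, (∫ ξ, osc x ξ * g ξ) * starRingEnd ℂ (φ x) =
      ∫ ξ, g ξ * starRingEnd ℂ (fourierInt φ ξ) := by
  have hφ : Integrable fun x => starRingEnd ℂ (φ x) :=
    (Complex.continuous_conj.comp φ.continuous).integrable_of_hasCompactSupport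
      (φ.hasCompactSupport.comp_left (map_zero _))
  have hint : Integrable (fun z : Euc n × Euc n =>
      osc z.1 z.2 * (starRingEnd ℂ (φ z.1) * g z.2)) (volume.prod volume) := by
    have hc : Continuous fun z : Euc n × Euc n => osc z.1 z.2 := by fun_prop
    exact (hφ.mul_prod hg).bdd_mul hc.aestronglyMeasurable
      (ae_of_all _ fun z => (norm_osc z.1 z.2).le)
  have h1 : ∀ x, (∫ ξ, osc x ξ * g ξ) * starRingEnd ℂ (φ x) =
      ∫ ξ, osc x ξ * (starRingEnd ℂ (φ x) * g ξ) := by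
    intro x
    rw [← integral_mul_const]
    exact integral_congr_ae (ae_of_all _ fun ξ => by ring)
  simp only [h1]
  rw [integral_integral_swap hint]
  refine integral_congr_ae (ae_of_all _ fun ξ => ?_)
  simp only
  rw [← integral_osc_mul_conj_testFunction, ← integral_const_mul]
  exact integral_congr_ae (ae_of_all _ fun x => by ring)

/-- Of the `n + m + 2` powers, `m` pay for the Peetre weight and one for `1 + |h|`. The remaining `n
+ 1` powers of `1 + |h|²` decay like `|h|^{-2(n+1)}`, which is integrable. -/
theorem integrable_jap_inv_pow (n m : ℕ) :
    Integrable fun h : Euc n => (jap h ^ (n + m + 2))⁻¹ * (1 + ‖h‖) * jap h ^ m := by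
  have h1 := (integrable_rpow_neg_one_add_norm_sq (E := Euc n) (μ := volume) (r := 2 * (n + 1))
    (by simp; linarith)).const_mul 2
  have hJ : ∀ h : Euc n, jap h ≠ 0 := fun h => (jap_pos h).ne'
  refine h1.mono' (Continuous.aestronglyMeasurable ?_) (ae_of_all _ fun h => ?_)
  · exact (((continuous_jap.pow _).inv₀ fun h => pow_ne_zero _ (hJ h)).mul
      (by fun_prop)).mul (by fun_prop)
  · have h2 : (1 + ‖h‖ ^ 2 : ℝ) ^ (-(2 * (n + 1 : ℝ)) / 2) = (jap h ^ (n + 1))⁻¹ := by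
      change (jap h) ^ _ = _
      rw [show -(2 * (n + 1 : ℝ)) / 2 = -((n + 1 : ℕ) : ℝ) by push_cast; ring,
        Real.rpow_neg (jap_pos h).le, Real.rpow_natCast]
    have h3 : 1 + ‖h‖ ≤ 2 * jap h := by
      unfold jap
      nlinarith [sq_nonneg (‖h‖ - 1)]
    have hJ0 := jap_pos h
    rw [h2, Real.norm_of_nonneg (by positivity)]
    calc (jap h ^ (n + m + 2))⁻¹ * (1 + ‖h‖) * jap h ^ m
        ≤ (jap h ^ (n + m + 2))⁻¹ * (2 * jap h) * jap h ^ m := by gcongr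
      _ = 2 * (jap h ^ (n + 1))⁻¹ := by
        rw [show n + m + 2 = (n + 1) + m + 1 by ring, pow_succ, pow_add]
        field_simp

/-- Gårding's inequality. -/
theorem ClassicalSymbol.garding (σ : ClassicalSymbol n (2 * m)) {X : Opens (Euc n)}
    (hX : Bornology.IsBounded (X : Set (Euc n))) (hn : 0 < n) (hm : 0 < m) {C₀ : ℝ} (hC₀ : 0 < C₀)
    (hell : ∀ x ∈ X, ∀ ξ : Euc n, ξ ≠ 0 → C₀ * ‖ξ‖ ^ (2 * m) ≤ (σ.principal x ξ).re) :
    ∃ c C : ℝ, 0 < c ∧ 0 ≤ C ∧ ∀ φ : 𝓓(X, ℂ),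
      c * (∫ ξ, jap ξ ^ m * ‖fourierInt φ ξ‖ ^ 2) - C * ∫ x, ‖φ x‖ ^ 2 ≤
        (∫ x, pdo σ.toFun φ x * starRingEnd ℂ (φ x)).re := by
  obtain ⟨c, C, ε, hc, hC, hε, hlow⟩ := σ.exists_lower_bound_thickening hX hn hC₀ hell
  obtain ⟨ψ, hψ, hψc, hψ0, hψ1, hψs⟩ := exists_cutoff hX hε
  have hψ' : ContDiff ℝ ∞ fun x => (ψ x : ℂ) := Complex.ofRealCLM.contDiff.comp hψ
  have hts : tsupport (fun x => (ψ x : ℂ)) = tsupport ψ := by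
    simp [tsupport, Function.support, Complex.ofReal_eq_zero]
  have hψc' : HasCompactSupport fun x => (ψ x : ℂ) := by rwa [HasCompactSupport, hts]
  set N := n + m + 2 with hN
  obtain ⟨D₁, hD₁, hb₁⟩ := σ.isSymbol.isKernelSymbol hn (ClassicalSymbol.order_eq m) hψ' hψc' N
  obtain ⟨D₂, hD₂, hb₂⟩ := isKernelSymbol_jap hm hψ' hψc' N c C
  -- The sum is the symbol `ψ (a + C - c (1 + |ξ|²)^m)`. Its real part is non-negative everywhere
  -- because the lower bound holds on the whole support of `ψ`.
  have hb := hb₁.add hψc' hb₂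
  have hJN : ∀ h : Euc n, (jap h ^ N)⁻¹ ≤ 1 := fun h =>
    inv_le_one_of_one_le₀ (one_le_pow₀ (one_le_jap h))
  have hJN0 : ∀ h : Euc n, 0 ≤ (jap h ^ N)⁻¹ := fun h => inv_nonneg.2 (pow_pos (jap_pos h) N).le
  set T : ℝ := (2 * Real.pi) ^ n with hT
  have hT0 : 0 < T := by positivity
  have hTC : (T : ℂ) ≠ 0 := Complex.ofReal_ne_zero.2 hT0.ne'
  -- The loss `δ = T c / 2` uses up half of the energy gained from the term with `c`. The factor `T
  -- = (2π)^n` arises because the form is evaluated at Fourier transforms and inversion yields `T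
  -- φ`.
  obtain ⟨C', hC', hform⟩ := hb.re_form_ge hψc'
    (fun h => add_nonneg (mul_nonneg hD₁ (hJN0 h)) (mul_nonneg hD₂ (hJN0 h)))
    ⟨D₁ + D₂, fun h => add_le_add (mul_le_of_le_one_right hD₁ (hJN h))
      (mul_le_of_le_one_right hD₂ (hJN h))⟩
    (((integrable_jap_inv_pow n m).const_mul (D₁ + D₂)).congr
      (ae_of_all _ fun h => by simp only [hN]; ring))
    (fun x ξ => by
      rw [← mul_add, Complex.re_ofReal_mul, Complex.add_re, Complex.ofReal_re]
      by_cases hx : x ∈ tsupport ψ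
      · have := hlow x (hψs hx) ξ
        exact mul_nonneg (hψ0 x) (by linarith)
      · rw [image_eq_zero_of_notMem_tsupport hx, zero_mul])
    (δ := T * c / 2) (by positivity)
  refine ⟨c / (2 * T), C + C' / T, by positivity, by positivity, fun φ => ?_⟩
  have hf : Continuous (fourierInt φ) := continuous_fourierInt φ
  have hint1 : ∀ k, Integrable fun ξ : Euc n => jap ξ ^ k * ‖fourierInt φ ξ‖ :=
    fun k => integrable_fourierInt φ k
  have hint2 := integrable_jap_mul_fourierInt_sq φ
  have h1 := hform (fourierInt φ) hf (hint1 m) (hint2 m)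
  set q : Euc n → ℂ := fun ξ => ((C - c * jap ξ ^ m : ℝ) : ℂ) * fourierInt φ ξ with hq
  have hqi : Integrable q := by
    refine (((hint1 0).const_mul C).add ((hint1 m).const_mul c)).mono'
      (by fun_prop) (ae_of_all _ fun ξ => ?_)
    have hJ : 0 < jap ξ ^ m := pow_pos (jap_pos ξ) m
    rw [hq, norm_mul, Complex.norm_real, Pi.add_apply, pow_zero, one_mul]
    have : ‖C - c * jap ξ ^ m‖ ≤ C + c * jap ξ ^ m := by
      rw [Real.norm_eq_abs, abs_le]
      constructor <;> nlinarith [mul_pos hc hJ]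
    nlinarith [norm_nonneg (fourierInt φ ξ)]
  have h2 : ∀ x, (∫ ζ, osc x ζ * (((ψ x : ℂ) * σ.toFun x ζ +
      (ψ x : ℂ) * ((C - c * jap ζ ^ m : ℝ) : ℂ)) * fourierInt φ ζ)) *
        starRingEnd ℂ (∫ η, osc x η * fourierInt φ η) =
      (T : ℂ) ^ 2 * (pdo σ.toFun φ x * starRingEnd ℂ (φ x)) +
        T * ((∫ ξ, osc x ξ * q ξ) * starRingEnd ℂ (φ x)) := by
    intro x
    have h3 : ∫ η, osc x η * fourierInt φ η = T * φ x := by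
      rw [testFunction_inversion φ x, mul_inv_cancel_left₀ hTC]
    rw [h3]
    -- The cutoff disappears here: it equals `1` on `X`, and off `X` both sides vanish with `φ`.
    by_cases hx : x ∈ X
    · have h4 : ∫ ξ, osc x ξ * σ.toFun x ξ * fourierInt φ ξ = T * pdo σ.toFun φ x := by
        unfold pdo
        rw [mul_inv_cancel_left₀ hTC]
        rfl
      have h5 : Integrable fun ξ => osc x ξ * σ.toFun x ξ * fourierInt φ ξ :=
        integrable_pdo σ.isSymbol φ x
      have h6 : Integrable fun ξ => osc x ξ * q ξ :=
        hqi.bdd_mul (by fun_prop) (ae_of_all _ fun ξ => (norm_osc x ξ).le)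
      have h7 : ∫ ζ, osc x ζ * (((ψ x : ℂ) * σ.toFun x ζ +
          (ψ x : ℂ) * ((C - c * jap ζ ^ m : ℝ) : ℂ)) * fourierInt φ ζ) =
          T * pdo σ.toFun φ x + ∫ ξ, osc x ξ * q ξ := by
        rw [← h4, ← integral_add h5 h6]
        refine integral_congr_ae (ae_of_all _ fun ξ => ?_)
        simp only [hq, hψ1 x hx, Complex.ofReal_one]
        ring
      rw [h7, map_mul, Complex.conj_ofReal]
      ring
    · have : φ x = 0 := image_eq_zero_of_notMem_tsupport fun h => hx (φ.tsupport_subset h)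
      simp [this]
  simp only [h2] at h1
  have hφc : Continuous fun x => starRingEnd ℂ (φ x) := Complex.continuous_conj.comp φ.continuous
  have hφs : HasCompactSupport fun x => starRingEnd ℂ (φ x) :=
    φ.hasCompactSupport.comp_left (map_zero _)
  have hi1 : Integrable fun x => pdo σ.toFun φ x * starRingEnd ℂ (φ x) :=
    ((continuous_pdo σ.isSymbol φ).mul hφc).integrable_of_hasCompactSupport hφs.mul_left
  have hoq : Continuous fun x => ∫ ξ, osc x ξ * q ξ := by
    refine continuous_of_dominated (bound := fun ξ => ‖q ξ‖) ?_ ?_ hqi.norm ?_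
    · exact fun x => (by fun_prop : Continuous fun ξ => osc x ξ * q ξ).aestronglyMeasurable
    · exact fun x => ae_of_all _ fun ξ => by rw [norm_mul, norm_osc, one_mul]
    · exact ae_of_all _ fun ξ => by fun_prop
  have hi2 : Integrable fun x => (∫ ξ, osc x ξ * q ξ) * starRingEnd ℂ (φ x) :=
    (hoq.mul hφc).integrable_of_hasCompactSupport hφs.mul_left
  rw [integral_add (hi1.const_mul _) (hi2.const_mul _), integral_const_mul, integral_const_mul,
    integral_osc_mul_integral φ hqi] at h1
  have h8 : ∫ ξ, q ξ * starRingEnd ℂ (fourierInt φ ξ) =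
      ((C * (∫ ξ, ‖fourierInt φ ξ‖ ^ 2) - c * ∫ ξ, jap ξ ^ m * ‖fourierInt φ ξ‖ ^ 2 : ℝ) : ℂ) := by
    have hi0 := hint2 0
    simp only [pow_zero, one_mul] at hi0
    rw [← integral_const_mul, ← integral_const_mul, ← integral_sub (hi0.const_mul C)
      ((hint2 m).const_mul c), ← integral_complex_ofReal]
    refine integral_congr_ae (ae_of_all _ fun ξ => ?_)
    simp only [hq]
    rw [mul_assoc, Complex.mul_conj, Complex.normSq_eq_norm_sq, ← Complex.ofReal_mul]
    congr 1
    ring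
  rw [h8, ← Complex.ofReal_pow, Complex.add_re, Complex.re_ofReal_mul, Complex.re_ofReal_mul,
    Complex.ofReal_re, integral_norm_sq_fourierInt] at h1
  set E := ∫ ξ, jap ξ ^ m * ‖fourierInt φ ξ‖ ^ 2
  set Q := (∫ x, pdo σ.toFun φ x * starRingEnd ℂ (φ x)).re
  set P := ∫ x, ‖φ x‖ ^ 2
  have h9 : 0 ≤ T ^ 2 * (Q - (c / (2 * T) * E - (C + C' / T) * P)) := by
    have : T ^ 2 * (Q - (c / (2 * T) * E - (C + C' / T) * P)) =
      T ^ 2 * Q - T * c / 2 * E + (T ^ 2 * C + T * C') * P := by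
      field_simp
      ring
    rw [this]
    change _ ≤ T ^ 2 * Q + T * (C * (T * P) - c * E) at h1
    nlinarith [h1]
  have := nonneg_of_mul_nonneg_right h9 (by positivity)
  linarith

end

end WeylPDO

end

noncomputable section

namespace WeylPDO

/-! ### The quadratic form of the restricted operator -/

section

variable {n m : ℕ} {X : Opens (Euc n)}

theorem testFunction_eq_zero (φ : 𝓓(X, ℂ)) {x : Euc n} (hx : x ∉ X) : φ x = 0 :=
  image_eq_zero_of_notMem_tsupport fun h => hx (φ.tsupport_subset h)

theorem coeFn_testToL2 (φ : 𝓓(X, ℂ)) :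
    testToL2 X φ =ᵐ[(volume : Measure (Euc n)).restrict (X : Set (Euc n))] φ :=
  (memLp_testFunction φ).coeFn_toLp

theorem inner_testToL2_left (φ : 𝓓(X, ℂ)) (g : L2 X) :
    inner ℂ (testToL2 X φ) g = ∫ x in (X : Set (Euc n)), g x * starRingEnd ℂ (φ x) := by
  rw [L2.inner_def]
  refine integral_congr_ae ?_
  filter_upwards [coeFn_testToL2 φ] with x hx
  rw [hx]
  rfl

theorem inner_testToL2_toLp (φ : 𝓓(X, ℂ)) {f : Euc n → ℂ}
    (hf : MemLp f 2 ((volume : Measure (Euc n)).restrict (X : Set (Euc n)))) :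
    inner ℂ (testToL2 X φ) (hf.toLp f) = ∫ x, f x * starRingEnd ℂ (φ x) := by
  have h : ∀ x ∉ (X : Set (Euc n)), f x * starRingEnd ℂ (φ x) = 0 := fun x hx => by
    rw [testFunction_eq_zero φ hx, map_zero, mul_zero]
  rw [inner_testToL2_left, ← setIntegral_eq_integral_of_forall_compl_eq_zero h]
  refine integral_congr_ae ?_
  filter_upwards [hf.coeFn_toLp] with x hx
  rw [hx]

theorem norm_testToL2_sq (φ : 𝓓(X, ℂ)) : ‖testToL2 X φ‖ ^ 2 = ∫ x, ‖φ x‖ ^ 2 := by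
  have h := inner_testToL2_toLp φ (memLp_testFunction φ)
  have h1 : (fun x => φ x * starRingEnd ℂ (φ x)) = fun x => ((‖φ x‖ ^ 2 : ℝ) : ℂ) := by
    funext x
    rw [Complex.mul_conj, Complex.normSq_eq_norm_sq]
  rw [h1, integral_complex_ofReal] at h
  change inner ℂ (testToL2 X φ) (testToL2 X φ) = _ at h
  rw [← inner_self_re, h, Complex.ofReal_re]

/-- The complex conjugate of a test function. -/
def conjTestFunction (φ : 𝓓(X, ℂ)) : 𝓓(X, ℂ) :=
  ⟨fun x => starRingEnd ℂ (φ x), Complex.conjCLE.contDiff.comp φ.contDiff,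
    φ.hasCompactSupport.comp_left (map_zero _),
    (closure_mono fun x (hx : starRingEnd ℂ (φ x) ≠ 0) (h : φ x = 0) =>
      hx (by simp [h])).trans φ.tsupport_subset⟩

theorem conjTestFunction_apply (φ : 𝓓(X, ℂ)) (x : Euc n) :
    conjTestFunction φ x = starRingEnd ℂ (φ x) := rfl

/-- An element orthogonal to all test functions is a weak derivative of order zero of `0`, hence
equals `0` by uniqueness of weak derivatives. -/
theorem denseRange_testToL2 (X : Opens (Euc n)) :
    Dense (LinearMap.range (testToL2 X) : Set (L2 X)) := by
  rw [Submodule.dense_iff_topologicalClosure_eq_top, Submodule.topologicalClosure_eq_top_iff,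
    Submodule.eq_bot_iff]
  intro g hg
  have h0 : ∀ φ : 𝓓(X, ℂ), ∫ x in (X : Set (Euc n)), g x * φ x = 0 := by
    intro φ
    have h := (Submodule.mem_orthogonal _ _).1 hg _
      (LinearMap.mem_range_self (testToL2 X) (conjTestFunction φ))
    rw [inner_testToL2_left] at h
    simpa [conjTestFunction_apply] using h
  have hz : ∀ φ : Euc n → ℂ, ∫ x in (X : Set (Euc n)), (0 : L2 X) x * φ x = 0 := by
    intro φ
    rw [← integral_zero (Euc n) ℂ (μ := volume.restrict (X : Set (Euc n)))]
    refine integral_congr_ae ?_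
    filter_upwards [Lp.coeFn_zero ℂ 2 ((volume : Measure (Euc n)).restrict (X : Set (Euc n)))]
      with x hx
    rw [hx, Pi.zero_apply, zero_mul]
  refine IsWeakDeriv.unique (α := 0) (u := (0 : L2 X)) (fun φ => ?_) fun φ => ?_
  · rw [hz, h0, mul_zero]
  · rw [hz, hz, mul_zero]

/-- The test function `φ` as an element of the domain of `res ∘ A₀ ∘ ext`. -/
def testToDomain {d : ℤ} (σ : ClassicalSymbol n d) (hX : Bornology.IsBounded (X : Set (Euc n)))
    (φ : 𝓓(X, ℂ)) : (resOpExt σ X hX).domain :=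
  ⟨testToL2 X φ, LinearMap.mem_range_self (testToL2 X) φ⟩

theorem exists_testToDomain {d : ℤ} (σ : ClassicalSymbol n d)
    (hX : Bornology.IsBounded (X : Set (Euc n))) (v : (resOpExt σ X hX).domain) :
    ∃ φ, v = testToDomain σ hX φ := by
  obtain ⟨φ, hφ⟩ := v.2
  exact ⟨φ, Subtype.ext hφ.symm⟩

theorem resOpExt_testToDomain {d : ℤ} (σ : ClassicalSymbol n d)
    (hX : Bornology.IsBounded (X : Set (Euc n))) (φ : 𝓓(X, ℂ)) :
    resOpExt σ X hX (testToDomain σ hX φ) = pdoToL2 σ X hX φ := by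
  change pdoToL2 σ X hX ((LinearEquiv.ofInjective (testToL2 X) (testToL2_injective X)).symm
    (testToDomain σ hX φ)) = _
  congr 1
  exact (LinearEquiv.ofInjective (testToL2 X) (testToL2_injective X)).symm_apply_apply φ

theorem inner_resOpExt {d : ℤ} (σ : ClassicalSymbol n d)
    (hX : Bornology.IsBounded (X : Set (Euc n))) (φ ψ : 𝓓(X, ℂ)) :
    inner ℂ (testToDomain σ hX φ : L2 X) (resOpExt σ X hX (testToDomain σ hX ψ)) =
      ∫ x, pdo σ.toFun ψ x * starRingEnd ℂ (φ x) := by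
  rw [resOpExt_testToDomain]
  exact inner_testToL2_toLp φ (memLp_pdo σ.isSymbol hX ψ)

/-- Extension of a test function by zero. -/
def extendTestFunction (φ : 𝓓(X, ℂ)) : 𝓓((⊤ : Opens (Euc n)), ℂ) :=
  ⟨φ, φ.contDiff, φ.hasCompactSupport, Set.subset_univ _⟩

theorem ClassicalSymbol.IsSymmetric.resOpExt {d : ℤ} {σ : ClassicalSymbol n d}
    (hσ : σ.IsSymmetric) (hX : Bornology.IsBounded (X : Set (Euc n)))
    (u v : (resOpExt σ X hX).domain) :
    inner ℂ (resOpExt σ X hX u) (v : L2 X) = inner ℂ (u : L2 X) (WeylPDO.resOpExt σ X hX v) := by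
  obtain ⟨φ, rfl⟩ := exists_testToDomain σ hX u
  obtain ⟨ψ, rfl⟩ := exists_testToDomain σ hX v
  rw [← inner_conj_symm, inner_resOpExt, inner_resOpExt, ← integral_conj]
  refine Eq.trans ?_ (hσ (extendTestFunction ψ) (extendTestFunction φ)).symm
  refine integral_congr_ae (ae_of_all _ fun x => ?_)
  simp only [map_mul, Complex.conj_conj]
  exact mul_comm _ _

/-- The squared norm of `φ` in the Sobolev space of order `m`, on the Fourier side. -/
def fourierEnergy (m : ℕ) (φ : Euc n → ℂ) : ℝ := ∫ ξ, jap ξ ^ m * ‖fourierInt φ ξ‖ ^ 2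

theorem fourierEnergy_nonneg (m : ℕ) (φ : Euc n → ℂ) : 0 ≤ fourierEnergy m φ :=
  integral_nonneg fun ξ => mul_nonneg (pow_pos (jap_pos ξ) m).le (sq_nonneg _)

/-- The operator `res ∘ A₀ ∘ ext` is semibounded, and its form controls the Sobolev norm. -/
theorem ClassicalSymbol.isSemibounded_resOpExt (σ : ClassicalSymbol n (2 * m))
    (hX : Bornology.IsBounded (X : Set (Euc n))) (hn : 0 < n) (hm : 0 < m) {C₀ : ℝ} (hC₀ : 0 < C₀)
    (hell : ∀ x ∈ X, ∀ ξ : Euc n, ξ ≠ 0 → C₀ * ‖ξ‖ ^ (2 * m) ≤ (σ.principal x ξ).re)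
    (hσ : σ.IsSymmetric) :
    ∃ c M : ℝ, 0 < c ∧ 0 < M ∧ IsSemibounded (WeylPDO.resOpExt σ X hX) M ∧
      ∀ φ : 𝓓(X, ℂ), c * fourierEnergy m φ ≤ (inner ℂ (testToDomain σ hX φ : L2 X)
        (energyOp (WeylPDO.resOpExt σ X hX) M (testToDomain σ hX φ))).re := by
  obtain ⟨c, C, hc, hC, h⟩ := σ.garding hX hn hm hC₀ hell
  have h' : ∀ φ : 𝓓(X, ℂ), c * fourierEnergy m φ - C * ‖testToL2 X φ‖ ^ 2 ≤
      (inner ℂ (testToDomain σ hX φ : L2 X)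
        (WeylPDO.resOpExt σ X hX (testToDomain σ hX φ))).re := by
    intro φ
    rw [inner_resOpExt, norm_testToL2_sq]
    exact h φ
  -- The shift by `C` cancels the negative term in Gårding's inequality, and the additional `1`
  -- makes the shifted form dominate the squared `L²` norm.
  refine ⟨c, C + 1, hc, by linarith, ⟨hσ.resOpExt hX, fun v => ?_⟩, fun φ => ?_⟩
  · obtain ⟨φ, rfl⟩ := exists_testToDomain σ hX v
    have h1 := h' φ
    have h2 := mul_nonneg hc.le (fourierEnergy_nonneg m φ)
    change ‖testToL2 X φ‖ ^ 2 ≤ _ + (C + 1) * ‖testToL2 X φ‖ ^ 2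
    linarith
  · rw [re_inner_energyOp]
    have h1 := h' φ
    change _ ≤ _ + (C + 1) * ‖testToL2 X φ‖ ^ 2
    nlinarith [sq_nonneg ‖testToL2 X φ‖]

end

end WeylPDO

end

noncomputable section

namespace WeylPDO

/-! ### Derivatives of test functions -/

section

variable {n m : ℕ} {X : Opens (Euc n)}

/-- The derivative `∂^α` restricted to the directions in the list `l`. -/
def listDeriv (α : Fin n → ℕ) (l : List (Fin n)) (f : Euc n → ℂ) : Euc n → ℂ :=
  l.foldr (fun i g => (partialDeriv i)^[α i] g) f

theorem listDeriv_cons (α : Fin n → ℕ) (i : Fin n) (l : List (Fin n)) (f : Euc n → ℂ) :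
    listDeriv α (i :: l) f = (partialDeriv i)^[α i] (listDeriv α l f) := rfl

theorem contDiff_listDeriv (α : Fin n → ℕ) (l : List (Fin n)) {f : Euc n → ℂ}
    (hf : ContDiff ℝ ∞ f) : ContDiff ℝ ∞ (listDeriv α l f) := by
  induction l with
  | nil => exact hf
  | cons i l ih => exact contDiff_partialDeriv_iterate i _ ih

theorem tsupport_listDeriv_subset (α : Fin n → ℕ) (l : List (Fin n)) (f : Euc n → ℂ) :
    tsupport (listDeriv α l f) ⊆ tsupport f := by
  induction l with
  | nil => exact subset_rfl
  | cons i l ih => exact (tsupport_partialDeriv_iterate_subset i _ _).trans ih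

theorem hasCompactSupport_listDeriv (α : Fin n → ℕ) (l : List (Fin n)) {f : Euc n → ℂ}
    (hf : HasCompactSupport f) : HasCompactSupport (listDeriv α l f) :=
  hf.of_isClosed_subset (isClosed_tsupport _) (tsupport_listDeriv_subset α l f)

theorem fourierInt_listDeriv (α : Fin n → ℕ) (l : List (Fin n)) {f : Euc n → ℂ}
    (hf : ContDiff ℝ ∞ f) (hfc : HasCompactSupport f) (ξ : Euc n) :
    fourierInt (listDeriv α l f) ξ =
      (l.map fun i => (Complex.I * (ξ i : ℂ)) ^ α i).prod * fourierInt f ξ := by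
  induction l with
  | nil => simp [listDeriv]
  | cons i l ih =>
    rw [listDeriv_cons, fourierInt_partialDeriv_iterate i _ (contDiff_listDeriv α l hf)
      (hasCompactSupport_listDeriv α l hfc), ih, List.map_cons, List.prod_cons, mul_assoc]

theorem partialDeriv_comm_listDeriv (α : Fin n → ℕ) (l : List (Fin n)) (j : Fin n)
    {f : Euc n → ℂ} (hf : ContDiff ℝ ∞ f) :
    partialDeriv j (listDeriv α l f) = listDeriv α l (partialDeriv j f) := by
  induction l with
  | nil => rfl
  | cons i l ih =>
    rw [listDeriv_cons, listDeriv_cons, ← ih]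
    exact dirDeriv_iterate_comm _ _ _ (contDiff_listDeriv α l hf)

theorem integral_mul_partialDeriv (i : Fin n) {f g : Euc n → ℂ} (hf : ContDiff ℝ ∞ f)
    (hg : ContDiff ℝ ∞ g) (hgc : HasCompactSupport g) :
    ∫ x, f x * partialDeriv i g x = -∫ x, partialDeriv i f x * g x :=
  integral_mul_fderiv_eq_neg_fderiv_mul_of_integrable
    (((contDiff_partialDeriv i hf).continuous.mul hg.continuous).integrable_of_hasCompactSupport
      hgc.mul_left)
    ((hf.continuous.mul (contDiff_partialDeriv i hg).continuous).integrable_of_hasCompactSupport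
      (hasCompactSupport_partialDeriv i hgc).mul_left)
    ((hf.continuous.mul hg.continuous).integrable_of_hasCompactSupport hgc.mul_left)
    (fun x _ => hf.differentiable (by simp) x) (fun x _ => hg.differentiable (by simp) x)

theorem integral_mul_partialDeriv_iterate (i : Fin n) (k : ℕ) {f g : Euc n → ℂ}
    (hf : ContDiff ℝ ∞ f) (hg : ContDiff ℝ ∞ g) (hgc : HasCompactSupport g) :
    ∫ x, f x * (partialDeriv i)^[k] g x = (-1) ^ k * ∫ x, (partialDeriv i)^[k] f x * g x := by
  induction k generalizing g with
  | zero => simp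
  | succ k ih =>
    rw [Function.iterate_succ_apply, ih (contDiff_partialDeriv i hg)
      (hasCompactSupport_partialDeriv i hgc), integral_mul_partialDeriv i
      (contDiff_partialDeriv_iterate i k hf) hg hgc, Function.iterate_succ_apply' _ _ f]
    ring

theorem listDeriv_iterate_comm (α : Fin n → ℕ) (l : List (Fin n)) (j : Fin n) (k : ℕ)
    {f : Euc n → ℂ} (hf : ContDiff ℝ ∞ f) :
    (partialDeriv j)^[k] (listDeriv α l f) = listDeriv α l ((partialDeriv j)^[k] f) := by
  induction k generalizing f with
  | zero => rfl
  | succ k ih =>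
    rw [Function.iterate_succ_apply, partialDeriv_comm_listDeriv α l j hf,
      ih (contDiff_partialDeriv j hf)]
    rfl

theorem integral_mul_listDeriv (α : Fin n → ℕ) (l : List (Fin n)) {f g : Euc n → ℂ}
    (hf : ContDiff ℝ ∞ f) (hg : ContDiff ℝ ∞ g) (hgc : HasCompactSupport g) :
    ∫ x, f x * listDeriv α l g x = (-1) ^ (l.map α).sum * ∫ x, listDeriv α l f x * g x := by
  induction l generalizing f with
  | nil => simp [listDeriv]
  | cons i l ih =>
    rw [listDeriv_cons, integral_mul_partialDeriv_iterate i _ hf (contDiff_listDeriv α l hg)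
      (hasCompactSupport_listDeriv α l hgc), ih (contDiff_partialDeriv_iterate i _ hf),
      ← listDeriv_iterate_comm α l i _ hf, List.map_cons, List.sum_cons, pow_add, mul_assoc]
    rfl

/-- The derivative `∂^α φ` as a test function. -/
def derivTestFunction (α : Fin n → ℕ) (φ : 𝓓(X, ℂ)) : 𝓓(X, ℂ) :=
  ⟨multiDeriv α φ, contDiff_listDeriv α _ φ.contDiff,
    hasCompactSupport_listDeriv α _ φ.hasCompactSupport,
    (tsupport_listDeriv_subset α _ _).trans φ.tsupport_subset⟩

theorem norm_fourierInt_multiDeriv_sq_le {α : Fin n → ℕ} (hα : ∑ i, α i ≤ m) {f : Euc n → ℂ}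
    (hf : ContDiff ℝ ∞ f) (hfc : HasCompactSupport f) (ξ : Euc n) :
    ‖fourierInt (multiDeriv α f) ξ‖ ^ 2 ≤ jap ξ ^ m * ‖fourierInt f ξ‖ ^ 2 := by
  have h : fourierInt (multiDeriv α f) ξ = _ := fourierInt_listDeriv α (List.finRange n) hf hfc ξ
  have h1 : ∏ i, ‖(Complex.I * (ξ i : ℂ)) ^ α i‖ ^ 2 ≤ ∏ i, jap ξ ^ α i := by
    refine Finset.prod_le_prod (fun i _ => sq_nonneg _) fun i _ => ?_
    rw [norm_pow, pow_right_comm]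
    refine pow_le_pow_left₀ (sq_nonneg _) ?_ _
    have := PiLp.norm_apply_le ξ i
    rw [norm_mul, Complex.norm_I, one_mul, Complex.norm_real, jap]
    nlinarith [norm_nonneg (ξ i), norm_nonneg ξ]
  rw [h, ← Fin.prod_univ_def, norm_mul, mul_pow, norm_prod, ← Finset.prod_pow]
  gcongr
  refine h1.trans ?_
  rw [Finset.prod_pow_eq_pow_sum]
  exact pow_le_pow_right₀ (one_le_jap ξ) hα

theorem norm_derivTestFunction_sq_le {α : Fin n → ℕ} (hα : ∑ i, α i ≤ m) (φ : 𝓓(X, ℂ)) :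
    ‖testToL2 X (derivTestFunction α φ)‖ ^ 2 ≤ ((2 * Real.pi) ^ n)⁻¹ * fourierEnergy m φ := by
  have h := integral_norm_sq_fourierInt (derivTestFunction α φ)
  rw [norm_testToL2_sq, ← div_eq_inv_mul, le_div_iff₀ (by positivity), mul_comm, ← h]
  have h0 := integrable_jap_mul_fourierInt_sq (derivTestFunction α φ) 0
  simp only [pow_zero, one_mul] at h0
  exact integral_mono h0 (integrable_jap_mul_fourierInt_sq φ m) fun ξ =>
    norm_fourierInt_multiDeriv_sq_le hα φ.contDiff φ.hasCompactSupport ξ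

/-! ### Weak derivatives -/

theorem integral_mul_testFunction (g : L2 X) (φ : 𝓓(X, ℂ)) :
    ∫ x in (X : Set (Euc n)), g x * φ x = inner ℂ (testToL2 X (conjTestFunction φ)) g := by
  rw [inner_testToL2_left]
  simp only [conjTestFunction_apply, Complex.conj_conj]

/-- Written with inner products, the condition is linear and continuous in the pair `(u, g)`, so
weak derivatives pass to differences and `L²` limits. -/
theorem isWeakDeriv_iff {α : Fin n → ℕ} {u g : L2 X} : IsWeakDeriv α u g ↔ ∀ φ : 𝓓(X, ℂ),
    inner ℂ (testToL2 X (conjTestFunction (derivTestFunction α φ))) u =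
      (-1) ^ (∑ i, α i) * inner ℂ (testToL2 X (conjTestFunction φ)) g := by
  refine forall_congr' fun φ => ?_
  rw [← integral_mul_testFunction, ← integral_mul_testFunction]
  rfl

theorem IsWeakDeriv.sub {α : Fin n → ℕ} {u v g h : L2 X} (hu : IsWeakDeriv α u g)
    (hv : IsWeakDeriv α v h) : IsWeakDeriv α (u - v) (g - h) := by
  rw [isWeakDeriv_iff] at *
  intro φ
  rw [inner_sub_right, inner_sub_right, hu, hv, mul_sub]

theorem IsWeakDeriv.of_tendsto {α : Fin n → ℕ} {u g : ℕ → L2 X} {u' g' : L2 X}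
    (h : ∀ k, IsWeakDeriv α (u k) (g k)) (hu : Tendsto u atTop (𝓝 u'))
    (hg : Tendsto g atTop (𝓝 g')) : IsWeakDeriv α u' g' := by
  simp only [isWeakDeriv_iff] at *
  intro φ
  refine tendsto_nhds_unique (Tendsto.inner tendsto_const_nhds hu) ?_
  simp only [h]
  exact (Tendsto.inner tendsto_const_nhds hg).const_mul _

theorem IsWeakDeriv.weakDeriv_eq {α : Fin n → ℕ} {u g : L2 X} (h : IsWeakDeriv α u g) :
    weakDeriv α u = g := by
  have h' : ∃ g, IsWeakDeriv α u g := ⟨g, h⟩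
  rw [weakDeriv, dif_pos h']
  exact h'.choose_spec.unique h

theorem isWeakDeriv_testToL2 (α : Fin n → ℕ) (φ : 𝓓(X, ℂ)) :
    IsWeakDeriv α (testToL2 X φ) (testToL2 X (derivTestFunction α φ)) := by
  intro ψ
  have h : ∀ φ ψ : 𝓓(X, ℂ), ∫ x in (X : Set (Euc n)), testToL2 X φ x * ψ x = ∫ x, φ x * ψ x := by
    intro φ ψ
    rw [integral_mul_testFunction]
    refine (inner_testToL2_toLp _ (memLp_testFunction φ)).trans ?_
    simp only [conjTestFunction_apply, Complex.conj_conj]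
  refine (h φ (derivTestFunction α ψ)).trans ?_
  rw [h]
  have := integral_mul_listDeriv α (List.finRange n) φ.contDiff ψ.contDiff ψ.hasCompactSupport
  rw [← Fin.sum_univ_def] at this
  exact this

theorem sobolevNorm_sq (m : ℕ) (u : L2 X) :
    sobolevNorm m u ^ 2 = ∑ α ∈ multiIndices n m, ‖weakDeriv α u‖ ^ 2 :=
  Real.sq_sqrt (Finset.sum_nonneg fun _ _ => sq_nonneg _)

theorem sobolevNorm_testToL2_sq_le (m : ℕ) (φ : 𝓓(X, ℂ)) :
    sobolevNorm m (testToL2 X φ) ^ 2 ≤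
      (multiIndices n m).card * (((2 * Real.pi) ^ n)⁻¹ * fourierEnergy m φ) := by
  rw [sobolevNorm_sq, ← nsmul_eq_mul]
  refine Finset.sum_le_card_nsmul _ _ _ fun α hα => ?_
  rw [(isWeakDeriv_testToL2 α φ).weakDeriv_eq]
  exact norm_derivTestFunction_sq_le (mem_multiIndices.1 hα) φ

theorem derivTestFunction_sub (α : Fin n → ℕ) (φ ψ : 𝓓(X, ℂ)) :
    testToL2 X (derivTestFunction α (φ - ψ)) =
      testToL2 X (derivTestFunction α φ) - testToL2 X (derivTestFunction α ψ) := by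
  have h := isWeakDeriv_testToL2 α (φ - ψ)
  rw [map_sub] at h
  exact h.unique ((isWeakDeriv_testToL2 α φ).sub (isWeakDeriv_testToL2 α ψ))

/-- By Plancherel the Fourier energy controls every derivative of order at most `m`, so these form
Cauchy sequences in `L²`. Weak differentiation being closed, their limits are the weak derivatives
of `u`. -/
theorem mem_sobolevZero_of_tendsto {v : ℕ → 𝓓(X, ℂ)} {u : L2 X}
    (hv : Tendsto (fun k => testToL2 X (v k)) atTop (𝓝 u))
    (hE : Tendsto (fun p : ℕ × ℕ => fourierEnergy m (v p.1 - v p.2 : 𝓓(X, ℂ))) atTop (𝓝 0)) :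
    u ∈ sobolevZero X m ∧ Tendsto (fun k => sobolevNorm m (testToL2 X (v k)) ^ 2) atTop
      (𝓝 (sobolevNorm m u ^ 2)) := by
  have hlim : ∀ α ∈ multiIndices n m, ∃ g : L2 X,
      Tendsto (fun k => testToL2 X (derivTestFunction α (v k))) atTop (𝓝 g) := by
    intro α hα
    refine cauchySeq_tendsto_of_complete (cauchySeq_iff_tendsto_sub.2
      (tendsto_of_norm_sq_tendsto ?_))
    have h0 := hE.const_mul ((2 * Real.pi) ^ n)⁻¹
    rw [mul_zero] at h0
    refine squeeze_zero (fun p => sq_nonneg _) (fun p => ?_) h0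
    rw [← derivTestFunction_sub]
    exact norm_derivTestFunction_sq_le (mem_multiIndices.1 hα) _
  choose! g hg using hlim
  have hw : ∀ α ∈ multiIndices n m, IsWeakDeriv α u (g α) := fun α hα =>
    IsWeakDeriv.of_tendsto (fun k => isWeakDeriv_testToL2 α (v k)) hv (hg α hα)
  refine ⟨⟨fun α hα => ⟨g α, hw α hα⟩, fun ε hε => ?_⟩, ?_⟩
  · have h1 : Tendsto (fun k => sobolevNorm m (u - testToL2 X (v k)) ^ 2) atTop (𝓝 0) := by
      simp only [sobolevNorm_sq]
      rw [← Finset.sum_const_zero (s := multiIndices n m)]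
      refine tendsto_finsetSum _ fun α hα => ?_
      have h2 := ((tendsto_const_nhds (x := g α)).sub (hg α hα)).norm.pow 2
      rw [sub_self, norm_zero, zero_pow two_ne_zero] at h2
      refine h2.congr fun k => ?_
      rw [((hw α hα).sub (isWeakDeriv_testToL2 α (v k))).weakDeriv_eq]
    obtain ⟨k, hk⟩ := (h1.eventually_lt_const (sq_pos_of_pos hε)).exists
    exact ⟨v k, lt_of_pow_lt_pow_left₀ 2 hε.le hk⟩
  · simp only [sobolevNorm_sq]
    refine tendsto_finsetSum _ fun α hα => ?_
    simp only [(isWeakDeriv_testToL2 α _).weakDeriv_eq, (hw α hα).weakDeriv_eq]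
    exact (hg α hα).norm.pow 2

end

end WeylPDO

end

noncomputable section

namespace WeylPDO

/-! ### Compactness -/

section

variable {n m : ℕ} {X : Opens (Euc n)}

theorem norm_osc_sub_le (x ξ η : Euc n) : ‖osc x ξ - osc x η‖ ≤ ‖x‖ * ‖ξ - η‖ := by
  have h1 : osc x ξ - osc x η = osc x η *
      (Complex.exp (Complex.I * ((inner ℝ x (ξ - η) : ℝ) : ℂ)) - 1) := by
    simp only [osc, mul_sub, ← Complex.exp_add, inner_sub_right]
    congr 2
    · push_cast
      ring
    · ring
  rw [h1, norm_mul, norm_osc, one_mul]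
  exact Real.norm_exp_I_mul_ofReal_sub_one_le.trans (norm_inner_le_norm x (ξ - η))

theorem isFiniteMeasure_restrict (hX : Bornology.IsBounded (X : Set (Euc n))) :
    IsFiniteMeasure ((volume : Measure (Euc n)).restrict (X : Set (Euc n))) :=
  ⟨by simpa using hX.measure_lt_top⟩

theorem memLp_osc (hX : Bornology.IsBounded (X : Set (Euc n))) (ξ : Euc n) :
    MemLp (fun x => osc x ξ) 2 ((volume : Measure (Euc n)).restrict (X : Set (Euc n))) := by
  have := isFiniteMeasure_restrict hX
  exact MemLp.of_bound (by fun_prop : Continuous fun x => osc x ξ).aestronglyMeasurable 1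
    (ae_of_all _ fun x => (norm_osc x ξ).le)

/-- The function `x ↦ e^{i x·ξ}` in `L²(X)`. -/
def oscL2 (hX : Bornology.IsBounded (X : Set (Euc n))) (ξ : Euc n) : L2 X := (memLp_osc hX ξ).toLp

theorem inner_oscL2 (hX : Bornology.IsBounded (X : Set (Euc n))) (ξ : Euc n) (φ : 𝓓(X, ℂ)) :
    inner ℂ (oscL2 hX ξ) (testToL2 X φ) = fourierInt φ ξ := by
  rw [← inner_conj_symm, oscL2, inner_testToL2_toLp, integral_osc_mul_conj_testFunction,
    Complex.conj_conj]

/-- On a bounded set the exponentials depend on the frequency in a uniformly Lipschitz way. Hence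
those with frequency in a closed ball form a compact subset of `L²(X)`. -/
theorem continuous_oscL2 (hX : Bornology.IsBounded (X : Set (Euc n))) :
    Continuous (oscL2 hX) := by
  have := isFiniteMeasure_restrict hX
  obtain ⟨B, hB0, hB⟩ := hX.exists_pos_norm_le
  rw [continuous_iff_continuousAt]
  intro η
  rw [ContinuousAt, tendsto_iff_norm_sub_tendsto_zero]
  have hlim : Tendsto (fun ξ : Euc n => (measureUnivNNReal ((volume : Measure (Euc n)).restrict
      (X : Set (Euc n))) : ℝ) ^ (2 : ENNReal).toReal⁻¹ * (B * ‖ξ - η‖)) (𝓝 η) (𝓝 0) := by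
    have h : Continuous fun ξ : Euc n => (measureUnivNNReal ((volume : Measure (Euc n)).restrict
      (X : Set (Euc n))) : ℝ) ^ (2 : ENNReal).toReal⁻¹ * (B * ‖ξ - η‖) := by fun_prop
    simpa using h.tendsto η
  refine squeeze_zero (fun _ => norm_nonneg _) (fun ξ => ?_) hlim
  refine Lp.norm_le_of_ae_bound (by positivity) ?_
  filter_upwards [Lp.coeFn_sub (oscL2 hX ξ) (oscL2 hX η), (memLp_osc hX ξ).coeFn_toLp,
    (memLp_osc hX η).coeFn_toLp, ae_restrict_mem X.isOpen.measurableSet] with x h1 h2 h3 hx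
  rw [h1, Pi.sub_apply, oscL2, oscL2, h2, h3]
  exact (norm_osc_sub_le x ξ η).trans (by gcongr; exact hB x hx)

/-- Plancherel splits the norm at frequency `r`. Above it the weight is large, so the energy term
takes over. Below it the transform is a pairing with an exponential in `L²(X)`, and a finite net of
the compact family of exponentials replaces them all, up to a small multiple of the norm that is
moved to the left side. -/
theorem exists_finset_norm_sq_le (hX : Bornology.IsBounded (X : Set (Euc n))) (hm : 0 < m) {δ : ℝ}
    (hδ : 0 < δ) : ∃ (s : Finset (L2 X)) (C : ℝ), ∀ φ : 𝓓(X, ℂ),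
      ‖testToL2 X φ‖ ^ 2 ≤ C * ∑ e ∈ s, ‖inner ℂ e (testToL2 X φ)‖ ^ 2 + δ * fourierEnergy m φ := by
  set T : ℝ := (2 * Real.pi) ^ n with hT
  have hT0 : 0 < T := by positivity
  -- With this radius `T δ / 2` times the weight is at least `1` outside the ball.
  set r : ℝ := 2 / (T * δ) with hr
  have hr0 : 0 < r := by positivity
  set B : Set (Euc n) := Metric.closedBall 0 r with hB
  have hBm : MeasurableSet B := measurableSet_closedBall
  set V : ℝ := volume.real B with hV
  have hV0 : 0 ≤ V := measureReal_nonneg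
  -- The net contributes the error `2 V η² ‖u‖²`, which must be at most half of `T ‖u‖²`. The bound
  -- `η ≤ 1` lets `η²` be estimated by `η`.
  set η : ℝ := min 1 (T / (4 * (V + 1))) with hη
  have hη0 : 0 < η := by positivity
  have hη2 : 2 * V * η ^ 2 ≤ T / 2 := by
    have h1 : η ^ 2 ≤ η := by
      have := min_le_left (1 : ℝ) (T / (4 * (V + 1)))
      nlinarith
    calc 2 * V * η ^ 2 ≤ 2 * V * (T / (4 * (V + 1))) := by
          gcongr
          exact h1.trans (min_le_right _ _)
      _ ≤ 2 * (V + 1) * (T / (4 * (V + 1))) := by gcongr; linarith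
      _ = T / 2 := by field_simp; norm_num
  obtain ⟨t, -, htf, ht⟩ := ((isCompact_closedBall (0 : Euc n) r).image
    (continuous_oscL2 hX)).finite_cover_balls hη0
  refine ⟨htf.toFinset, 4 * V / T, fun φ => ?_⟩
  set u := testToL2 X φ with hu
  set Q : ℝ := ∑ e ∈ htf.toFinset, ‖inner ℂ e u‖ ^ 2 with hQ
  have hi0 := integrable_jap_mul_fourierInt_sq φ 0
  simp only [pow_zero, one_mul] at hi0
  have him := integrable_jap_mul_fourierInt_sq φ m
  have hin : ∀ ξ ∈ B, ‖fourierInt φ ξ‖ ^ 2 ≤ 2 * Q + 2 * η ^ 2 * ‖u‖ ^ 2 := by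
    intro ξ hξ
    obtain ⟨e, he, hd⟩ := Set.mem_iUnion₂.1 (ht (Set.mem_image_of_mem _ hξ))
    rw [Metric.mem_ball, dist_eq_norm] at hd
    have h1 : ‖fourierInt φ ξ‖ ≤ ‖inner ℂ e u‖ + η * ‖u‖ := by
      rw [← inner_oscL2 hX ξ φ, ← hu, ← sub_add_cancel (oscL2 hX ξ) e, inner_add_left, add_comm]
      refine (norm_add_le _ _).trans ?_
      gcongr
      exact (norm_inner_le_norm _ _).trans (by gcongr)
    have h2 : ‖inner ℂ e u‖ ^ 2 ≤ Q := Finset.single_le_sum (f := fun e => ‖inner ℂ e u‖ ^ 2)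
      (fun _ _ => sq_nonneg _) (htf.mem_toFinset.2 he)
    calc ‖fourierInt φ ξ‖ ^ 2 ≤ (‖inner ℂ e u‖ + η * ‖u‖) ^ 2 := by gcongr
      _ ≤ 2 * ‖inner ℂ e u‖ ^ 2 + 2 * η ^ 2 * ‖u‖ ^ 2 := by
        nlinarith [sq_nonneg (‖inner ℂ e u‖ - η * ‖u‖)]
      _ ≤ _ := by gcongr
  have hout : ∀ ξ ∈ Bᶜ, ‖fourierInt φ ξ‖ ^ 2 ≤ T * δ / 2 * (jap ξ ^ m * ‖fourierInt φ ξ‖ ^ 2) := by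
    intro ξ hξ
    have h1 : r < ‖ξ‖ := by simpa [hB] using hξ
    have h2 : r ≤ jap ξ ^ m := by
      refine le_trans ?_ (le_self_pow₀ (one_le_jap ξ) hm.ne')
      unfold jap
      nlinarith [sq_nonneg (‖ξ‖ - 1)]
    have h3 : 1 ≤ T * δ / 2 * jap ξ ^ m := by
      calc (1 : ℝ) = T * δ / 2 * r := by rw [hr]; field_simp
        _ ≤ _ := by gcongr
    rw [← mul_assoc]
    exact le_mul_of_one_le_left (sq_nonneg _) h3
  have hmain : T * ‖u‖ ^ 2 ≤ V * (2 * Q + 2 * η ^ 2 * ‖u‖ ^ 2) + T * δ / 2 * fourierEnergy m φ := by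
    rw [hu, norm_testToL2_sq, ← integral_norm_sq_fourierInt, ← integral_add_compl hBm hi0,
      ← norm_testToL2_sq]
    gcongr
    · calc ∫ ξ in B, ‖fourierInt φ ξ‖ ^ 2 ≤ ∫ ξ in B, (2 * Q + 2 * η ^ 2 * ‖u‖ ^ 2) :=
          setIntegral_mono_on hi0.integrableOn
            (integrableOn_const (measure_closedBall_lt_top.ne)) hBm hin
        _ = _ := by rw [setIntegral_const, smul_eq_mul]
    · calc ∫ ξ in Bᶜ, ‖fourierInt φ ξ‖ ^ 2
          ≤ ∫ ξ in Bᶜ, T * δ / 2 * (jap ξ ^ m * ‖fourierInt φ ξ‖ ^ 2) :=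
          setIntegral_mono_on hi0.integrableOn (him.const_mul _).integrableOn hBm.compl hout
        _ ≤ ∫ ξ, T * δ / 2 * (jap ξ ^ m * ‖fourierInt φ ξ‖ ^ 2) :=
          setIntegral_le_integral (him.const_mul _) (ae_of_all _ fun ξ => by
            have := pow_pos (jap_pos ξ) m
            positivity)
        _ = _ := integral_const_mul _ _
  have h4 : T / 2 * ‖u‖ ^ 2 ≤ 2 * V * Q + T * δ / 2 * fourierEnergy m φ := by
    nlinarith [mul_le_mul_of_nonneg_right hη2 (sq_nonneg ‖u‖)]
  have h5 : 4 * V / T * Q + δ * fourierEnergy m φ =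
      (2 * V * Q + T * δ / 2 * fourierEnergy m φ) / (T / 2) := by
    field_simp
    ring
  rw [h5, le_div_iff₀ (by positivity)]
  linarith

/-- In finite dimension the dense subspace of test functions would be everything, so the constant
`1` would agree on `X` with a test function. Its support would then be `X`, making `X` clopen and
hence all of `ℝⁿ`, which is unbounded for `n > 0`. -/
theorem not_finiteDimensional_L2 (hX : Bornology.IsBounded (X : Set (Euc n))) (hn : 0 < n)
    (hne : (X : Set (Euc n)).Nonempty) : ¬ FiniteDimensional ℂ (L2 X) := by
  intro hfd
  have := isFiniteMeasure_restrict hX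
  have : Nonempty (Fin n) := ⟨⟨0, hn⟩⟩
  have htop : LinearMap.range (testToL2 X) = ⊤ := by
    rw [← Submodule.dense_iff_topologicalClosure_eq_top.1 (denseRange_testToL2 X)]
    exact ((Submodule.closed_of_finiteDimensional _).submodule_topologicalClosure_eq).symm
  have h1 : MemLp (fun _ : Euc n => (1 : ℂ)) 2
      ((volume : Measure (Euc n)).restrict (X : Set (Euc n))) :=
    memLp_const 1
  obtain ⟨φ, hφ⟩ : h1.toLp ∈ LinearMap.range (testToL2 X) := htop ▸ Submodule.mem_top
  have hae : φ =ᵐ[(volume : Measure (Euc n)).restrict (X : Set (Euc n))] fun _ => (1 : ℂ) := by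
    refine (coeFn_testToL2 φ).symm.trans ?_
    rw [hφ]
    exact h1.coeFn_toLp
  have heq := Measure.eqOn_open_of_ae_eq hae X.isOpen φ.continuous.continuousOn
    continuous_const.continuousOn
  have hsupp : tsupport φ = (X : Set (Euc n)) := by
    refine φ.tsupport_subset.antisymm fun x hx => subset_tsupport _ ?_
    rw [Function.mem_support, heq hx]
    exact one_ne_zero
  have hclopen : IsClopen (X : Set (Euc n)) := ⟨hsupp ▸ isClosed_tsupport φ, X.isOpen⟩
  have huniv := hclopen.eq_univ hne
  rw [huniv] at hX
  exact NormedSpace.unbounded_univ ℝ (Euc n) hX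

end

end WeylPDO

end

/-! ### The Friedrichs extension of the elliptic operator -/

theorem mainTheorem2 {n m : ℕ} (hn : 0 < n) (hm : 0 < m)
    (X : Opens (Euc n)) (hXb : Bornology.IsBounded (X : Set (Euc n)))
    (hXne : (X : Set (Euc n)).Nonempty)
    (σ : ClassicalSymbol n (2 * m)) (hsymm : σ.IsSymmetric)
    (hell : ∃ C₀ : ℝ, 0 < C₀ ∧ ∀ x ∈ X, ∀ ξ : Euc n, ξ ≠ 0 →
      (σ.principal x ξ).im = 0 ∧ C₀ * ‖ξ‖ ^ (2 * m) ≤ (σ.principal x ξ).re) :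
    let S : L2 X →ₗ.[ℂ] L2 X := resOpExt σ X hXb
    let A : L2 X →ₗ.[ℂ] L2 X := friedrichsExtension S
    (S ≤ A ∧ IsSelfAdjoint A) ∧
    HasCompactResolvent A ∧
    HasDiscreteSpectrum A ∧
    (∀ u ∈ A.domain, u ∈ sobolevZero X m) ∧
    ∃ C M : ℝ, 0 < C ∧ 0 < M ∧ ∀ u : A.domain,
      C * sobolevNorm m (u : L2 X) ^ 2 ≤
        (inner ℂ (u : L2 X) (A u + (M : ℂ) • (u : L2 X))).re := by
  intro S A
  obtain ⟨C₀, hC₀, hell⟩ := hell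
  obtain ⟨c, M, hc, hM, hS, hcE⟩ := σ.isSemibounded_resOpExt hXb hn hm hC₀
    (fun x hx ξ hξ => (hell x hx ξ hξ).2) hsymm
  obtain ⟨hSA, hsa, ⟨R, hRs, hR⟩, happrox⟩ := hS.friedrichs (denseRange_testToL2 X)
  -- The abstract approximation, rewritten for test functions: by Gårding's inequality, sequences
  -- that are Cauchy in the operator's energy are also Cauchy in the Fourier energy.
  have happrox' : ∀ u : A.domain, ∃ φ : ℕ → 𝓓(X, ℂ),
      Tendsto (fun k => testToL2 X (φ k)) atTop (𝓝 u) ∧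
      Tendsto (fun p : ℕ × ℕ => fourierEnergy m (φ p.1 - φ p.2 : 𝓓(X, ℂ))) atTop (𝓝 0) ∧
      Tendsto (fun k => (inner ℂ (testToDomain σ hXb (φ k) : L2 X)
        (energyOp S M (testToDomain σ hXb (φ k)))).re) atTop
        (𝓝 (inner ℂ (u : L2 X) (A u + (M : ℂ) • (u : L2 X))).re) := by
    intro u
    obtain ⟨v, hv, hcau, hlim⟩ := happrox u
    choose φ hφ using fun k => exists_testToDomain σ hXb (v k)
    obtain rfl : v = fun k => testToDomain σ hXb (φ k) := funext hφ
    refine ⟨φ, hv, ?_, hlim⟩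
    have h0 := hcau.const_mul c⁻¹
    rw [mul_zero] at h0
    refine squeeze_zero (fun p => fourierEnergy_nonneg m _) (fun p => ?_) h0
    have h1 : testToDomain σ hXb (φ p.1) - testToDomain σ hXb (φ p.2) =
        testToDomain σ hXb (φ p.1 - φ p.2) :=
      Subtype.ext (map_sub (testToL2 X) (φ p.1) (φ p.2)).symm
    rw [h1, ← div_eq_inv_mul, le_div_iff₀ hc, mul_comm]
    exact hcE _
  have hpos : ∀ u : A.domain,
      ‖(u : L2 X)‖ ^ 2 ≤ (inner ℂ (u : L2 X) (A u + (M : ℂ) • (u : L2 X))).re := by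
    intro u
    obtain ⟨φ, hφ, -, hlim⟩ := happrox' u
    refine le_of_tendsto_of_tendsto' (hφ.norm.pow 2) hlim fun k => ?_
    rw [re_inner_energyOp]
    exact hS.bound (testToDomain σ hXb (φ k))
  have hRA : ∀ f, ∃ u : A.domain, (u : L2 X) = R f ∧ A u + (M : ℂ) • (u : L2 X) = f := by
    intro f
    obtain ⟨hmem, hf⟩ := hR.1 f
    refine ⟨⟨R f, hmem⟩, rfl, ?_⟩
    rw [Complex.ofReal_neg, neg_smul, sub_neg_eq_add] at hf
    exact hf
  -- Passing to the limit in the finite-rank Rellich inequality for `R f` replaces the energy by `Re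
  -- (R f, f) ≤ ‖R‖ ‖f‖²`. If `R f` is orthogonal to the finitely many test vectors, only that term
  -- is left, and `δ` is chosen so that it is at most `ε² ‖f‖²`.
  have hcomp : IsCompactOperator R := by
    refine isCompactOperator_of_forall_finiteDimensional fun ε hε => ?_
    obtain ⟨s, C, hs⟩ := exists_finset_norm_sq_le hXb hm
      (δ := c * (ε ^ 2 / (‖R‖ + 1))) (by positivity)
    refine ⟨Submodule.span ℂ (s : Set (L2 X)), inferInstance, fun f hf => ?_⟩
    obtain ⟨u, hu, huf⟩ := hRA f
    obtain ⟨φ, hφ, -, hlim⟩ := happrox' u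
    rw [huf, hu] at hlim
    rw [hu] at hφ
    have h1 : ‖R f‖ ^ 2 ≤ C * ∑ e ∈ s, ‖inner ℂ e (R f)‖ ^ 2 +
        ε ^ 2 / (‖R‖ + 1) * (inner ℂ (R f) f).re := by
      refine le_of_tendsto_of_tendsto' (hφ.norm.pow 2)
        (((tendsto_finsetSum _ fun e _ =>
          ((tendsto_const_nhds (x := e)).inner hφ).norm.pow 2).const_mul C).add
          (hlim.const_mul _)) fun k => (hs (φ k)).trans ?_
      rw [mul_comm c, mul_assoc]
      gcongr
      exact hcE (φ k)
    have h2 : ∑ e ∈ s, ‖inner ℂ e (R f)‖ ^ 2 = 0 := Finset.sum_eq_zero fun e he => by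
      rw [(Submodule.mem_orthogonal _ _).1 hf e (Submodule.subset_span he)]
      simp
    have h3 : (inner ℂ (R f) f).re ≤ (‖R‖ + 1) * ‖f‖ ^ 2 := by
      calc (inner ℂ (R f) f).re ≤ ‖inner ℂ (R f) f‖ := Complex.re_le_norm _
        _ ≤ ‖R f‖ * ‖f‖ := norm_inner_le_norm _ _
        _ ≤ ‖R‖ * ‖f‖ * ‖f‖ := by gcongr; exact R.le_opNorm f
        _ ≤ _ := by nlinarith [sq_nonneg ‖f‖]
    have h4 : ‖R f‖ ^ 2 ≤ (ε * ‖f‖) ^ 2 := by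
      rw [h2, mul_zero, zero_add] at h1
      calc ‖R f‖ ^ 2 ≤ ε ^ 2 / (‖R‖ + 1) * ((‖R‖ + 1) * ‖f‖ ^ 2) := h1.trans (by gcongr)
        _ = (ε * ‖f‖) ^ 2 := by
          field_simp
    exact le_of_sq_le_sq h4 (by positivity)
  refine ⟨⟨hSA, hsa⟩, hasCompactResolvent_of_isCompactOperator hR hcomp,
    hasDiscreteSpectrum_of_isCompactOperator hR hcomp hRs hpos
      (not_finiteDimensional_L2 hXb hn hXne), fun u hu => ?_, ?_⟩
  · obtain ⟨φ, hφ, hcau, -⟩ := happrox' ⟨u, hu⟩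
    exact (mem_sobolevZero_of_tendsto hφ hcau).1
  -- `B` bounds the squared Sobolev norm of test functions by their Fourier energy; the summand `1`
  -- ensures positivity. The coercive estimate holds for the approximating test functions, and both
  -- of its sides converge.
  · set B : ℝ := (multiIndices n m).card * ((2 * Real.pi) ^ n)⁻¹ + 1 with hB
    have hB0 : 0 < B := by positivity
    refine ⟨c / B, M, by positivity, hM, fun u => ?_⟩
    obtain ⟨φ, hφ, hcau, hlim⟩ := happrox' u
    refine le_of_tendsto_of_tendsto' ((mem_sobolevZero_of_tendsto hφ hcau).2.const_mul (c / B))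
      hlim fun k => le_trans ?_ (hcE (φ k))
    rw [div_mul_eq_mul_div, div_le_iff₀ hB0, mul_assoc]
    gcongr
    have h1 := sobolevNorm_testToL2_sq_le m (φ k)
    have h2 := fourierEnergy_nonneg m (φ k)
    rw [hB]
    nlinarith
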